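/- Fix a universe and let $\mathfrak{Cat}$ be the 2-category of small categories. For small (strict) 2-categories $\mathfrak G,\mathcal E$, let $[\mathcal E,\mathfrak{Cat}]$ be the 2-category of 2-functors, 2-natural transformations and modifications, and $\mathrm{Ps}(\mathfrak G,\mathfrak{Cat})$ the 2-category of 2-functors $\mathfrak G\to\mathfrak{Cat}$, pseudo-natural transformations and modifications. A 2-functor $G:\mathcal E\to\mathfrak{Cat}$ is cofibrant if it is so for the projective model structure on $[\mathcal E,\mathfrak{Cat}]$, that is, if 2-natural transformations out of $G$ lift strictly through the 2-natural transformations that are pointwise both an equivalence of categories and an isofibration. A weighted homotopy limit 2-sketch $\mathcal S=(\mathfrak G,\mathcal P)$ is a small 2-category $\mathfrak G$ with a (small) set $\mathcal P$ of cones $(\mathcal E,F,G,L,\gamma)$, where $\mathcal E$ is a small 2-category, $F:\mathcal E\to\mathfrak G$ and $G:\mathcal E\to\mathfrak{Cat}$ are 2-functors with $G$ cofibrant, $L$ is an object of $\mathfrak G$ and $\gamma:G\Rightarrow\mathfrak G(L,F-)$ is 2-natural. In a 2-category $\mathfrak C$, a 2-natural $\gamma:G\Rightarrow\mathfrak C(L,F-)$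 exhibits $L$ as the weighted homotopy 2-limit $\{G,F\}_h$ if for every object $D$ the induced functor $\mathfrak C(D,L)\to[\mathcal E,\mathfrak{Cat}](G,\mathfrak C(D,F-))$ is an equivalence of categories; dually, for a contravariant 2-functor $F$ from $\mathcal E$ to $\mathfrak C$, a 2-natural $\kappa:G\Rightarrow\mathfrak C(F-,P)$ exhibits $P$ as the weighted homotopy 2-colimit $G\star_hF$ if every induced functor $\mathfrak C(P,D)\to[\mathcal E,\mathfrak{Cat}](G,\mathfrak C(F-,D))$ is an equivalence. A homotopy model of $\mathcal S$ is a 2-functor $M:\mathfrak G\to\mathfrak{Cat}$ such that for every cone of $\mathcal P$ the induced $G\Rightarrow\mathfrak{Cat}(ML,MF-)$ exhibits $ML$ as $\{G,MF\}_h$; $\mathfrak{hMod}^{ps}_{\mathcal S}$ is the full 2-subcategory of $\mathrm{Ps}(\mathfrak G,\mathfrak{Cat})$ spanned by the homotopy models. An object $X$ of a 2-category $\mathfrak C$ is homotopy orthogonal to $f:A\to A'$ if $\mathfrak C(f,X):\mathfrak C(A',X)\to\mathfrak C(A,X)$ is an equivalence of categories; a full 2-subcategory of $\mathfrak C$ is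 homotopy orthogonal if, for some (small) set $\Sigma$ of 1-morphisms, its objects are exactly the objects homotopy orthogonal to every element of $\Sigma$. **Lemma.** Let $\mathcal S=(\mathfrak G,\mathcal P)$ be a weighted homotopy limit 2-sketch and let $Y(a)=\mathfrak G(a,-)$ denote the contravariant Yoneda embedding of $\mathfrak G$, with values in $\mathrm{Ps}(\mathfrak G,\mathfrak{Cat})$. Then $\mathfrak{hMod}^{ps}_{\mathcal S}$ is a homotopy orthogonal subcategory of $\mathrm{Ps}(\mathfrak G,\mathfrak{Cat})$. More precisely: 1. For each cone $(\mathcal E,F,G,L,\gamma)\in\mathcal P$ the weighted homotopy 2-colimit $G\star_hY(F-)$ exists in $\mathrm{Ps}(\mathfrak G,\mathfrak{Cat})$, and there is a 1-morphism $\rho:G\star_hY(F-)\to Y(L)$ corresponding, up to isomorphism, to $Y(\gamma):G\Rightarrow\mathrm{Ps}(\mathfrak G,\mathfrak{Cat})(Y(F-),Y(L))$. 2. For any choice of such a $\rho$ for each cone of $\mathcal P$, a 2-functor $M:\mathfrak G\to\mathfrak{Cat}$ is a homotopy model of $\mathcal S$ if and only if it is homotopy orthogonal in $\mathrm{Ps}(\mathfrak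 G,\mathfrak{Cat})$ to all these $\rho$; equivalently, if and only if for every small category $D$ the 2-functor $[D,M-]$ is homotopy orthogonal to all these $\rho$. -/

import Mathlib

open CategoryTheory Bicategory Opposite
open scoped Pseudofunctor.StrongTrans Bicategory.Opposite

universe u v

namespace HSketch

/-- A morphism is an identity, up to an equality between its source and its target. -/
def IsId {C : Type*} [Category* C] {X Y : C} (f : X ⟶ Y) : Prop :=
  ∃ h : X = Y, f = eqToHom h

namespace IsId

lemma eq {C : Type*} [Category* C] {X Y : C} {f g : X ⟶ Y} (hf : IsId f) (hg : IsId g) :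
    f = g := by
  obtain ⟨h, rfl⟩ := hf
  obtain ⟨_, rfl⟩ := hg
  rfl

lemma eqToHom {C : Type*} [Category* C] {X Y : C} (h : X = Y) : IsId (eqToHom h) := ⟨h, rfl⟩

lemma id {C : Type*} [Category* C] (X : C) : IsId (𝟙 X) := ⟨rfl, rfl⟩

lemma comp {C : Type*} [Category* C] {X Y Z : C} {f : X ⟶ Y} {g : Y ⟶ Z} (hf : IsId f)
    (hg : IsId g) : IsId (f ≫ g) := by
  obtain ⟨h, rfl⟩ := hf
  obtain ⟨h', rfl⟩ := hg
  exact ⟨h.trans h', eqToHom_trans _ _⟩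

lemma inv {C : Type*} [Category* C] {X Y : C} {f : X ≅ Y} (hf : IsId f.hom) : IsId f.inv := by
  obtain ⟨h, hf⟩ := hf
  subst h
  exact ⟨rfl, by simpa [hf] using f.hom_inv_id⟩

lemma iso_eq {C : Type*} [Category* C] {X Y : C} {f : X ≅ Y} (hf : IsId f.hom) (h : X = Y) :
    f = eqToIso h :=
  Iso.ext (hf.eq ⟨h, rfl⟩)

lemma map {C D : Type*} [Category* C] [Category* D] (F : C ⥤ D) {X Y : C} {f : X ⟶ Y}
    (hf : IsId f) : IsId (F.map f) := by
  obtain ⟨h, rfl⟩ := hf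
  exact ⟨congrArg F.obj h, eqToHom_map F h⟩

section

variable {B : Type*} [Bicategory B] {a b c d : B}

lemma whiskerLeft (f : a ⟶ b) {g h : b ⟶ c} {η : g ⟶ h} (hη : IsId η) : IsId (f ◁ η) := by
  obtain ⟨h, rfl⟩ := hη
  exact ⟨_, whiskerLeft_eqToHom f h⟩

lemma whiskerRight {f g : a ⟶ b} {η : f ⟶ g} (hη : IsId η) (h : b ⟶ c) : IsId (η ▷ h) := by
  obtain ⟨e, rfl⟩ := hη
  exact ⟨_, eqToHom_whiskerRight e h⟩

variable [Strict B]

lemma leftUnitor (f : a ⟶ b) : IsId (λ_ f).hom :=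
  ⟨Strict.id_comp f, by rw [Strict.leftUnitor_eqToIso]; rfl⟩

lemma rightUnitor (f : a ⟶ b) : IsId (ρ_ f).hom :=
  ⟨Strict.comp_id f, by rw [Strict.rightUnitor_eqToIso]; rfl⟩

lemma associator (f : a ⟶ b) (g : b ⟶ c) (h : c ⟶ d) : IsId (α_ f g h).hom :=
  ⟨Strict.assoc f g h, by rw [Strict.associator_eqToIso]; rfl⟩

end

end IsId

section TwoNatural

variable {E : Type u} [Bicategory.{u, u} E]

/-- The pseudo-natural transformations between two 2-functors which are 2-natural: every structure
2-cell is an identity. -/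
def isTwoNatural (G H : StrictPseudofunctor E Cat.{u, u}) :
    ObjectProperty (G.toPseudofunctor ⟶ H.toPseudofunctor) :=
  fun t => ∀ ⦃a b : E⦄ (f : a ⟶ b), IsId (t.naturality f).hom

/-- The category `[E, Cat](G, H)` of 2-natural transformations and modifications. -/
abbrev TwoNat (G H : StrictPseudofunctor E Cat.{u, u}) : Type u :=
  (isTwoNatural G H).FullSubcategory

lemma isTwoNatural_comp {G H K : StrictPseudofunctor E Cat.{u, u}}
    {s : G.toPseudofunctor ⟶ H.toPseudofunctor} {t : H.toPseudofunctor ⟶ K.toPseudofunctor}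
    (hs : isTwoNatural G H s) (ht : isTwoNatural H K t) : isTwoNatural G K (s ≫ t) := by
  intro a b f
  rw [Pseudofunctor.StrongTrans.categoryStruct_comp_naturality_hom]
  exact (IsId.associator _ _ _).inv.comp (((hs f).whiskerRight _).comp
    ((IsId.associator _ _ _).comp (((ht f).whiskerLeft _).comp (IsId.associator _ _ _).inv)))

lemma isTwoNatural_id (G : StrictPseudofunctor E Cat.{u, u}) :
    isTwoNatural G G (𝟙 G.toPseudofunctor) := by
  intro a b f
  rw [Pseudofunctor.StrongTrans.categoryStruct_id_naturality_hom]
  exact (IsId.rightUnitor _).comp (IsId.leftUnitor _).inv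

end TwoNatural

section Strictness

variable {B : Type u} [Bicategory.{u, u} B]

lemma strongTrans_ext {F G : B ⥤ᵖ Cat.{u, u}} {s t : F ⟶ G}
    (h : ∀ a, s.app a = t.app a)
    (h' : ∀ ⦃a b : B⦄ (f : a ⟶ b), (s.naturality f).hom ≫ eqToHom (by rw [h a]) =
      eqToHom (by rw [h b]) ≫ (t.naturality f).hom) : s = t := by
  obtain ⟨s₁, s₂, _, _, _⟩ := s
  obtain ⟨t₁, t₂, _, _, _⟩ := t
  obtain rfl : s₁ = t₁ := funext h
  have : @s₂ = @t₂ := by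
    funext a b f
    ext1
    simpa using h' f
  subst this
  rfl

lemma isId_modification {F G : B ⥤ᵖ Cat.{u, u}} {s t : F ⟶ G} (m : s ⟶ t) 
    (h : ∀ a, IsId (m.as.app a)) : IsId m := by
  have e : s = t := by
    refine strongTrans_ext (fun a => (h a).1) fun a b f => ?_
    have := m.as.naturality f
    obtain ⟨h₁, e₁⟩ := h a
    obtain ⟨h₂, e₂⟩ := h b
    rw [e₁, e₂] at this
    simp at this
    exact this.symm
  subst e
  refine ⟨rfl, ?_⟩
  ext a : 1
  exact (h a).eq ⟨rfl, rfl⟩ 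

lemma twoNatural_ext {G H : StrictPseudofunctor B Cat.{u, u}}
    {s t : G.toPseudofunctor ⟶ H.toPseudofunctor} (hs : isTwoNatural G H s)
    (ht : isTwoNatural G H t) (h : ∀ a, s.app a = t.app a) : s = t :=
  strongTrans_ext h fun _ _ f => ((hs f).comp (IsId.eqToHom _)).eq ((IsId.eqToHom _).comp (ht f))

instance strictPseudofunctorCat : Strict (B ⥤ᵖ Cat.{u, u}) :=
  have h₁ {F G : B ⥤ᵖ Cat.{u, u}} (f : F ⟶ G) : IsId (λ_ f).hom :=
    isId_modification _ fun a => IsId.leftUnitor (f.app a)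
  have h₂ {F G : B ⥤ᵖ Cat.{u, u}} (f : F ⟶ G) : IsId (ρ_ f).hom :=
    isId_modification _ fun a => IsId.rightUnitor (f.app a)
  have h₃ {F G H K : B ⥤ᵖ Cat.{u, u}} (f : F ⟶ G) (g : G ⟶ H) (h : H ⟶ K) :
      IsId (α_ f g h).hom :=
    isId_modification _ fun a => IsId.associator (f.app a) (g.app a) (h.app a)
  { id_comp f := (h₁ f).1
    comp_id f := (h₂ f).1
    assoc f g h := (h₃ f g h).1
    leftUnitor_eqToIso f := (h₁ f).iso_eq _
    rightUnitor_eqToIso f := (h₂ f).iso_eq _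
    associator_eqToIso f g h := (h₃ f g h).iso_eq _ }

instance strictOp {B : Type v} [Bicategory.{u, u} B] [Strict B] : Strict Bᵒᵖ :=
  have h {a b : B} {f g : a ⟶ b} {η : f ⟶ g} (hη : IsId η) : IsId (op2 η) :=
    hη.map (opFunctor a b)
  { id_comp f := Quiver.Hom.unop_inj (Strict.comp_id f.unop)
    comp_id f := Quiver.Hom.unop_inj (Strict.id_comp f.unop)
    assoc f g h := Quiver.Hom.unop_inj (Strict.assoc h.unop g.unop f.unop).symm
    leftUnitor_eqToIso f := (h (IsId.rightUnitor f.unop)).iso_eq _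
    rightUnitor_eqToIso f := (h (IsId.leftUnitor f.unop)).iso_eq _
    associator_eqToIso f g k := 
      (h (IsId.associator k.unop g.unop f.unop).inv).iso_eq _ }

/-- The 2-category `Ps(B, Cat)` of 2-functors `B → Cat`, pseudo-natural transformations and
modifications. -/
abbrev Ps (B : Type u) [Bicategory.{u, u} B] : Type (u + 1) :=
  InducedBicategory (B ⥤ᵖ Cat.{u, u})
    (fun M : StrictPseudofunctor B Cat.{u, u} => M.toPseudofunctor)

end Strictness

lemma isId_cat {X Y : Cat.{u, u}} {f g : X ⟶ Y} (η : f ⟶ g)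
    (h : ∀ x, IsId (η.toNatTrans.app x)) : IsId η := by
  have e : f = g := by
    refine Cat.ext (CategoryTheory.Functor.ext (fun x => (h x).1) fun x y k => ?_)
    have := η.toNatTrans.naturality k
    obtain ⟨h₁, e₁⟩ := h x
    obtain ⟨h₂, e₂⟩ := h y
    rw [e₁, e₂] at this
    simp [← reassoc_of% this]
  subst e
  refine ⟨rfl, ?_⟩
  ext x : 3
  exact (h x).eq ⟨rfl, rfl⟩

lemma IsId.app {X Y : Cat.{u, u}} {f g : X ⟶ Y} {η : f ⟶ g} (h : IsId η) (x : X) :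
    IsId (η.toNatTrans.app x) := by
  obtain ⟨h, rfl⟩ := h
  exact ⟨_, Cat.eqToHom_app f g h x⟩

section

variable {E : Type*} [Bicategory E] {C : Type*} [Bicategory C]

lemma IsId.mapId (F : StrictPseudofunctor E C) (a : E) : IsId (F.mapId a).hom :=
  ⟨F.map_id a, by rw [F.mapId_eq_eqToIso]; rfl⟩

lemma IsId.mapComp (F : StrictPseudofunctor E C) {a b c : E} (f : a ⟶ b) (g : b ⟶ c) :
    IsId (F.mapComp f g).hom :=
  ⟨F.map_comp f g, by rw [F.mapComp_eq_eqToIso]; rfl⟩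

end

section

variable {E : Type*} [Bicategory E] {C : Type*} [Bicategory C] (T : StrictPseudofunctor E C)

lemma map₂_whiskerRight_mapComp {a b c : E} {f g : a ⟶ b} (η : f ⟶ g) (h : b ⟶ c) :
    T.map₂ (η ▷ h) ≫ (T.mapComp g h).hom = (T.mapComp f h).hom ≫ T.map₂ η ▷ T.map h := by
  rw [T.map₂_whisker_right]
  simp

lemma map₂_whiskerLeft_mapComp {a b c : E} (f : a ⟶ b) {g h : b ⟶ c} (η : g ⟶ h) :
    T.map₂ (f ◁ η) ≫ (T.mapComp f h).hom = (T.mapComp f g).hom ≫ T.map f ◁ T.map₂ η := by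
  rw [T.map₂_whisker_left]
  simp

end

/-- Conjugating by identities. -/
lemma IsId.conj_eq {C : Type*} [Category* C] {X X' X'' Y Y' Y'' : C} {p : X ⟶ X'} {q : X'' ⟶ X'}
    {r : X ⟶ X''} {p' : Y' ⟶ Y} {q' : Y' ⟶ Y''} {r' : Y'' ⟶ Y} (hp : IsId p) (hq : IsId q)
    (hr : IsId r) (hp' : IsId p') (hq' : IsId q') (hr' : IsId r') (k : X' ⟶ Y') :
    p ≫ k ≫ p' = r ≫ (q ≫ k ≫ q') ≫ r' := by
  rw [hp.eq (hr.comp hq), hp'.eq (hq'.comp hr')]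
  simp only [Category.assoc]

lemma IsId.conj_eq' {C : Type*} [Category* C] {X X' Y Y' : C} {p r : X ⟶ X'} {p' r' : Y' ⟶ Y}
    (hp : IsId p) (hr : IsId r) (hp' : IsId p') (hr' : IsId r') (k : X' ⟶ Y') :
    p ≫ k ≫ p' = r ≫ k ≫ r' := by
  rw [hp.eq hr, hp'.eq hr']

section HomFunctor

variable {E : Type u} [Bicategory.{u, u} E] [Strict E]
  {C : Type v} [Bicategory.{u, u} C] [Strict C]

lemma postcomp_map_comp (D : C) (F : StrictPseudofunctor E C) {a b c : E} (f : a ⟶ b)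
    (g : b ⟶ c) : (postcomp D (F.map (f ≫ g))).toCatHom =
      (postcomp D (F.map f)).toCatHom ≫ (postcomp D (F.map g)).toCatHom :=
  (isId_cat (((postcomposing D _ _).map (F.mapComp f g).hom).toCatHom₂ ≫
      (associatorNatIsoLeftCat D (F.map f) (F.map g)).inv)
    (fun x => ((IsId.mapComp F f g).whiskerLeft x).comp (IsId.associator x _ _).inv)).1

lemma whiskerLeft_map₂_whiskerLeft {D : C} (F : StrictPseudofunctor E C) {a b c : E}
    (x : D ⟶ F.obj a) (f : a ⟶ b) {g h : b ⟶ c} (η : g ⟶ h)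
    {r : x ≫ F.map (f ≫ g) ⟶ (x ≫ F.map f) ≫ F.map g}
    {r' : (x ≫ F.map f) ≫ F.map h ⟶ x ≫ F.map (f ≫ h)} (hr : IsId r) (hr' : IsId r') :
    x ◁ F.map₂ (f ◁ η) = r ≫ (x ≫ F.map f) ◁ F.map₂ η ≫ r' := by
  rw [F.map₂_whisker_left, comp_whiskerLeft, whiskerLeft_comp, whiskerLeft_comp]
  exact IsId.conj_eq ((IsId.mapComp F f g).whiskerLeft x) (IsId.associator _ _ _) hr
    ((IsId.mapComp F f h).inv.whiskerLeft x) (IsId.associator _ _ _).inv hr' _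

lemma whiskerLeft_map₂_whiskerRight {D : C} (F : StrictPseudofunctor E C) {a b c : E}
    (x : D ⟶ F.obj a) {f g : a ⟶ b} (η : f ⟶ g) (h : b ⟶ c)
    {r : x ≫ F.map (f ≫ h) ⟶ (x ≫ F.map f) ≫ F.map h}
    {r' : (x ≫ F.map g) ≫ F.map h ⟶ x ≫ F.map (g ≫ h)} (hr : IsId r) (hr' : IsId r') :
    x ◁ F.map₂ (η ▷ h) = r ≫ (x ◁ F.map₂ η) ▷ F.map h ≫ r' := by
  rw [F.map₂_whisker_right, whisker_assoc, whiskerLeft_comp, whiskerLeft_comp]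
  exact IsId.conj_eq ((IsId.mapComp F f h).whiskerLeft x) (IsId.associator _ _ _) hr
    ((IsId.mapComp F g h).inv.whiskerLeft x) (IsId.associator _ _ _).inv hr' _

/-- The 2-functor `C(D, F-) : E → Cat`. -/
@[simps! obj map map₂]
def homFunctor (D : C) (F : StrictPseudofunctor E C) : StrictPseudofunctor E Cat.{u, u} :=
  StrictPseudofunctor.mk''
    { obj e := Cat.of (D ⟶ F.obj e)
      map f := (postcomposingCat D _ _).obj (F.map f)
      map₂ η := (postcomposingCat D _ _).map (F.map₂ η)
      map_id a := (isId_cat (((postcomposing D _ _).map (F.mapId a).hom).toCatHom₂ ≫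
          (rightUnitorNatIsoCat D (F.obj a)).hom)
        (fun x => ((IsId.mapId F a).whiskerLeft x).comp (IsId.rightUnitor x))).1
      map_comp := postcomp_map_comp D F
      map₂_whisker_left f g h η := by
        ext x : 3
        exact whiskerLeft_map₂_whiskerLeft F x f η
          ((IsId.eqToHom (postcomp_map_comp D F f g)).app x)
          ((IsId.eqToHom (postcomp_map_comp D F f h).symm).app x)
      map₂_whisker_right {_ _ _ f f'} η g := by
        ext x : 3
        exact whiskerLeft_map₂_whiskerRight F x η g
          ((IsId.eqToHom (postcomp_map_comp D F f g)).app x)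
          ((IsId.eqToHom (postcomp_map_comp D F f' g).symm).app x) }

/-- The structure 2-cells of `homFunctorMap`. -/
def homFunctorMapIso {D D' : C} (f : D ⟶ D') (F : StrictPseudofunctor E C) {a b : E} (g : a ⟶ b) :
    (homFunctor D' F).map g ≫ (precomposingCat D D' (F.obj b)).obj f ≅
      (precomposingCat D D' (F.obj a)).obj f ≫ (homFunctor D F).map g :=
  Cat.Hom.isoMk (NatIso.ofComponents (fun h => (α_ f h (F.map g)).symm)
    (fun η => (associator_inv_naturality_middle f η (F.map g))))

lemma isId_homFunctorMapIso {D D' : C} (f : D ⟶ D') (F : StrictPseudofunctor E C) {a b : E}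
    (g : a ⟶ b) : IsId (homFunctorMapIso f F g).hom :=
  isId_cat _ fun _ => (IsId.associator _ _ _).inv

/-- Precomposition with `f : D ⟶ D'`, as a 2-natural transformation `C(D', F-) ⟶ C(D, F-)`. -/
@[simps! app]
def homFunctorMap {D D' : C} (f : D ⟶ D') (F : StrictPseudofunctor E C) :
    (homFunctor D' F).toPseudofunctor ⟶ (homFunctor D F).toPseudofunctor where
  app e := (precomposingCat D D' (F.obj e)).obj f
  naturality g := homFunctorMapIso f F g
  naturality_naturality η := by
    ext x : 3
    exact associator_inv_naturality_right f x (F.map₂ η)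
  naturality_id a :=
    ((isId_homFunctorMapIso f F _).comp ((IsId.mapId (homFunctor D F) a).whiskerLeft _)).eq
      (((IsId.mapId (homFunctor D' F) a).whiskerRight _).comp
        ((IsId.leftUnitor _).comp (IsId.rightUnitor _).inv))
  naturality_comp g h :=
    ((isId_homFunctorMapIso f F _).comp ((IsId.mapComp (homFunctor D F) g h).whiskerLeft _)).eq
      (((IsId.mapComp (homFunctor D' F) g h).whiskerRight _).comp ((IsId.associator _ _ _).comp
        (((isId_homFunctorMapIso f F h).whiskerLeft _).comp ((IsId.associator _ _ _).inv.comp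
          (((isId_homFunctorMapIso f F g).whiskerRight _).comp (IsId.associator _ _ _))))))

lemma isTwoNatural_homFunctorMap {D D' : C} (f : D ⟶ D') (F : StrictPseudofunctor E C) :
    isTwoNatural _ _ (homFunctorMap f F) := fun _ _ g => isId_homFunctorMapIso f F g

/-- The modification `C(f, F-) ⟶ C(g, F-)` induced by a 2-cell `f ⟶ g`. -/
@[simps! as_app]
def homFunctorMap₂ {D D' : C} {f g : D ⟶ D'} (η : f ⟶ g) (F : StrictPseudofunctor E C) :
    homFunctorMap f F ⟶ homFunctorMap g F where
  as :=
    { app e := (precomposingCat D D' (F.obj e)).map η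
      naturality k := by
        ext x : 3
        exact associator_inv_naturality_left η x (F.map k) }

section

variable {C' : Type*} [Bicategory.{u, u} C'] [Strict C'] (L : C) (F : StrictPseudofunctor E C)
  (T : StrictPseudofunctor C C')

/-- The structure 2-cells of `homFunctorApply`. -/
def homFunctorApplyIso {a b : E} (g : a ⟶ b) :
    (homFunctor L F).map g ≫ (T.mapFunctor L (F.obj b)).toCatHom ≅
      (T.mapFunctor L (F.obj a)).toCatHom ≫ (homFunctor (T.obj L) (F.comp T)).map g :=
  Cat.Hom.isoMk (NatIso.ofComponents (fun x => T.mapComp x (F.map g)) fun k =>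
    
    map₂_whiskerRight_mapComp T k (F.map g))

lemma isId_homFunctorApplyIso {a b : E} (g : a ⟶ b) : IsId (homFunctorApplyIso L F T g).hom :=
  isId_cat _ fun x => IsId.mapComp T x (F.map g)

/-- The 2-natural transformation `C(L, F-) ⟶ C'(T L, T F-)` given by the action of the 2-functor `T`
on hom-categories. -/
@[simps! app]
def homFunctorApply :
    (homFunctor L F).toPseudofunctor ⟶ (homFunctor (T.obj L) (F.comp T)).toPseudofunctor where
  app e := (T.mapFunctor L (F.obj e)).toCatHom
  naturality g := homFunctorApplyIso L F T g
  naturality_naturality η := by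
    ext x : 3
    exact map₂_whiskerLeft_mapComp T x (F.map₂ η)
  naturality_id a :=
    ((isId_homFunctorApplyIso L F T _).comp
      ((IsId.mapId (homFunctor (T.obj L) (F.comp T)) a).whiskerLeft _)).eq
      (((IsId.mapId (homFunctor L F) a).whiskerRight _).comp
        ((IsId.leftUnitor _).comp (IsId.rightUnitor _).inv))
  naturality_comp g h :=
    ((isId_homFunctorApplyIso L F T _).comp
      ((IsId.mapComp (homFunctor (T.obj L) (F.comp T)) g h).whiskerLeft _)).eq
      (((IsId.mapComp (homFunctor L F) g h).whiskerRight _).comp ((IsId.associator _ _ _).comp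
        (((isId_homFunctorApplyIso L F T h).whiskerLeft _).comp ((IsId.associator _ _ _).inv.comp
          (((isId_homFunctorApplyIso L F T g).whiskerRight _).comp (IsId.associator _ _ _))))))

lemma isTwoNatural_homFunctorApply : isTwoNatural _ _ (homFunctorApply L F T) :=
  fun _ _ g => isId_homFunctorApplyIso L F T g

end

end HomFunctor

section Yoneda

variable (B : Type u) [Bicategory.{u, u} B]

variable {B} in
/-- A 2-functor `B → Cat` as an object of `Ps(B, Cat)`. -/
abbrev Ps.of (M : StrictPseudofunctor B Cat.{u, u}) : Ps B := M

variable {B} in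
/-- A pseudo-natural transformation as a 1-morphism of `Ps(B, Cat)`. -/
abbrev Ps.hom {M N : StrictPseudofunctor B Cat.{u, u}}
    (t : M.toPseudofunctor ⟶ N.toPseudofunctor) : Ps.of M ⟶ Ps.of N :=
  InducedBicategory.mkHom t

variable {B} in
/-- A modification as a 2-morphism of `Ps(B, Cat)`. -/
abbrev Ps.hom₂ {M N : StrictPseudofunctor B Cat.{u, u}}
    {s t : M.toPseudofunctor ⟶ N.toPseudofunctor} (m : s ⟶ t) : Ps.hom s ⟶ Ps.hom t :=
  InducedBicategory.mkHom₂ m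

variable {B} in
lemma Ps.op_ext {M N : (Ps B)ᵒᵖ} {s t : M ⟶ N} {m n : s ⟶ t}
    (h : ∀ a x, (m.unop2.hom.as.app a).toNatTrans.app x =
      (n.unop2.hom.as.app a).toNatTrans.app x) : m = n := by
  have : m.unop2.hom = n.unop2.hom := by
    ext a : 1
    ext x : 3
    exact h a x
  exact congrArg (fun k : s.unop.hom ⟶ t.unop.hom =>
    @Bicategory.Opposite.Hom2.op2' _ _ _ _ s t (InducedBicategory.Hom₂.mk k)) this

variable {B} in
lemma Ps.isId_app {M N : (Ps B)ᵒᵖ} {s t : M ⟶ N} {m : s ⟶ t} (hm : IsId m) (a : B)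
    (x : N.unop.obj a) : IsId ((m.unop2.hom.as.app a).toNatTrans.app x) := by
  obtain ⟨h, rfl⟩ := hm
  subst h
  exact IsId.id _

variable [Strict B]

variable {B} in
lemma homFunctorMap_id (a : B) :
    homFunctorMap (𝟙 a) (StrictPseudofunctor.id B) = 𝟙 _ :=
  twoNatural_ext (isTwoNatural_homFunctorMap _ _) (isTwoNatural_id _) fun b =>
    (isId_cat (leftUnitorNatIsoCat a b).hom fun x => IsId.leftUnitor x).1

variable {B} in
lemma homFunctorMap_comp {a b c : B} (f : a ⟶ b) (g : b ⟶ c) :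
    homFunctorMap (f ≫ g) (StrictPseudofunctor.id B) =
      homFunctorMap g (StrictPseudofunctor.id B) ≫ homFunctorMap f (StrictPseudofunctor.id B) :=
  twoNatural_ext (isTwoNatural_homFunctorMap _ _)
    (isTwoNatural_comp (isTwoNatural_homFunctorMap _ _) (isTwoNatural_homFunctorMap _ _)) fun d =>
    (isId_cat (associatorNatIsoRightCat f g d).hom fun x => IsId.associator f g x).1

/-- The contravariant Yoneda embedding `a ↦ B(a, -)`, composed with the inclusion of the 2-category
of 2-functors and 2-natural transformations in `Ps(B, Cat)`, as a 2-functor `B → Ps(B, Cat)ᵒᵖ`. -/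
def yoneda : StrictPseudofunctor B (Ps B)ᵒᵖ :=
  have hcomp {a b c : B} (f : a ⟶ b) (g : b ⟶ c) :
      (Ps.hom (homFunctorMap (f ≫ g) (StrictPseudofunctor.id B))).op =
        (Ps.hom (homFunctorMap f (StrictPseudofunctor.id B))).op ≫
          (Ps.hom (homFunctorMap g (StrictPseudofunctor.id B))).op :=
    congrArg (fun k => (Ps.hom k).op) (homFunctorMap_comp f g)
  StrictPseudofunctor.mk''
    { obj a := op (Ps.of (homFunctor a (StrictPseudofunctor.id B)))
      map f := (Ps.hom (homFunctorMap f (StrictPseudofunctor.id B))).op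
      map₂ η := op2 (Ps.hom₂ (homFunctorMap₂ η (StrictPseudofunctor.id B)))
      map₂_id f := Ps.op_ext fun _ x => id_whiskerRight f x
      map₂_comp η θ := Ps.op_ext fun _ x => comp_whiskerRight η θ x
      map_id a := congrArg (fun k => (Ps.hom k).op) (homFunctorMap_id a)
      map_comp := hcomp
      map₂_whisker_left f g h η := Ps.op_ext fun _ x => (whisker_assoc f η x).trans
        (IsId.conj_eq' (IsId.associator f g x) (Ps.isId_app (IsId.eqToHom (hcomp f g)) _ x)
          (IsId.associator f h x).inv (Ps.isId_app (IsId.eqToHom (hcomp f h).symm) _ x) _)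
      map₂_whisker_right {_ _ _ f g} η h := Ps.op_ext fun _ x =>
        (whiskerRight_comp_symm η h x).trans
          (IsId.conj_eq' (IsId.associator f h x) (Ps.isId_app (IsId.eqToHom (hcomp f h)) _ x)
            (IsId.associator g h x).inv (Ps.isId_app (IsId.eqToHom (hcomp g h).symm) _ x) _) }

end Yoneda

section Limits

variable {E : Type u} [Bicategory.{u, u} E] [Strict E]
  {C : Type v} [Bicategory.{u, u} C] [Strict C]

/-- For a 2-natural transformation `γ : G ⟶ C(L, F-)` and an object `D`, the functor
`C(D, L) ⥤ [E, Cat](G, C(D, F-))` which sends `f` to `γ` followed by precomposition with `f`. -/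
@[simps!]
def comparison {G : StrictPseudofunctor E Cat.{u, u}} {F : StrictPseudofunctor E C} {L : C}
    (γ : TwoNat G (homFunctor L F)) (D : C) : (D ⟶ L) ⥤ TwoNat G (homFunctor D F) where
  obj f := ⟨γ.obj ≫ homFunctorMap f F,
    isTwoNatural_comp γ.property (isTwoNatural_homFunctorMap f F)⟩
  map η := ObjectProperty.homMk (γ.obj ◁ homFunctorMap₂ η F)
  map_id f := by
    ext a : 2
    ext x : 3
    exact id_whiskerRight f _
  map_comp η θ := by
    ext a : 2
    ext x : 3
    exact comp_whiskerRight η θ _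

/-- The cone `γ : G ⟶ C(L, F-)` exhibits `L` as the homotopy 2-limit `{G, F}_h`: the 2-natural family
of functors `C(D, L) ⥤ [E, Cat](G, C(D, F-))` that it induces consists of equivalences. -/
def IsHomotopyLimit {G : StrictPseudofunctor E Cat.{u, u}} {F : StrictPseudofunctor E C} {L : C}
    (γ : TwoNat G (homFunctor L F)) : Prop :=
  ∀ D : C, (comparison γ D).IsEquivalence

/-- Let `F` be a contravariant 2-functor from `E` to `C`. The cocone `κ : G ⟶ C(F-, P)` exhibits `P` as
the homotopy 2-colimit `G ⋆_h F`: the functors `C(P, D) ⥤ [E, Cat](G, C(F-, D))` that it induces are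
equivalences. -/
def IsHomotopyColimit {G : StrictPseudofunctor E Cat.{u, u}} {F : StrictPseudofunctor E Cᵒᵖ} {P : C}
    (κ : TwoNat G (homFunctor (op P) F)) : Prop :=
  IsHomotopyLimit κ

/-- The image `T γ : G ⟶ C'(T L, T F-)` of a cone `γ : G ⟶ C(L, F-)` under a 2-functor `T`. -/
def mapCone {C' : Type*} [Bicategory.{u, u} C'] [Strict C'] (T : StrictPseudofunctor C C')
    {G : StrictPseudofunctor E Cat.{u, u}} {F : StrictPseudofunctor E C} {L : C}
    (γ : TwoNat G (homFunctor L F)) : TwoNat G (homFunctor (T.obj L) (F.comp T)) :=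
  ⟨γ.obj ≫ homFunctorApply L F T,
    isTwoNatural_comp γ.property (isTwoNatural_homFunctorApply L F T)⟩

end Limits

section Cofibrant

/-- The trivial fibrations of the standard model structure on the category of small categories:
equivalences of categories which are isofibrations. -/
structure IsTrivialFibration {X Y : Type u} [Category.{u} X] [Category.{u} Y] (p : X ⥤ Y) :
    Prop where
  isEquivalence : p.IsEquivalence
  isofibration : ∀ (x : X) (y : Y) (e : p.obj x ≅ y),
    ∃ (x' : X) (e' : x ≅ x') (h : p.obj x' = y), p.map e'.hom ≫ eqToHom h = e.hom

/-- Cofibrant objects of the projective model structure on `[E, Cat]`: the 2-functors `G` such that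
`∅ ⟶ G` has the left lifting property with respect to the pointwise trivial fibrations. -/
def IsCofibrant {E : Type u} [Bicategory.{u, u} E] (G : StrictPseudofunctor E Cat.{u, u}) : Prop :=
  ∀ (X Y : StrictPseudofunctor E Cat.{u, u}) (p : TwoNat X Y) (g : TwoNat G Y),
    (∀ e, IsTrivialFibration (p.obj.app e).toFunctor) → ∃ l : TwoNat G X, l.obj ≫ p.obj = g.obj

end Cofibrant

section Sketch

variable (B : Type u) [Bicategory.{u, u} B] [Strict B]

/-- A 2-cone `(E, F, G, L, γ)` in a 2-category. -/
structure Cone where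
  /-- the shape, a small 2-category -/
  E : Type u
  [bicategory : Bicategory.{u, u} E]
  [strict : Strict E]
  /-- the diagram -/
  F : StrictPseudofunctor E B
  /-- the weight -/
  G : StrictPseudofunctor E Cat.{u, u}
  /-- the vertex -/
  L : B
  /-- the 2-natural transformation `G ⟶ B(L, F-)` -/
  γ : TwoNat G (homFunctor L F)

attribute [instance] Cone.bicategory Cone.strict

/-- A weighted homotopy limit 2-sketch on the small 2-category `B`: a small family of 2-cones with
cofibrant weights. -/
structure HomotopyLimitSketch where
  /-- the set which indexes the cones -/
  ι : Type u
  /-- the cones -/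
  cone : ι → Cone B
  cofibrant : ∀ i, IsCofibrant (cone i).G

variable {B}

/-- A homotopy model: a 2-functor to `Cat` which sends the cones to homotopy 2-limits. -/
def HomotopyLimitSketch.IsHomotopyModel (S : HomotopyLimitSketch B)
    (M : StrictPseudofunctor B Cat.{u, u}) : Prop :=
  ∀ i, IsHomotopyLimit (mapCone M (S.cone i).γ)

/-- The objects of `hMod^ps_S`, the full 2-subcategory of `Ps(B, Cat)` spanned by the homotopy
models. -/
def HomotopyLimitSketch.hModPs (S : HomotopyLimitSketch B) : Set (Ps B) :=
  {M | S.IsHomotopyModel M}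

/-- `ρ : P ⟶ B(L, -)` is the 1-morphism `G ⋆_h Y(F-) ⟶ Y(L)` of `Ps(B, Cat)` built from the cone `c`:
its source `P` is a homotopy 2-colimit of `Y(F-)` weighted by `G`, and `ρ` corresponds, up to
isomorphism, to `Y(γ) : G ⟶ Ps(B, Cat)(Y(F-), Y(L))` under the equivalence
`Ps(B, Cat)(P, Y(L)) ⥤ [E, Cat](G, Ps(B, Cat)(Y(F-), Y(L)))`. -/
def Cone.IsRho (c : Cone B) {P : Ps B} (ρ : P ⟶ ((yoneda B).obj c.L).unop) : Prop :=
  ∃ κ : TwoNat c.G (homFunctor (op P) (c.F.comp (yoneda B))),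
    IsHomotopyColimit κ ∧
      Nonempty ((comparison κ ((yoneda B).obj c.L)).obj ρ.op ≅ mapCone (yoneda B) c.γ)

end Sketch

section Orthogonality

variable {C : Type v} [Bicategory.{u, u} C]

/-- The object `X` is homotopy orthogonal to `f : A ⟶ A'`: the functor `C(f, X)` is an equivalence. -/
def IsHomotopyOrthogonal {A A' : C} (f : A ⟶ A') (X : C) : Prop :=
  (precomp X f).IsEquivalence

/-- The full 2-subcategory spanned by `K` is a homotopy orthogonal subcategory: for some small family
`Σ` of 1-morphisms, the objects of `K` are those which are homotopy orthogonal to all members of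
`Σ`. -/
def IsHomotopyOrthogonalSubcategory (K : Set C) : Prop :=
  ∃ (I : Type u) (A A' : I → C) (σ : ∀ i, A i ⟶ A' i),
    ∀ X : C, X ∈ K ↔ ∀ i, IsHomotopyOrthogonal (σ i) X

end Orthogonality

end HSketch

/-! Fix a cone with cofibrant weight `G`, diagram `F` and vertex `L`, and a 2-functor `M` to `Cat`.
The image of the cone under `M` is a homotopy limit exactly when its transpose `M L ⥤ [E, Cat](G, M
F-)` is an equivalence: evaluation at the terminal category gives one direction, and equivalences
are preserved by `Cat(D, -)` for the other (`isHomotopyLimit_iff_transpose`). The bicategorical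
Yoneda lemma `M a ≃ Ps(Y a, M)` is strictly 2-natural in `a`, so it turns the transpose into `Ps(Y
L, M) ⥤ [E, Cat](G, Ps(Y F-, M))`, the functor induced by `Y(γ)`
(`comparison_yoneda_isEquivalence_iff`). If `P` is the homotopy colimit, the target is equivalent to
`Ps(P, M)` and the functor becomes `Ps(ρ, M)` up to isomorphism. Two out of three then identifies
homotopy models with the objects orthogonal to all `ρ` (`Cone.IsRho.isHomotopyOrthogonal_iff`).

Cofibrancy is used twice, each time through the mapping path object of a pseudo-natural `t : X ⟶ Y`,
whose objects are isomorphisms `t x ≅ y`. Both of its projections are 2-natural even if `t` is not.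
The first is always a pointwise trivial fibration, so a section of it replaces a pseudo-natural
transformation out of a cofibrant `X` by an isomorphic 2-natural one
(`IsCofibrant.exists_twoNat_iso`). The second is a pointwise trivial fibration when `t` is a
pointwise equivalence, so that `[E, Cat](G, -)` sends pointwise equivalences to equivalences
(`IsCofibrant.postcompTwoNat_isEquivalence`).

The colimit `P` is built by generators and relations: `P b` has objects `(e, x, h : F e ⟶ b)`, and
an object `(e, x, F f ≫ h)` is glued to `(e', G f x, h)` by a formal isomorphism. It classifies the
pseudo-natural transformations `G ⟶ Ps(Y F-, D)`. Its universal cocone is only pseudo-natural, and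
cofibrancy of `G` makes it 2-natural up to isomorphism (`comparison_isEquivalence`,
`exists_isHomotopyColimit`).

For the statement about `[D, M-]`, the transpose of the image of the cone under `[D, M-]` is the
comparison functor of its image under `M` at `D`. Requiring an equivalence for all `D` is therefore
the definition of a homotopy limit (`transpose_cotensor_isEquivalence_iff`). -/

namespace HSketch

/-! ### 2-functors to `Cat`, their transformations and modifications, in components -/

section Components

variable {E : Type u} [Bicategory.{u, u} E]

section Functor

variable (X : StrictPseudofunctor E Cat.{u, u}) {a b c : E}

/-- The component at `x` of the image of a 2-cell under a 2-functor to `Cat`. -/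
def map₂App {f g : a ⟶ b} (η : f ⟶ g) (x : X.obj a) :
    (X.map f).toFunctor.obj x ⟶ (X.map g).toFunctor.obj x :=
  (X.map₂ η).toNatTrans.app x

/-- The component at `x` of the unit constraint of a 2-functor to `Cat`. -/
def mapIdApp (x : X.obj a) : (X.map (𝟙 a)).toFunctor.obj x ≅ x :=
  (Cat.Hom.toNatIso (X.mapId a)).app x

/-- The component at `x` of the composition constraint of a 2-functor to `Cat`. -/
def mapCompApp (f : a ⟶ b) (g : b ⟶ c) (x : X.obj a) :
    (X.map (f ≫ g)).toFunctor.obj x ≅ (X.map g).toFunctor.obj ((X.map f).toFunctor.obj x) :=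
  (Cat.Hom.toNatIso (X.mapComp f g)).app x

lemma map₂App_naturality {f g : a ⟶ b} (η : f ⟶ g) {x y : X.obj a} (k : x ⟶ y) :
    (X.map f).toFunctor.map k ≫ map₂App X η y = map₂App X η x ≫ (X.map g).toFunctor.map k :=
  (X.map₂ η).toNatTrans.naturality k

lemma mapIdApp_naturality {x y : X.obj a} (k : x ⟶ y) :
    (X.map (𝟙 a)).toFunctor.map k ≫ (mapIdApp X y).hom = (mapIdApp X x).hom ≫ k :=
  (X.mapId a).hom.toNatTrans.naturality k

lemma mapCompApp_naturality (f : a ⟶ b) (g : b ⟶ c) {x y : X.obj a} (k : x ⟶ y) :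
    (X.map (f ≫ g)).toFunctor.map k ≫ (mapCompApp X f g y).hom =
      (mapCompApp X f g x).hom ≫ (X.map g).toFunctor.map ((X.map f).toFunctor.map k) :=
  (X.mapComp f g).hom.toNatTrans.naturality k

@[simp]
lemma map₂App_id (f : a ⟶ b) (x : X.obj a) : map₂App X (𝟙 f) x = 𝟙 _ :=
  congrArg (fun m => m.toNatTrans.app x) (X.map₂_id f)

@[simp]
lemma map₂App_comp {f g h : a ⟶ b} (η : f ⟶ g) (θ : g ⟶ h) (x : X.obj a) :
    map₂App X (η ≫ θ) x = map₂App X η x ≫ map₂App X θ x :=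
  congrArg (fun m => m.toNatTrans.app x) (X.map₂_comp η θ)

lemma map₂App_whiskerLeft (f : a ⟶ b) {g h : b ⟶ c} (η : g ⟶ h) (x : X.obj a) :
    map₂App X (f ◁ η) x ≫ (mapCompApp X f h x).hom =
      (mapCompApp X f g x).hom ≫ map₂App X η ((X.map f).toFunctor.obj x) :=
  congrArg (fun m => m.toNatTrans.app x) (map₂_whiskerLeft_mapComp X f η)

lemma map₂App_whiskerRight {f g : a ⟶ b} (η : f ⟶ g) (h : b ⟶ c) (x : X.obj a) :
    map₂App X (η ▷ h) x ≫ (mapCompApp X g h x).hom =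
      (mapCompApp X f h x).hom ≫ (X.map h).toFunctor.map (map₂App X η x) :=
  congrArg (fun m => m.toNatTrans.app x) (map₂_whiskerRight_mapComp X η h)

lemma isId_mapIdApp (x : X.obj a) : IsId (mapIdApp X x).hom := (IsId.mapId X a).app x

lemma isId_mapCompApp (f : a ⟶ b) (g : b ⟶ c) (x : X.obj a) : IsId (mapCompApp X f g x).hom :=
  (IsId.mapComp X f g).app x

end Functor

section Trans

variable {X Y Z : StrictPseudofunctor E Cat.{u, u}} {a b c : E}

/-- The component at `x` of the structure 2-cell at `f` of a pseudo-natural transformation. -/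
def natApp (t : X.toPseudofunctor ⟶ Y.toPseudofunctor) (f : a ⟶ b) (x : X.obj a) :
    (t.app b).toFunctor.obj ((X.map f).toFunctor.obj x) ≅
      (Y.map f).toFunctor.obj ((t.app a).toFunctor.obj x) :=
  (Cat.Hom.toNatIso (t.naturality f)).app x

lemma natApp_naturality (t : X.toPseudofunctor ⟶ Y.toPseudofunctor) (f : a ⟶ b) {x y : X.obj a}
    (k : x ⟶ y) :
    (t.app b).toFunctor.map ((X.map f).toFunctor.map k) ≫ (natApp t f y).hom =
      (natApp t f x).hom ≫ (Y.map f).toFunctor.map ((t.app a).toFunctor.map k) :=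
  (t.naturality f).hom.toNatTrans.naturality k

lemma natApp_map₂ (t : X.toPseudofunctor ⟶ Y.toPseudofunctor) {f g : a ⟶ b} (η : f ⟶ g)
    (x : X.obj a) :
    (t.app b).toFunctor.map (map₂App X η x) ≫ (natApp t g x).hom =
      (natApp t f x).hom ≫ map₂App Y η ((t.app a).toFunctor.obj x) :=
  congrArg (fun m => m.toNatTrans.app x) (t.naturality_naturality η)

/-- The unitors and associators of `Cat` have identity components, so they drop out of the axioms of
a pseudo-natural transformation. The constraints of `X` and `Y` are identities too, but between
objects that are only propositionally equal, and they stay visible. -/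
lemma natApp_id (t : X.toPseudofunctor ⟶ Y.toPseudofunctor) (x : X.obj a) :
    (natApp t (𝟙 a) x).hom ≫ (mapIdApp Y ((t.app a).toFunctor.obj x)).hom =
      (t.app a).toFunctor.map (mapIdApp X x).hom := by
  refine (congrArg (fun m => m.toNatTrans.app x) (t.naturality_id a)).trans ?_
  exact (congrArg _ (Category.comp_id _)).trans (Category.comp_id _)

lemma natApp_comp (t : X.toPseudofunctor ⟶ Y.toPseudofunctor) (f : a ⟶ b) (g : b ⟶ c)
    (x : X.obj a) :
    (natApp t (f ≫ g) x).hom ≫ (mapCompApp Y f g ((t.app a).toFunctor.obj x)).hom =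
      (t.app c).toFunctor.map (mapCompApp X f g x).hom ≫
        (natApp t g ((X.map f).toFunctor.obj x)).hom ≫
          (Y.map g).toFunctor.map (natApp t f x).hom := by
  refine (congrArg (fun m => m.toNatTrans.app x) (t.naturality_comp f g)).trans ?_
  refine congrArg (_ ≫ ·) ((Category.id_comp _).trans (congrArg (_ ≫ ·) ?_))
  exact (Category.id_comp _).trans (Category.comp_id _)

lemma natApp_comp_trans (s : X.toPseudofunctor ⟶ Y.toPseudofunctor)
    (t : Y.toPseudofunctor ⟶ Z.toPseudofunctor) (f : a ⟶ b) (x : X.obj a) :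
    (natApp (s ≫ t) f x).hom = (t.app b).toFunctor.map (natApp s f x).hom ≫
      (natApp t f ((s.app a).toFunctor.obj x)).hom := by
  refine (congrArg (fun m => m.toNatTrans.app x)
    (Pseudofunctor.StrongTrans.categoryStruct_comp_naturality_hom s t f)).trans ?_
  refine (Category.id_comp _).trans (congrArg (_ ≫ ·) ?_)
  exact (Category.id_comp _).trans (Category.comp_id _)

/-- Constructor for pseudo-natural transformations between 2-functors to `Cat`. -/
def mkTrans (app : ∀ a, X.obj a ⥤ Y.obj a)
    (nat : ∀ {a b : E} (f : a ⟶ b) (x : X.obj a),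
      (app b).obj ((X.map f).toFunctor.obj x) ≅ (Y.map f).toFunctor.obj ((app a).obj x))
    (nat_naturality : ∀ {a b : E} (f : a ⟶ b) {x y : X.obj a} (k : x ⟶ y),
      (app b).map ((X.map f).toFunctor.map k) ≫ (nat f y).hom =
        (nat f x).hom ≫ (Y.map f).toFunctor.map ((app a).map k))
    (nat_map₂ : ∀ {a b : E} {f g : a ⟶ b} (η : f ⟶ g) (x : X.obj a),
      (app b).map (map₂App X η x) ≫ (nat g x).hom = (nat f x).hom ≫ map₂App Y η ((app a).obj x))
    (nat_id : ∀ {a : E} (x : X.obj a),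
      (nat (𝟙 a) x).hom ≫ (mapIdApp Y ((app a).obj x)).hom = (app a).map (mapIdApp X x).hom)
    (nat_comp : ∀ {a b c : E} (f : a ⟶ b) (g : b ⟶ c) (x : X.obj a),
      (nat (f ≫ g) x).hom ≫ (mapCompApp Y f g ((app a).obj x)).hom =
        (app c).map (mapCompApp X f g x).hom ≫ (nat g ((X.map f).toFunctor.obj x)).hom ≫
          (Y.map g).toFunctor.map (nat f x).hom) :
    X.toPseudofunctor ⟶ Y.toPseudofunctor where
  app a := (app a).toCatHom
  naturality {a b} f := Cat.Hom.isoMk (F := (X.map f).toFunctor ⋙ app b)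
    (G := app a ⋙ (Y.map f).toFunctor) (NatIso.ofComponents (nat f) (nat_naturality f))
  naturality_naturality η := by
    ext x : 3
    exact nat_map₂ η x
  naturality_id a := by
    ext x : 3
    refine (nat_id x).trans ?_
    exact ((congrArg _ (Category.comp_id _)).trans (Category.comp_id _)).symm
  naturality_comp f g := by
    ext x : 3
    refine (nat_comp f g x).trans ?_
    refine congrArg (_ ≫ ·) (((Category.id_comp _).trans (congrArg (_ ≫ ·) ?_)).symm)
    exact (Category.id_comp _).trans (Category.comp_id _)

/-- The component at `x` of a modification. -/
def modApp {s t : X.toPseudofunctor ⟶ Y.toPseudofunctor} (m : s ⟶ t) (x : X.obj a) :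
    (s.app a).toFunctor.obj x ⟶ (t.app a).toFunctor.obj x :=
  (m.as.app a).toNatTrans.app x

lemma modApp_naturality {s t : X.toPseudofunctor ⟶ Y.toPseudofunctor} (m : s ⟶ t) {x y : X.obj a}
    (k : x ⟶ y) :
    (s.app a).toFunctor.map k ≫ modApp m y = modApp m x ≫ (t.app a).toFunctor.map k :=
  (m.as.app a).toNatTrans.naturality k

lemma modApp_natApp {s t : X.toPseudofunctor ⟶ Y.toPseudofunctor} (m : s ⟶ t) (f : a ⟶ b)
    (x : X.obj a) :
    modApp m ((X.map f).toFunctor.obj x) ≫ (natApp t f x).hom =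
      (natApp s f x).hom ≫ (Y.map f).toFunctor.map (modApp m x) :=
  congrArg (fun k => k.toNatTrans.app x) (m.as.naturality f)

lemma mod_ext {s t : X.toPseudofunctor ⟶ Y.toPseudofunctor} {m n : s ⟶ t}
    (h : ∀ (a : E) (x : X.obj a), modApp m x = modApp n x) : m = n := by
  ext a : 1
  ext x : 3
  exact h a x

/-- Constructor for modifications. -/
def mkMod {s t : X.toPseudofunctor ⟶ Y.toPseudofunctor}
    (m : ∀ {a : E} (x : X.obj a), (s.app a).toFunctor.obj x ⟶ (t.app a).toFunctor.obj x)
    (naturality : ∀ {a : E} {x y : X.obj a} (k : x ⟶ y),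
      (s.app a).toFunctor.map k ≫ m y = m x ≫ (t.app a).toFunctor.map k)
    (mod : ∀ {a b : E} (f : a ⟶ b) (x : X.obj a),
      m ((X.map f).toFunctor.obj x) ≫ (natApp t f x).hom =
        (natApp s f x).hom ≫ (Y.map f).toFunctor.map (m x)) : s ⟶ t where
  as :=
    { app a := NatTrans.toCatHom₂ (F := (s.app a).toFunctor) (G := (t.app a).toFunctor)
        { app := m, naturality _ _ := naturality }
      naturality f := by
        ext x : 3
        exact mod f x }

/-- Constructor for invertible modifications. -/
def mkModIso {s t : X.toPseudofunctor ⟶ Y.toPseudofunctor}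
    (m : ∀ {a : E} (x : X.obj a), (s.app a).toFunctor.obj x ≅ (t.app a).toFunctor.obj x)
    (naturality : ∀ {a : E} {x y : X.obj a} (k : x ⟶ y),
      (s.app a).toFunctor.map k ≫ (m y).hom = (m x).hom ≫ (t.app a).toFunctor.map k)
    (mod : ∀ {a b : E} (f : a ⟶ b) (x : X.obj a),
      (m ((X.map f).toFunctor.obj x)).hom ≫ (natApp t f x).hom =
        (natApp s f x).hom ≫ (Y.map f).toFunctor.map (m x).hom) : s ≅ t where
  hom := mkMod (fun x => (m x).hom) naturality mod
  inv := mkMod (fun x => (m x).inv)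
    (fun {a x y} k => by rw [Iso.comp_inv_eq, Category.assoc, naturality k, Iso.inv_hom_id_assoc])
    (fun f x => by
      rw [Iso.inv_comp_eq, ← Category.assoc, mod f x, Category.assoc, ← Functor.map_comp,
        Iso.hom_inv_id, CategoryTheory.Functor.map_id, Category.comp_id])
  hom_inv_id := mod_ext fun _ x => (m x).hom_inv_id
  inv_hom_id := mod_ext fun _ x => (m x).inv_hom_id

end Trans

/-- Constructor for 2-functors to `Cat`. -/
def mkStrict [Strict E] (obj : E → Cat.{u, u}) (map : ∀ {a b : E}, (a ⟶ b) → (obj a ⥤ obj b))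
    (map₂ : ∀ {a b : E} {f g : a ⟶ b}, (f ⟶ g) → (map f ⟶ map g))
    (map₂_id : ∀ {a b : E} (f : a ⟶ b) (x : obj a), (map₂ (𝟙 f)).app x = 𝟙 _)
    (map₂_comp : ∀ {a b : E} {f g h : a ⟶ b} (η : f ⟶ g) (θ : g ⟶ h) (x : obj a),
      (map₂ (η ≫ θ)).app x = (map₂ η).app x ≫ (map₂ θ).app x)
    (mapId : ∀ a, map (𝟙 a) ⟶ 𝟭 (obj a)) (isId_mapId : ∀ a x, IsId ((mapId a).app x))
    (mapComp : ∀ {a b c : E} (f : a ⟶ b) (g : b ⟶ c), map (f ≫ g) ⟶ map f ⋙ map g)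
    (isId_mapComp : ∀ {a b c : E} (f : a ⟶ b) (g : b ⟶ c) (x), IsId ((mapComp f g).app x))
    (map₂_whiskerLeft : ∀ {a b c : E} (f : a ⟶ b) {g h : b ⟶ c} (η : g ⟶ h) (x),
      (map₂ (f ◁ η)).app x ≫ (mapComp f h).app x =
        (mapComp f g).app x ≫ (map₂ η).app ((map f).obj x))
    (map₂_whiskerRight : ∀ {a b c : E} {f g : a ⟶ b} (η : f ⟶ g) (h : b ⟶ c) (x),
      (map₂ (η ▷ h)).app x ≫ (mapComp g h).app x =
        (mapComp f h).app x ≫ (map h).map ((map₂ η).app x)) :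
    StrictPseudofunctor E Cat.{u, u} :=
  have hcomp {a b c : E} (f : a ⟶ b) (g : b ⟶ c) :
      (map (f ≫ g)).toCatHom = (map f).toCatHom ≫ (map g).toCatHom :=
    (isId_cat (mapComp f g).toCatHom₂ (isId_mapComp f g)).1
  StrictPseudofunctor.mk''
    { obj := obj
      map f := (map f).toCatHom
      map₂ η := (map₂ η).toCatHom₂
      map₂_id f := by
        ext x : 3
        exact map₂_id f x
      map₂_comp η θ := by
        ext x : 3
        exact map₂_comp η θ x
      map_id a := (isId_cat (mapId a).toCatHom₂ (isId_mapId a)).1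
      map_comp := hcomp
      map₂_whisker_left f g h η := by
        ext x : 3
        -- The strict constructor states its axioms with `eqToHom`. A morphism that is an identity
        -- up to equality of its ends is determined by these ends, so `mapComp` may be exchanged
        -- with `eqToHom`.
        have hg := (isId_mapComp f g x).eq ((IsId.eqToHom (hcomp f g)).app x)
        have hi' : (mapComp f h).app x ≫ (eqToHom (hcomp f h).symm).toNatTrans.app x = 𝟙 _ :=
          ((isId_mapComp f h x).comp ((IsId.eqToHom (hcomp f h).symm).app x)).eq (IsId.id _)
        refine (Category.comp_id _).symm.trans ((congrArg (_ ≫ ·) hi'.symm).trans ?_)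
        refine (Category.assoc _ _ _).symm.trans ?_
        refine (congrArg (· ≫ _) (map₂_whiskerLeft f η x)).trans ?_
        rw [hg]
        exact Category.assoc _ _ _
      map₂_whisker_right {_ _ _ f g} η h := by
        ext x : 3
        have hg := (isId_mapComp f h x).eq ((IsId.eqToHom (hcomp f h)).app x)
        have hi' : (mapComp g h).app x ≫ (eqToHom (hcomp g h).symm).toNatTrans.app x = 𝟙 _ :=
          ((isId_mapComp g h x).comp ((IsId.eqToHom (hcomp g h).symm).app x)).eq (IsId.id _)
        refine (Category.comp_id _).symm.trans ((congrArg (_ ≫ ·) hi'.symm).trans ?_)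
        refine (Category.assoc _ _ _).symm.trans ?_
        refine (congrArg (· ≫ _) (map₂_whiskerRight η h x)).trans ?_
        rw [hg]
        exact Category.assoc _ _ _ }

end Components

/-! ### The mapping path object and transformations out of a cofibrant 2-functor -/

section MappingPath

variable {E : Type u} [Bicategory.{u, u} E] {X Y : StrictPseudofunctor E Cat.{u, u}}
  (t : X.toPseudofunctor ⟶ Y.toPseudofunctor)

/-- The objects of the value at `e` of the mapping path object of `t`: an object `x` of `X e`, an
object `y` of `Y e` and an isomorphism `t x ≅ y`. -/
structure PathObj (e : E) where
  /-- the object of `X e` -/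
  fst : X.obj e
  /-- the object of `Y e` -/
  snd : Y.obj e
  /-- the isomorphism -/
  iso : (t.app e).toFunctor.obj fst ≅ snd

namespace PathObj

variable {t} {e : E}

/-- The morphisms of the mapping path object. -/
@[ext]
structure Hom (z w : PathObj t e) where
  /-- the morphism between the first components -/
  fst : z.fst ⟶ w.fst

-- A morphism needs only a first component: the isomorphisms `t x ≅ y` transport it to a unique
-- compatible second one. This makes the first projection fully faithful by construction.
@[simps]
instance : Category.{u} (PathObj t e) where
  Hom z w := Hom z w
  id z := ⟨𝟙 z.fst⟩
  comp u v := ⟨u.fst ≫ v.fst⟩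

@[ext]
lemma hom_ext {z w : PathObj t e} {u v : z ⟶ w} (h : u.fst = v.fst) : u = v := Hom.ext h

variable (t e) in
/-- The first projection. -/
@[simps]
def fstFunctor : PathObj t e ⥤ X.obj e where
  obj z := z.fst
  map u := u.fst

variable (t e) in
/-- The second projection. -/
@[simps]
def sndFunctor : PathObj t e ⥤ Y.obj e where
  obj z := z.snd
  map {z w} u := z.iso.inv ≫ (t.app e).toFunctor.map u.fst ≫ w.iso.hom

variable (t e) in
/-- The isomorphism between `t` applied to the first projection and the second projection. -/
def fstIsoSnd : fstFunctor t e ⋙ (t.app e).toFunctor ≅ sndFunctor t e :=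
  NatIso.ofComponents (fun z => z.iso) fun {z _} _ => (z.iso.hom_inv_id_assoc _).symm

/-- An isomorphism between the first components, as an isomorphism in the mapping path object. -/
def isoMk {z w : PathObj t e} (k : z.fst ≅ w.fst) : z ≅ w where
  hom := ⟨k.hom⟩
  inv := ⟨k.inv⟩
  hom_inv_id := hom_ext k.hom_inv_id
  inv_hom_id := hom_ext k.inv_hom_id

/-- Once both components are identities, the second one being `φ.inv ≫ ψ.hom` forces the
isomorphisms `φ` and `ψ` to coincide, so the two objects are equal. -/
lemma isId_hom {z w : PathObj t e} (u : z ⟶ w) (h₁ : IsId u.fst)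
    (h₂ : IsId ((sndFunctor t e).map u)) : IsId u := by
  obtain ⟨x, y, φ⟩ := z
  obtain ⟨x', y', ψ⟩ := w
  obtain ⟨u⟩ := u
  obtain ⟨e₁, h₁⟩ := h₁
  obtain ⟨e₂, h₂⟩ := h₂
  change x = x' at e₁
  change y = y' at e₂
  subst e₁ e₂
  have h₁' : u = 𝟙 x := h₁
  subst h₁'
  have h₂' : φ.inv ≫ (t.app e).toFunctor.map (𝟙 x) ≫ ψ.hom = 𝟙 y := h₂
  obtain rfl : φ = ψ := by
    ext
    rw [CategoryTheory.Functor.map_id, Category.id_comp, Iso.inv_comp_eq,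
      Category.comp_id] at h₂'
    exact h₂'.symm
  exact IsId.id _

instance : (fstFunctor t e).Full where map_surjective u := ⟨⟨u⟩, rfl⟩

instance : (fstFunctor t e).Faithful where map_injective h := hom_ext h

/-- Nothing is required of `t`. An object `x` lifts to the identity of `t x`, and an isomorphism `k`
out of the first component lifts by keeping `y` and composing the given isomorphism with the inverse
of `t k`. -/
lemma isTrivialFibration_fstFunctor : IsTrivialFibration (fstFunctor t e) where
  isEquivalence :=
    { essSurj := ⟨fun x => ⟨⟨x, _, Iso.refl _⟩, ⟨Iso.refl _⟩⟩⟩ }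
  isofibration z x k :=
    ⟨⟨x, z.snd, (t.app e).toFunctor.mapIso k.symm ≪≫ z.iso⟩, isoMk k, rfl, Category.comp_id _⟩

/-- The second projection is isomorphic to the first followed by `t`, hence an equivalence when `t`
is one. It is an isofibration for any `t`: an isomorphism out of `y` lifts by keeping `x` and
extending `t x ≅ y`. -/
lemma isTrivialFibration_sndFunctor [(t.app e).toFunctor.IsEquivalence] :
    IsTrivialFibration (sndFunctor t e) where
  isEquivalence :=
    have : (fstFunctor t e).IsEquivalence := isTrivialFibration_fstFunctor.isEquivalence
    Functor.isEquivalence_of_iso (fstIsoSnd t e)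
  isofibration z y k := by
    refine ⟨⟨z.fst, y, z.iso ≪≫ k⟩, isoMk (Iso.refl _), rfl, (Category.comp_id _).trans ?_⟩
    have (y : Y.obj e) (k : z.snd ⟶ y) :
        z.iso.inv ≫ (t.app e).toFunctor.map (𝟙 z.fst) ≫ z.iso.hom ≫ k = k := by
      rw [CategoryTheory.Functor.map_id, Category.id_comp, Iso.inv_hom_id_assoc]
    exact this y k.hom

end PathObj

open PathObj

/-- The action of a 1-cell on the mapping path object. -/
def pathMap {a b : E} (f : a ⟶ b) : PathObj t a ⥤ PathObj t b where
  obj z := ⟨(X.map f).toFunctor.obj z.fst, (Y.map f).toFunctor.obj z.snd,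
    natApp t f z.fst ≪≫ (Y.map f).toFunctor.mapIso z.iso⟩
  map u := ⟨(X.map f).toFunctor.map u.fst⟩
  map_id z := hom_ext ((X.map f).toFunctor.map_id z.fst)
  map_comp u v := hom_ext ((X.map f).toFunctor.map_comp u.fst v.fst)

/-- The second component is the unique filler of a square, so each computation with it below reduces
to one of the axioms of the pseudo-natural transformation `t`. -/
lemma sndFunctor_map_eq {b : E} {z w : PathObj t b} (u : z ⟶ w) {k : z.snd ⟶ w.snd}
    (h : (t.app b).toFunctor.map u.fst ≫ w.iso.hom = z.iso.hom ≫ k) :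
    (sndFunctor t b).map u = k := by
  rw [sndFunctor_map, h, Iso.inv_hom_id_assoc]

lemma sndFunctor_map_pathMap {a b : E} (f : a ⟶ b) {z w : PathObj t a} (u : z ⟶ w) :
    (sndFunctor t b).map ((pathMap t f).map u) =
      (Y.map f).toFunctor.map ((sndFunctor t a).map u) := by
  refine sndFunctor_map_eq t _ ?_
  change (t.app b).toFunctor.map ((X.map f).toFunctor.map u.fst) ≫
      (natApp t f w.fst).hom ≫ (Y.map f).toFunctor.map w.iso.hom =
    ((natApp t f z.fst).hom ≫ (Y.map f).toFunctor.map z.iso.hom) ≫ (Y.map f).toFunctor.map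
      (z.iso.inv ≫ (t.app a).toFunctor.map u.fst ≫ w.iso.hom)
  rw [reassoc_of% (@natApp_naturality), Category.assoc, ← Functor.map_comp, ← Functor.map_comp,
    Iso.hom_inv_id_assoc]

/-- The action of a 2-cell on the mapping path object. -/
def pathMap₂ {a b : E} {f g : a ⟶ b} (η : f ⟶ g) : pathMap t f ⟶ pathMap t g where
  app z := ⟨map₂App X η z.fst⟩
  naturality _ _ u := hom_ext (map₂App_naturality X η u.fst)

/-- The unit constraint of the mapping path object. -/
def pathMapId (a : E) : pathMap t (𝟙 a) ⟶ 𝟭 (PathObj t a) where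
  app z := ⟨(mapIdApp X z.fst).hom⟩
  naturality _ _ u := hom_ext (mapIdApp_naturality X u.fst)

/-- The composition constraint of the mapping path object. -/
def pathMapComp {a b c : E} (f : a ⟶ b) (g : b ⟶ c) :
    pathMap t (f ≫ g) ⟶ pathMap t f ⋙ pathMap t g where
  app z := ⟨(mapCompApp X f g z.fst).hom⟩
  naturality _ _ u := hom_ext (mapCompApp_naturality X f g u.fst)

lemma sndFunctor_map_pathMapId {a : E} (z : PathObj t a) :
    (sndFunctor t a).map ((pathMapId t a).app z) = (mapIdApp Y z.snd).hom := by
  refine sndFunctor_map_eq t _ ?_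
  change (t.app a).toFunctor.map (mapIdApp X z.fst).hom ≫ z.iso.hom =
    ((natApp t (𝟙 a) z.fst).hom ≫ (Y.map (𝟙 a)).toFunctor.map z.iso.hom) ≫ _
  rw [Category.assoc, mapIdApp_naturality, reassoc_of% (@natApp_id)]

lemma sndFunctor_map_pathMapComp {a b c : E} (f : a ⟶ b) (g : b ⟶ c) (z : PathObj t a) :
    (sndFunctor t c).map ((pathMapComp t f g).app z) = (mapCompApp Y f g z.snd).hom := by
  refine sndFunctor_map_eq t _ ?_
  change (t.app c).toFunctor.map (mapCompApp X f g z.fst).hom ≫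
      (natApp t g ((X.map f).toFunctor.obj z.fst)).hom ≫
        (Y.map g).toFunctor.map ((natApp t f z.fst).hom ≫ (Y.map f).toFunctor.map z.iso.hom) =
    ((natApp t (f ≫ g) z.fst).hom ≫ (Y.map (f ≫ g)).toFunctor.map z.iso.hom) ≫ _
  rw [Category.assoc, mapCompApp_naturality, reassoc_of% (@natApp_comp), Functor.map_comp]

lemma sndFunctor_map_pathMap₂ {a b : E} {f g : a ⟶ b} (η : f ⟶ g) (z : PathObj t a) :
    (sndFunctor t b).map ((pathMap₂ t η).app z) = map₂App Y η z.snd := by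
  refine sndFunctor_map_eq t _ ?_
  change (t.app b).toFunctor.map (map₂App X η z.fst) ≫
      (natApp t g z.fst).hom ≫ (Y.map g).toFunctor.map z.iso.hom =
    ((natApp t f z.fst).hom ≫ (Y.map f).toFunctor.map z.iso.hom) ≫ _
  rw [Category.assoc, map₂App_naturality, reassoc_of% (@natApp_map₂)]

/-- The constraint projects to those of `X` and of `Y`, which are identities. Hence the mapping path
object is a strict 2-functor although `t` is only pseudo-natural. -/
lemma isId_pathMapComp {a b c : E} (f : a ⟶ b) (g : b ⟶ c) (z : PathObj t a) :
    IsId ((pathMapComp t f g).app z) :=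
  isId_hom _ (isId_mapCompApp X f g z.fst)
    (by rw [sndFunctor_map_pathMapComp]; exact isId_mapCompApp Y f g z.snd)

lemma isId_pathMapId {a : E} (z : PathObj t a) : IsId ((pathMapId t a).app z) :=
  isId_hom _ (isId_mapIdApp X z.fst)
    (by rw [sndFunctor_map_pathMapId]; exact isId_mapIdApp Y z.snd)

variable [Strict E]

/-- The mapping path object of a pseudo-natural transformation `t`, as a 2-functor. -/
def pathFunctor : StrictPseudofunctor E Cat.{u, u} :=
  mkStrict (fun e => Cat.of (PathObj t e)) (pathMap t) (pathMap₂ t)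
    (fun f z => hom_ext (map₂App_id X f z.fst))
    (fun η θ z => hom_ext (map₂App_comp X η θ z.fst))
    (pathMapId t) (fun _ => isId_pathMapId t) (pathMapComp t) (isId_pathMapComp t)
    (fun f _ _ η z => hom_ext (map₂App_whiskerLeft X f η z.fst))
    (fun η h z => hom_ext (map₂App_whiskerRight X η h z.fst))

lemma mapIdApp_pathFunctor {a : E} (z : PathObj t a) :
    (mapIdApp (pathFunctor t) (a := a) z).hom = (pathMapId t a).app z :=
  (isId_mapIdApp (pathFunctor t) (a := a) z).eq (isId_pathMapId t z)

lemma mapCompApp_pathFunctor {a b c : E} (f : a ⟶ b) (g : b ⟶ c) (z : PathObj t a) :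
    (mapCompApp (pathFunctor t) f g z).hom = (pathMapComp t f g).app z :=
  (isId_mapCompApp (pathFunctor t) f g z).eq (isId_pathMapComp t f g z)

/-- The first projection of the mapping path object. -/
def pathFst : TwoNat (pathFunctor t) X :=
  ⟨mkTrans (fun e => fstFunctor t e) (fun _ _ => Iso.refl _)
    (fun _ _ _ _ => (Category.comp_id _).trans (Category.id_comp _).symm)
    (fun _ _ => (Category.comp_id _).trans (Category.id_comp _).symm)
    (fun {a} z => (Category.id_comp _).trans
      (congrArg (fstFunctor t a).map (mapIdApp_pathFunctor t z)).symm)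
    (fun {_ _ c} f g z => (Category.id_comp _).trans (Eq.trans
      (congrArg (fstFunctor t c).map (mapCompApp_pathFunctor t f g z)).symm
      ((congrArg (_ ≫ ·) ((Category.id_comp _).trans
        ((X.map g).toFunctor.map_id _))).trans (Category.comp_id _)).symm)),
    fun _ _ _ => isId_cat _ fun _ => IsId.id _⟩

/-- The second projection of the mapping path object. -/
def pathSnd : TwoNat (pathFunctor t) Y :=
  ⟨mkTrans (fun e => sndFunctor t e) (fun _ _ => Iso.refl _)
    (fun f _ _ k => ((Category.comp_id _).trans (sndFunctor_map_pathMap t f k)).trans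
      (Category.id_comp _).symm)
    (fun η z => ((Category.comp_id _).trans (sndFunctor_map_pathMap₂ t η z)).trans
      (Category.id_comp _).symm)
    (fun {a} z => (Category.id_comp _).trans ((sndFunctor_map_pathMapId t z).symm.trans
      (congrArg (sndFunctor t a).map (mapIdApp_pathFunctor t z)).symm))
    (fun {_ _ c} f g z => (Category.id_comp _).trans (Eq.trans
      ((sndFunctor_map_pathMapComp t f g z).symm.trans
        (congrArg (sndFunctor t c).map (mapCompApp_pathFunctor t f g z)).symm)
      ((congrArg (_ ≫ ·) ((Category.id_comp _).trans
        ((Y.map g).toFunctor.map_id _))).trans (Category.comp_id _)).symm)),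
    fun _ _ _ => isId_cat _ fun _ => IsId.id _⟩

/-- The canonical isomorphism between the two maps from the mapping path object to `Y`. -/
def pathIso : (pathFst t).obj ≫ t ≅ (pathSnd t).obj :=
  mkModIso (fun {a} z => (fstIsoSnd t a).app z) (fun {a} _ _ k => (fstIsoSnd t a).hom.naturality k)
    -- The modification axiom holds by the choice made in `pathMap`: the isomorphism there is the
    -- structure 2-cell of `t` followed by the image of `z.iso`.
    (fun {a b} f z => by
      rw [natApp_comp_trans]
      refine (Category.comp_id _).trans ?_
      refine Eq.symm ((congrArg (· ≫ _) (congrArg (· ≫ _) ((t.app b).toFunctor.map_id _))).trans ?_)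
      exact (congrArg (· ≫ _) (Category.id_comp _)))

lemma isTrivialFibration_pathFst (e : E) :
    IsTrivialFibration ((pathFst t).obj.app e).toFunctor :=
  isTrivialFibration_fstFunctor

lemma isTrivialFibration_pathSnd (h : ∀ e, (t.app e).toFunctor.IsEquivalence) (e : E) :
    IsTrivialFibration ((pathSnd t).obj.app e).toFunctor :=
  have := h e
  isTrivialFibration_sndFunctor

variable {t}

/-- A pseudo-natural transformation out of a cofibrant 2-functor is isomorphic to a 2-natural
one. -/
theorem IsCofibrant.exists_twoNat_iso (hX : IsCofibrant X)
    (t : X.toPseudofunctor ⟶ Y.toPseudofunctor) : ∃ s : TwoNat X Y, Nonempty (s.obj ≅ t) := by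
  -- Here `l` is a 2-natural section of the first projection. Composing `pathIso` with it gives an
  -- isomorphism from `t` to `l` followed by the second projection.
  obtain ⟨l, hl⟩ := hX _ _ (pathFst t) ⟨𝟙 _, isTwoNatural_id X⟩ (isTrivialFibration_pathFst t)
  refine ⟨⟨l.obj ≫ (pathSnd t).obj, isTwoNatural_comp l.property (pathSnd t).property⟩, ⟨?_⟩⟩
  exact whiskerLeftIso l.obj (pathIso t).symm ≪≫ (α_ _ _ _).symm ≪≫
    whiskerRightIso (eqToIso hl) t ≪≫ λ_ t

/-- 2-natural transformations out of a cofibrant 2-functor factor, up to isomorphism, through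
2-natural transformations which are pointwise equivalences. -/
theorem IsCofibrant.exists_comp_iso {G : StrictPseudofunctor E Cat.{u, u}} (hG : IsCofibrant G)
    (j : TwoNat X Y) (hj : ∀ e, (j.obj.app e).toFunctor.IsEquivalence) (g : TwoNat G Y) :
    ∃ s : TwoNat G X, Nonempty (s.obj ≫ j.obj ≅ g.obj) := by
  -- The strict lift is taken through the second projection; its first projection is the desired
  -- factorization, and `pathIso` supplies the isomorphism.
  obtain ⟨l, hl⟩ := hG _ _ (pathSnd j.obj) g (isTrivialFibration_pathSnd j.obj hj)
  refine ⟨⟨l.obj ≫ (pathFst j.obj).obj,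
    isTwoNatural_comp l.property (pathFst j.obj).property⟩, ⟨?_⟩⟩
  exact α_ _ _ _ ≪≫ whiskerLeftIso l.obj (pathIso j.obj) ≪≫ eqToIso hl

end MappingPath

/-! ### Cofibrant weights and pointwise equivalences -/

section PostComposition

variable {E : Type u} [Bicategory.{u, u} E] {X Y : StrictPseudofunctor E Cat.{u, u}}

/-- Composition with a 2-natural transformation, as a functor. -/
def postcompTwoNat (G : StrictPseudofunctor E Cat.{u, u}) (j : TwoNat X Y) :
    TwoNat G X ⥤ TwoNat G Y where
  obj s := ⟨s.obj ≫ j.obj, isTwoNatural_comp s.property j.property⟩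
  map m := ObjectProperty.homMk (m.hom ▷ j.obj)
  map_id s := by
    ext : 1
    exact id_whiskerRight s.obj j.obj
  map_comp m n := by
    ext : 1
    exact comp_whiskerRight m.hom n.hom j.obj

/-- The components of `j` are fully faithful, so the components of a modification have unique
preimages, and the axioms of a modification may be checked after applying `j`. Cofibrancy plays no
role here. -/
lemma postcompTwoNat_fullyFaithful (G : StrictPseudofunctor E Cat.{u, u}) (j : TwoNat X Y)
    (hj : ∀ e, (j.obj.app e).toFunctor.IsEquivalence) :
    (postcompTwoNat G j).Full ∧ (postcompTwoNat G j).Faithful := by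
  refine ⟨⟨fun {s t} m => ?_⟩, ⟨fun {s t} m n h => ?_⟩⟩
  -- The components of `m` and their axioms are restated with the composites `s ≫ j` and `t ≫ j`
  -- unfolded, so that preimages under `j` can be taken and rewritten.
  · obtain ⟨n, hn, hn₁, hn₂⟩ : ∃ n : ∀ {a : E} (x : G.obj a),
        (j.obj.app a).toFunctor.obj ((s.obj.app a).toFunctor.obj x) ⟶
          (j.obj.app a).toFunctor.obj ((t.obj.app a).toFunctor.obj x),
        (∀ (a : E) (x : G.obj a), n x = modApp m.hom x) ∧
        (∀ (a : E) (x y : G.obj a) (k : x ⟶ y),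
          (j.obj.app a).toFunctor.map ((s.obj.app a).toFunctor.map k) ≫ n y =
            n x ≫ (j.obj.app a).toFunctor.map ((t.obj.app a).toFunctor.map k)) ∧
        ∀ (a b : E) (f : a ⟶ b) (x : G.obj a),
          n ((G.map f).toFunctor.obj x) ≫ (j.obj.app b).toFunctor.map (natApp t.obj f x).hom ≫
            (natApp j.obj f ((t.obj.app a).toFunctor.obj x)).hom =
          ((j.obj.app b).toFunctor.map (natApp s.obj f x).hom ≫
            (natApp j.obj f ((s.obj.app a).toFunctor.obj x)).hom) ≫
              (Y.map f).toFunctor.map (n x) := by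
      refine ⟨fun x => modApp m.hom x, fun a x => rfl, fun a x y k => modApp_naturality m.hom k,
        fun a b f x => ?_⟩
      refine (congrArg (_ ≫ ·) (natApp_comp_trans t.obj j.obj f x).symm).trans ?_
      exact (modApp_natApp m.hom f x).trans
        (congrArg (· ≫ _) (natApp_comp_trans s.obj j.obj f x))
    refine ⟨ObjectProperty.homMk (mkMod
      (fun {a} x => (j.obj.app a).toFunctor.preimage (n x)) ?_ ?_), ?_⟩
    · intro a x y k
      apply (j.obj.app a).toFunctor.map_injective
      rw [Functor.map_comp, Functor.map_comp, Functor.map_preimage, Functor.map_preimage]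
      exact hn₁ a x y k
    · intro a b f x
      apply (j.obj.app b).toFunctor.map_injective
      -- The structure 2-cell of `j` is invertible; composing with it turns the goal into the axiom
      -- `hn₂` for `m`.
      rw [Functor.map_comp, Functor.map_comp, Functor.map_preimage,
        ← cancel_mono (natApp j.obj f _).hom, Category.assoc, Category.assoc, hn₂,
        natApp_naturality j.obj f, Functor.map_preimage, Category.assoc]
    · ext : 1
      refine mod_ext fun a x => ?_
      exact ((j.obj.app a).toFunctor.map_preimage _).trans (hn a x)
  · ext : 1
    refine mod_ext fun a x => (j.obj.app a).toFunctor.map_injective ?_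
    exact congrArg (fun k => modApp k.hom x) h

/-- Only essential surjectivity uses cofibrancy, by the factorization up to isomorphism through `j`.
-/
theorem IsCofibrant.postcompTwoNat_isEquivalence [Strict E] {G : StrictPseudofunctor E Cat.{u, u}}
    (hG : IsCofibrant G) (j : TwoNat X Y) (hj : ∀ e, (j.obj.app e).toFunctor.IsEquivalence) :
    (postcompTwoNat G j).IsEquivalence where
  full := (postcompTwoNat_fullyFaithful G j hj).1
  faithful := (postcompTwoNat_fullyFaithful G j hj).2
  essSurj := ⟨fun g => by
    obtain ⟨s, ⟨i⟩⟩ := hG.exists_comp_iso j hj g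
    exact ⟨s, ⟨(isTwoNatural G Y).isoMk i⟩⟩⟩

end PostComposition

/-! ### The weighted pseudo-colimit of representables, by generators and relations -/

section PseudoColimit

variable {E : Type u} [Bicategory.{u, u} E] {B : Type u} [Bicategory.{u, u} B]
  (F : StrictPseudofunctor E B) (G : StrictPseudofunctor E Cat.{u, u})

/-- The objects of the value at `b` of the pseudo-colimit of the representables `B(F e, -)` weighted
by `G`. -/
structure ColimObj (b : B) where
  /-- the index -/
  e : E
  /-- the object of the weight -/
  x : G.obj e
  /-- the 1-cell -/
  h : F.obj e ⟶ b

namespace ColimObj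

variable {F G} {b : B}

/-- The formal morphisms of the pseudo-colimit. -/
inductive Pre : ColimObj F G b → ColimObj F G b → Type u
  | id (X : ColimObj F G b) : Pre X X
  | comp {X Y Z : ColimObj F G b} (p : Pre X Y) (q : Pre Y Z) : Pre X Z
  | gen {e : E} {x y : G.obj e} {h k : F.obj e ⟶ b} (s : x ⟶ y) (β : h ⟶ k) :
      Pre ⟨e, x, h⟩ ⟨e, y, k⟩
  | glue {e e' : E} (f : e ⟶ e') (x : G.obj e) (h : F.obj e' ⟶ b) :
      Pre ⟨e, x, F.map f ≫ h⟩ ⟨e', (G.map f).toFunctor.obj x, h⟩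
  | glueInv {e e' : E} (f : e ⟶ e') (x : G.obj e) (h : F.obj e' ⟶ b) :
      Pre ⟨e', (G.map f).toFunctor.obj x, h⟩ ⟨e, x, F.map f ≫ h⟩

/-- The relations between the formal morphisms of the pseudo-colimit. -/
inductive Rel : ∀ {X Y : ColimObj F G b}, Pre X Y → Pre X Y → Prop
  | comp_left {X Y Z : ColimObj F G b} (p : Pre X Y) {q q' : Pre Y Z} :
      Rel q q' → Rel (p.comp q) (p.comp q')
  | comp_right {X Y Z : ColimObj F G b} {p p' : Pre X Y} (q : Pre Y Z) :
      Rel p p' → Rel (p.comp q) (p'.comp q)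
  | id_comp {X Y : ColimObj F G b} (p : Pre X Y) : Rel ((Pre.id X).comp p) p
  | comp_id {X Y : ColimObj F G b} (p : Pre X Y) : Rel (p.comp (Pre.id Y)) p
  | assoc {X Y Z W : ColimObj F G b} (p : Pre X Y) (q : Pre Y Z) (r : Pre Z W) :
      Rel ((p.comp q).comp r) (p.comp (q.comp r))
  | gen_id {e : E} (x : G.obj e) (h : F.obj e ⟶ b) :
      Rel (Pre.gen (𝟙 x) (𝟙 h)) (Pre.id ⟨e, x, h⟩)
  | gen_comp {e : E} {x y z : G.obj e} {h k l : F.obj e ⟶ b} (s : x ⟶ y) (β : h ⟶ k) (t : y ⟶ z)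
      (θ : k ⟶ l) : Rel (Pre.gen (s ≫ t) (β ≫ θ)) ((Pre.gen s β).comp (Pre.gen t θ))
  | glue_naturality {e e' : E} (f : e ⟶ e') {x y : G.obj e} {h k : F.obj e' ⟶ b} (s : x ⟶ y)
      (β : h ⟶ k) :
      Rel ((Pre.gen s (F.map f ◁ β)).comp (Pre.glue f y k))
        ((Pre.glue f x h).comp (Pre.gen ((G.map f).toFunctor.map s) β))
  | glue_map₂ {e e' : E} {f g : e ⟶ e'} (η : f ⟶ g) (x : G.obj e) (h : F.obj e' ⟶ b) :
      Rel ((Pre.gen (𝟙 x) (F.map₂ η ▷ h)).comp (Pre.glue g x h))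
        ((Pre.glue f x h).comp (Pre.gen (map₂App G η x) (𝟙 h)))
  | glue_mapId {e : E} (x : G.obj e) (h : F.obj e ⟶ b) :
      Rel ((Pre.glue (𝟙 e) x h).comp (Pre.gen (mapIdApp G x).hom (𝟙 h)))
        (Pre.gen (𝟙 x) ((F.mapId e).hom ▷ h ≫ (λ_ h).hom))
  | glue_mapComp {e e' e'' : E} (f : e ⟶ e') (g : e' ⟶ e'') (x : G.obj e) (h : F.obj e'' ⟶ b) :
      Rel ((Pre.glue (f ≫ g) x h).comp (Pre.gen (mapCompApp G f g x).hom (𝟙 h)))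
        ((Pre.gen (𝟙 x) ((F.mapComp f g).hom ▷ h ≫ (α_ _ _ _).hom)).comp
          ((Pre.glue f x (F.map g ≫ h)).comp (Pre.glue g ((G.map f).toFunctor.obj x) h)))
  | glue_glueInv {e e' : E} (f : e ⟶ e') (x : G.obj e) (h : F.obj e' ⟶ b) :
      Rel ((Pre.glue f x h).comp (Pre.glueInv f x h)) (Pre.id _)
  | glueInv_glue {e e' : E} (f : e ⟶ e') (x : G.obj e) (h : F.obj e' ⟶ b) :
      Rel ((Pre.glueInv f x h).comp (Pre.glue f x h)) (Pre.id _)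

/-- Objects and formal morphisms both live in universe `u`, so the quotient is a small category and
can be a value of a 2-functor to `Cat.{u, u}`. -/
instance : Category.{u} (ColimObj F G b) where
  Hom X Y := Quot (Rel (X := X) (Y := Y))
  id X := Quot.mk _ (Pre.id X)
  comp := Quot.map₂ Pre.comp (fun p _ _ => Rel.comp_left p) (fun _ _ q => Rel.comp_right q)
  id_comp := by
    rintro X Y ⟨p⟩
    exact Quot.sound (Rel.id_comp p)
  comp_id := by
    rintro X Y ⟨p⟩
    exact Quot.sound (Rel.comp_id p)
  assoc := by
    rintro X Y Z W ⟨p⟩ ⟨q⟩ ⟨r⟩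
    exact Quot.sound (Rel.assoc p q r)

/-- The morphisms of the pseudo-colimit induced by a morphism of the weight and a 2-cell. -/
def gen {e : E} {x y : G.obj e} {h k : F.obj e ⟶ b} (s : x ⟶ y) (β : h ⟶ k) :
    (⟨e, x, h⟩ : ColimObj F G b) ⟶ ⟨e, y, k⟩ :=
  Quot.mk _ (Pre.gen s β)

/-- The structure isomorphisms of the pseudo-colimit. -/
def glue {e e' : E} (f : e ⟶ e') (x : G.obj e) (h : F.obj e' ⟶ b) :
    (⟨e, x, F.map f ≫ h⟩ : ColimObj F G b) ≅ ⟨e', (G.map f).toFunctor.obj x, h⟩ where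
  hom := Quot.mk _ (Pre.glue f x h)
  inv := Quot.mk _ (Pre.glueInv f x h)
  hom_inv_id := Quot.sound (Rel.glue_glueInv f x h)
  inv_hom_id := Quot.sound (Rel.glueInv_glue f x h)

@[simp]
lemma gen_id {e : E} (x : G.obj e) (h : F.obj e ⟶ b) :
    gen (𝟙 x) (𝟙 h) = 𝟙 (⟨e, x, h⟩ : ColimObj F G b) :=
  Quot.sound (Rel.gen_id x h)

lemma gen_comp_gen {e : E} {x y z : G.obj e} {h k l : F.obj e ⟶ b} (s : x ⟶ y) (β : h ⟶ k)
    (t : y ⟶ z) (θ : k ⟶ l) : gen s β ≫ gen t θ = gen (s ≫ t) (β ≫ θ) :=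
  (Quot.sound (Rel.gen_comp s β t θ)).symm

lemma gen_comp_gen_assoc {e : E} {x y z : G.obj e} {h k l : F.obj e ⟶ b} (s : x ⟶ y)
    (β : h ⟶ k) (t : y ⟶ z) (θ : k ⟶ l) {W : ColimObj F G b}
    (p : (⟨e, z, l⟩ : ColimObj F G b) ⟶ W) :
    gen s β ≫ gen t θ ≫ p = gen (s ≫ t) (β ≫ θ) ≫ p := by
  rw [← Category.assoc, gen_comp_gen]

lemma glue_naturality {e e' : E} (f : e ⟶ e') {x y : G.obj e} {h k : F.obj e' ⟶ b} (s : x ⟶ y)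
    (β : h ⟶ k) : gen s (F.map f ◁ β) ≫ (glue f y k).hom =
      (glue f x h).hom ≫ gen ((G.map f).toFunctor.map s) β :=
  Quot.sound (Rel.glue_naturality f s β)

lemma glue_naturality_right {e e' : E} (f : e ⟶ e') (x : G.obj e) {h k : F.obj e' ⟶ b}
    (β : h ⟶ k) : gen (𝟙 x) (F.map f ◁ β) ≫ (glue f x k).hom =
      (glue f x h).hom ≫ gen (𝟙 ((G.map f).toFunctor.obj x)) β := by
  rw [glue_naturality, CategoryTheory.Functor.map_id]

lemma glue_map₂ {e e' : E} {f g : e ⟶ e'} (η : f ⟶ g) (x : G.obj e) (h : F.obj e' ⟶ b) :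
    gen (𝟙 x) (F.map₂ η ▷ h) ≫ (glue g x h).hom = (glue f x h).hom ≫ gen (map₂App G η x) (𝟙 h) :=
  Quot.sound (Rel.glue_map₂ η x h)

lemma glue_mapId {e : E} (x : G.obj e) (h : F.obj e ⟶ b) :
    (glue (𝟙 e) x h).hom ≫ gen (mapIdApp G x).hom (𝟙 h) =
      gen (𝟙 x) ((F.mapId e).hom ▷ h ≫ (λ_ h).hom) :=
  Quot.sound (Rel.glue_mapId x h)

lemma glue_mapComp {e e' e'' : E} (f : e ⟶ e') (g : e' ⟶ e'') (x : G.obj e) (h : F.obj e'' ⟶ b) :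
    (glue (f ≫ g) x h).hom ≫ gen (mapCompApp G f g x).hom (𝟙 h) =
      gen (𝟙 x) ((F.mapComp f g).hom ▷ h ≫ (α_ _ _ _).hom) ≫
        (glue f x (F.map g ≫ h)).hom ≫ (glue g ((G.map f).toFunctor.obj x) h).hom :=
  Quot.sound (Rel.glue_mapComp f g x h)

@[elab_as_elim]
lemma hom_induction {motive : ∀ {X Y : ColimObj F G b}, (X ⟶ Y) → Prop}
    (id : ∀ X, motive (𝟙 X)) (comp : ∀ {X Y Z : ColimObj F G b} (p : X ⟶ Y) (q : Y ⟶ Z),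
      motive p → motive q → motive (p ≫ q))
    (gen : ∀ {e : E} {x y : G.obj e} {h k : F.obj e ⟶ b} (s : x ⟶ y) (β : h ⟶ k),
      motive (gen s β))
    (glue : ∀ {e e' : E} (f : e ⟶ e') (x : G.obj e) (h : F.obj e' ⟶ b), motive (glue f x h).hom)
    (glueInv : ∀ {e e' : E} (f : e ⟶ e') (x : G.obj e) (h : F.obj e' ⟶ b),
      motive (ColimObj.glue f x h).inv)
    {X Y : ColimObj F G b} (p : X ⟶ Y) : motive p := by
  refine Quot.ind (fun q => ?_) p
  clear p
  induction q with
  | id X => exact id X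
  | comp p q hp hq => exact comp _ _ hp hq
  | gen s β => exact gen s β
  | glue f x h => exact glue f x h
  | glueInv f x h => exact glueInv f x h

variable (F G b) in
/-- The data of a functor out of the pseudo-colimit. -/
structure Desc (C : Type u) [Category.{u} C] where
  /-- the value on objects -/
  obj {e : E} (x : G.obj e) (h : F.obj e ⟶ b) : C
  /-- the value on the morphisms `gen` -/
  map {e : E} {x y : G.obj e} {h k : F.obj e ⟶ b} (s : x ⟶ y) (β : h ⟶ k) : obj x h ⟶ obj y k
  map_id {e : E} (x : G.obj e) (h : F.obj e ⟶ b) : map (𝟙 x) (𝟙 h) = 𝟙 _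
  map_comp {e : E} {x y z : G.obj e} {h k l : F.obj e ⟶ b} (s : x ⟶ y) (β : h ⟶ k)
    (t : y ⟶ z) (θ : k ⟶ l) : map (s ≫ t) (β ≫ θ) = map s β ≫ map t θ
  /-- the value on the isomorphisms `glue` -/
  glue {e e' : E} (f : e ⟶ e') (x : G.obj e) (h : F.obj e' ⟶ b) :
    obj x (F.map f ≫ h) ≅ obj ((G.map f).toFunctor.obj x) h
  glue_naturality {e e' : E} (f : e ⟶ e') {x y : G.obj e} {h k : F.obj e' ⟶ b} (s : x ⟶ y)
    (β : h ⟶ k) : map s (F.map f ◁ β) ≫ (glue f y k).hom =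
      (glue f x h).hom ≫ map ((G.map f).toFunctor.map s) β
  glue_map₂ {e e' : E} {f g : e ⟶ e'} (η : f ⟶ g) (x : G.obj e) (h : F.obj e' ⟶ b) :
    map (𝟙 x) (F.map₂ η ▷ h) ≫ (glue g x h).hom = (glue f x h).hom ≫ map (map₂App G η x) (𝟙 h)
  glue_mapId {e : E} (x : G.obj e) (h : F.obj e ⟶ b) :
    (glue (𝟙 e) x h).hom ≫ map (mapIdApp G x).hom (𝟙 h) =
      map (𝟙 x) ((F.mapId e).hom ▷ h ≫ (λ_ h).hom)
  glue_mapComp {e e' e'' : E} (f : e ⟶ e') (g : e' ⟶ e'') (x : G.obj e) (h : F.obj e'' ⟶ b) :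
    (glue (f ≫ g) x h).hom ≫ map (mapCompApp G f g x).hom (𝟙 h) =
      map (𝟙 x) ((F.mapComp f g).hom ▷ h ≫ (α_ _ _ _).hom) ≫
        (glue f x (F.map g ≫ h)).hom ≫ (glue g ((G.map f).toFunctor.obj x) h).hom

namespace Desc

variable {C : Type u} [Category.{u} C] (d : Desc F G b C)

/-- The value on formal morphisms. -/
def preMap : ∀ {X Y : ColimObj F G b}, Pre X Y → (d.obj X.x X.h ⟶ d.obj Y.x Y.h)
  | _, _, .id _ => 𝟙 _
  | _, _, .comp p q => preMap p ≫ preMap q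
  | _, _, .gen s β => d.map s β
  | _, _, .glue f x h => (d.glue f x h).hom
  | _, _, .glueInv f x h => (d.glue f x h).inv

lemma preMap_eq {X Y : ColimObj F G b} {p q : Pre X Y} (r : Rel p q) :
    d.preMap p = d.preMap q := by
  induction r with
  | comp_left p _ ih => exact congrArg (d.preMap p ≫ ·) ih
  | comp_right q _ ih => exact congrArg (· ≫ d.preMap q) ih
  | id_comp p => exact Category.id_comp _
  | comp_id p => exact Category.comp_id _
  | assoc p q r => exact Category.assoc _ _ _
  | gen_id x h => exact d.map_id x h
  | gen_comp s β t θ => exact d.map_comp s β t θ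
  | glue_naturality f s β => exact d.glue_naturality f s β
  | glue_map₂ η x h => exact d.glue_map₂ η x h
  | glue_mapId x h => exact d.glue_mapId x h
  | glue_mapComp f g x h => exact d.glue_mapComp f g x h
  | glue_glueInv f x h => exact (d.glue f x h).hom_inv_id
  | glueInv_glue f x h => exact (d.glue f x h).inv_hom_id

/-- The functor out of the pseudo-colimit. -/
def functor : ColimObj F G b ⥤ C where
  obj X := d.obj X.x X.h
  map := Quot.lift d.preMap fun _ _ => d.preMap_eq
  map_id _ := rfl
  map_comp := by
    rintro X Y Z ⟨p⟩ ⟨q⟩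
    rfl

end Desc

/-- Naturality squares paste along composites and can be inverted along isomorphisms, so only the
generators `gen` and `glue` have to be tested. This is how all transformations out of the
pseudo-colimit are obtained. -/
lemma naturality_of_gen {C : Type u} [Category.{u} C] (S T : ColimObj F G b ⥤ C)
    (m : ∀ X, S.obj X ⟶ T.obj X)
    (gen : ∀ {e : E} {x y : G.obj e} {h k : F.obj e ⟶ b} (s : x ⟶ y) (β : h ⟶ k),
      S.map (gen s β) ≫ m ⟨e, y, k⟩ = m ⟨e, x, h⟩ ≫ T.map (ColimObj.gen s β))
    (glue : ∀ {e e' : E} (f : e ⟶ e') (x : G.obj e) (h : F.obj e' ⟶ b),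
      S.map (glue f x h).hom ≫ m ⟨e', (G.map f).toFunctor.obj x, h⟩ =
        m ⟨e, x, F.map f ≫ h⟩ ≫ T.map (ColimObj.glue f x h).hom) {X Y : ColimObj F G b}
    (p : X ⟶ Y) :
    S.map p ≫ m Y = m X ≫ T.map p := by
  refine hom_induction (motive := fun {X Y} p => S.map p ≫ m Y = m X ≫ T.map p) ?_ ?_ gen glue ?_ p
  · intro X
    simp
  · intro X Y Z p q hp hq
    rw [Functor.map_comp, Category.assoc, hq, reassoc_of% hp, Functor.map_comp]
  · intro e e' f x h
    rw [← Functor.mapIso_inv, ← Functor.mapIso_inv, Iso.inv_comp_eq, ← Category.assoc,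
      Iso.eq_comp_inv]
    exact (glue f x h).symm

end ColimObj

open ColimObj

/-- The action of a 1-cell on the pseudo-colimit. -/
def colimMapDesc {b c : B} (k : b ⟶ c) : Desc F G b (ColimObj F G c) where
  obj {e} x h := ⟨e, x, h ≫ k⟩
  map s β := gen s (β ▷ k)
  map_id x h := by rw [id_whiskerRight, gen_id]
  map_comp s β t θ := by rw [comp_whiskerRight, gen_comp_gen]
  -- The source is `(e, x, (F f ≫ h) ≫ k)`, so an associator must precede the gluing along `f`.
  glue f x h :=
    { hom := gen (𝟙 x) (α_ (F.map f) h k).hom ≫ (glue f x (h ≫ k)).hom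
      inv := (glue f x (h ≫ k)).inv ≫ gen (𝟙 x) (α_ (F.map f) h k).inv
      hom_inv_id := by
        rw [Category.assoc, Iso.hom_inv_id_assoc, gen_comp_gen, Category.comp_id, Iso.hom_inv_id,
          gen_id]
      inv_hom_id := by
        rw [Category.assoc, gen_comp_gen_assoc, Category.comp_id, Iso.inv_hom_id, gen_id,
          Category.id_comp, Iso.inv_hom_id] }
  glue_naturality f x y h l s β := by
    rw [gen_comp_gen_assoc, Category.assoc, ← glue_naturality, gen_comp_gen_assoc,
      Category.comp_id, Category.id_comp]
    congr 2
    simp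
  glue_map₂ η x h := by
    rw [gen_comp_gen_assoc, id_whiskerRight, Category.assoc, ← glue_map₂, gen_comp_gen_assoc,
      associator_naturality_left]
  glue_mapId x h := by
    rw [id_whiskerRight, Category.assoc, glue_mapId, gen_comp_gen, Category.comp_id]
    congr 1
    simp
  glue_mapComp f g x h := by
    rw [id_whiskerRight, Category.assoc, glue_mapComp]
    simp only [Category.assoc]
    rw [← reassoc_of% (@glue_naturality_right)]
    simp only [gen_comp_gen_assoc]
    congr 2
    · simp
    · simp

/-- The action of a 1-cell on the pseudo-colimit. -/
def colimMap {b c : B} (k : b ⟶ c) : ColimObj F G b ⥤ ColimObj F G c :=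
  (colimMapDesc F G k).functor

/-- The action of a 2-cell on the pseudo-colimit. -/
def colimMap₂ {b c : B} {k l : b ⟶ c} (θ : k ⟶ l) : colimMap F G k ⟶ colimMap F G l where
  app X := gen (𝟙 X.x) (X.h ◁ θ)
  naturality _ _ p := by
    refine naturality_of_gen (colimMap F G k) (colimMap F G l) (fun X => gen (𝟙 X.x) (X.h ◁ θ))
      ?_ ?_ p
    · intro e x y h m s β
      change gen s (β ▷ k) ≫ gen (𝟙 y) (m ◁ θ) = gen (𝟙 x) (h ◁ θ) ≫ gen s (β ▷ l)
      rw [gen_comp_gen, gen_comp_gen, Category.comp_id, Category.id_comp, whisker_exchange]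
    · intro e e' f x h
      change (gen (𝟙 x) (α_ (F.map f) h k).hom ≫ (glue f x (h ≫ k)).hom) ≫ gen (𝟙 _) (h ◁ θ) =
        gen (𝟙 x) ((F.map f ≫ h) ◁ θ) ≫ gen (𝟙 x) (α_ (F.map f) h l).hom ≫ (glue f x (h ≫ l)).hom
      rw [Category.assoc, ← glue_naturality_right, gen_comp_gen_assoc, gen_comp_gen_assoc]
      congr 2
      simp

/-- The unit constraint of the pseudo-colimit. -/
def colimMapId (b : B) : colimMap F G (𝟙 b) ⟶ 𝟭 (ColimObj F G b) where
  app X := gen (𝟙 X.x) (ρ_ X.h).hom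
  naturality _ _ p := by
    refine naturality_of_gen (colimMap F G (𝟙 b)) (𝟭 _) (fun X => gen (𝟙 X.x) (ρ_ X.h).hom) ?_ ?_ p
    · intro e x y h m s β
      change gen s (β ▷ 𝟙 b) ≫ gen (𝟙 y) (ρ_ m).hom = gen (𝟙 x) (ρ_ h).hom ≫ gen s β
      rw [gen_comp_gen, gen_comp_gen, Category.comp_id, Category.id_comp, rightUnitor_naturality]
    · intro e e' f x h
      change (gen (𝟙 x) (α_ (F.map f) h (𝟙 b)).hom ≫ (glue f x (h ≫ 𝟙 b)).hom) ≫
        gen (𝟙 _) (ρ_ h).hom = gen (𝟙 x) (ρ_ (F.map f ≫ h)).hom ≫ (glue f x h).hom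
      rw [Category.assoc, ← glue_naturality_right, gen_comp_gen_assoc]
      congr 2
      · simp
      · simp

/-- The composition constraint of the pseudo-colimit. -/
def colimMapComp {b c d : B} (k : b ⟶ c) (l : c ⟶ d) :
    colimMap F G (k ≫ l) ⟶ colimMap F G k ⋙ colimMap F G l where
  app X := gen (𝟙 X.x) (α_ X.h k l).inv
  naturality _ _ p := by
    refine naturality_of_gen (colimMap F G (k ≫ l)) (colimMap F G k ⋙ colimMap F G l)
      (fun X => gen (𝟙 X.x) (α_ X.h k l).inv) ?_ ?_ p
    · intro e x y h m s β
      change gen s (β ▷ (k ≫ l)) ≫ gen (𝟙 y) (α_ m k l).inv =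
        gen (𝟙 x) (α_ h k l).inv ≫ gen s (β ▷ k ▷ l)
      rw [gen_comp_gen, gen_comp_gen, Category.comp_id, Category.id_comp,
        associator_inv_naturality_left]
    · intro e e' f x h
      change (gen (𝟙 x) (α_ (F.map f) h (k ≫ l)).hom ≫ (glue f x (h ≫ k ≫ l)).hom) ≫
        gen (𝟙 _) (α_ h k l).inv = gen (𝟙 x) (α_ (F.map f ≫ h) k l).inv ≫
          gen (𝟙 x) ((α_ (F.map f) h k).hom ▷ l) ≫
            gen (𝟙 x) (α_ (F.map f) (h ≫ k) l).hom ≫ (glue f x ((h ≫ k) ≫ l)).hom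
      rw [Category.assoc, ← glue_naturality_right, gen_comp_gen_assoc, gen_comp_gen_assoc,
        gen_comp_gen_assoc]
      congr 2
      · simp
      · simp

-- The constraints of the pseudo-colimit are `gen` applied to unitors and associators of `B`. These
-- are identities when `B` is strict, and then the pseudo-colimit is a strict 2-functor.
variable {F G} in
lemma isId_gen {b : B} {e : E} (x : G.obj e) {h k : F.obj e ⟶ b} {β : h ⟶ k} (hβ : IsId β) :
    IsId (gen (𝟙 x) β) := by
  obtain ⟨rfl, rfl⟩ := hβ
  rw [eqToHom_refl, gen_id]
  exact IsId.id _

variable [Strict B]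

lemma isId_colimMapId {b : B} (X : ColimObj F G b) : IsId ((colimMapId F G b).app X) :=
  isId_gen X.x (IsId.rightUnitor X.h)

lemma isId_colimMapComp {b c d : B} (k : b ⟶ c) (l : c ⟶ d) (X : ColimObj F G b) :
    IsId ((colimMapComp F G k l).app X) :=
  isId_gen X.x (IsId.associator X.h k l).inv

/-- The pseudo-colimit of the representables `B(F e, -)` weighted by `G`, as a 2-functor. -/
def colimFunctor : StrictPseudofunctor B Cat.{u, u} :=
  mkStrict (fun b => Cat.of (ColimObj F G b)) (colimMap F G) (colimMap₂ F G)
    (fun k X => (congrArg (gen (𝟙 X.x)) (whiskerLeft_id X.h k)).trans (gen_id _ _))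
    (fun θ φ X => by
      refine Eq.trans ?_ (gen_comp_gen _ _ _ _).symm
      rw [Category.comp_id, ← whiskerLeft_comp]
      rfl)
    (colimMapId F G) (fun _ => isId_colimMapId F G) (colimMapComp F G) (isId_colimMapComp F G)
    (fun k l m θ X => by
      refine (gen_comp_gen _ _ _ _).trans (Eq.trans ?_ (gen_comp_gen _ _ _ _).symm)
      exact congrArg (gen _) (associator_inv_naturality_right X.h k θ))
    (fun θ l X => by
      refine (gen_comp_gen _ _ _ _).trans (Eq.trans ?_ (gen_comp_gen _ _ _ _).symm)
      exact congrArg (gen _) (associator_inv_naturality_middle X.h θ l))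

end PseudoColimit

/-! ### Transformations out of representables, and cocones on them -/

section HomYoneda

variable {E : Type u} [Bicategory.{u, u} E] [Strict E] {B : Type u} [Bicategory.{u, u} B]
  [Strict B] (F : StrictPseudofunctor E B) (D : StrictPseudofunctor B Cat.{u, u})

/-- The 2-functor `e ↦ Ps(B, Cat)(B(F e, -), D)`. -/
abbrev homYoneda : StrictPseudofunctor E Cat.{u, u} :=
  homFunctor (op (Ps.of D)) (F.comp (yoneda B))

variable {F D} {e e' : E} {b c : B}

/-- The pseudo-natural transformation underlying an object of `homYoneda F D`. -/
def toTrans (T : (homYoneda F D).obj e) :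
    (homFunctor (F.obj e) (StrictPseudofunctor.id B)).toPseudofunctor ⟶ D.toPseudofunctor :=
  (Quiver.Hom.unop T).hom

/-- The object of `homYoneda F D` given by a pseudo-natural transformation. -/
def ofTrans (t : (homFunctor (F.obj e) (StrictPseudofunctor.id B)).toPseudofunctor ⟶
    D.toPseudofunctor) : (homYoneda F D).obj e :=
  (Ps.hom t).op

/-- The modification underlying a morphism of `homYoneda F D`. -/
def toMod {S T : (homYoneda F D).obj e} (m : S ⟶ T) : toTrans S ⟶ toTrans T :=
  (Bicategory.Opposite.Hom2.unop2 m).hom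

/-- The morphism of `homYoneda F D` given by a modification. -/
def ofMod {S T : (homYoneda F D).obj e} (m : toTrans S ⟶ toTrans T) : S ⟶ T :=
  Bicategory.Opposite.Hom2.op2' (InducedBicategory.Hom₂.mk m)

/-- The isomorphism of `homYoneda F D` given by an invertible modification. -/
def ofModIso {S T : (homYoneda F D).obj e} (m : toTrans S ≅ toTrans T) : S ≅ T where
  hom := ofMod m.hom
  inv := ofMod m.inv
  hom_inv_id := congrArg ofMod m.hom_inv_id
  inv_hom_id := congrArg ofMod m.inv_hom_id

/-- The value of `T : B(F e, -) ⟶ D` at a 1-cell `h`. -/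
def elt (T : (homYoneda F D).obj e) (h : F.obj e ⟶ b) : D.obj b :=
  ((toTrans T).app b).toFunctor.obj h

/-- The value of `T : B(F e, -) ⟶ D` at a 2-cell. -/
def eltMap (T : (homYoneda F D).obj e) {h k : F.obj e ⟶ b} (β : h ⟶ k) : elt T h ⟶ elt T k :=
  ((toTrans T).app b).toFunctor.map β

/-- The naturality constraint of `T : B(F e, -) ⟶ D`. -/
def eltNat (T : (homYoneda F D).obj e) (k : b ⟶ c) (h : F.obj e ⟶ b) :
    elt T (h ≫ k) ≅ (D.map k).toFunctor.obj (elt T h) :=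
  natApp (toTrans T) k h

/-- The components of a morphism of `homYoneda F D`. -/
def cell {S T : (homYoneda F D).obj e} (m : S ⟶ T) (h : F.obj e ⟶ b) : elt S h ⟶ elt T h :=
  modApp (toMod m) h

@[simp]
lemma eltMap_id (T : (homYoneda F D).obj e) (h : F.obj e ⟶ b) : eltMap T (𝟙 h) = 𝟙 _ :=
  ((toTrans T).app b).toFunctor.map_id h

lemma eltMap_comp (T : (homYoneda F D).obj e) {h k l : F.obj e ⟶ b} (β : h ⟶ k) (θ : k ⟶ l) :
    eltMap T (β ≫ θ) = eltMap T β ≫ eltMap T θ :=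
  ((toTrans T).app b).toFunctor.map_comp β θ

lemma isId_eltMap (T : (homYoneda F D).obj e) {h k : F.obj e ⟶ b} {β : h ⟶ k} (hβ : IsId β) :
    IsId (eltMap T β) :=
  hβ.map ((toTrans T).app b).toFunctor

lemma eltNat_naturality (T : (homYoneda F D).obj e) (k : b ⟶ c) {h l : F.obj e ⟶ b}
    (β : h ⟶ l) : eltMap T (β ▷ k) ≫ (eltNat T k l).hom =
      (eltNat T k h).hom ≫ (D.map k).toFunctor.map (eltMap T β) :=
  natApp_naturality (toTrans T) k β

lemma eltNat_map₂ (T : (homYoneda F D).obj e) {k l : b ⟶ c} (θ : k ⟶ l) (h : F.obj e ⟶ b) :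
    eltMap T (h ◁ θ) ≫ (eltNat T l h).hom = (eltNat T k h).hom ≫ map₂App D θ (elt T h) :=
  natApp_map₂ (toTrans T) θ h

/-- Both sides are identities with the same ends. The form with a unitor is the one that matches the
relations of the pseudo-colimit. -/
lemma mapIdApp_homFunctor_id {a : B} (h : a ⟶ b) :
    (mapIdApp (homFunctor a (StrictPseudofunctor.id B)) (a := b) h).hom = (ρ_ h).hom :=
  (isId_mapIdApp (homFunctor a (StrictPseudofunctor.id B)) (a := b) h).eq (IsId.rightUnitor h)

lemma mapCompApp_homFunctor_id {a d : B} (h : a ⟶ b) (k : b ⟶ c) (l : c ⟶ d) :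
    (mapCompApp (homFunctor a (StrictPseudofunctor.id B)) k l h).hom = (α_ h k l).inv :=
  (isId_mapCompApp (homFunctor a (StrictPseudofunctor.id B)) k l h).eq (IsId.associator h k l).inv

lemma eltNat_id (T : (homYoneda F D).obj e) (h : F.obj e ⟶ b) :
    (eltNat T (𝟙 b) h).hom ≫ (mapIdApp D (elt T h)).hom = eltMap T (ρ_ h).hom :=
  (natApp_id (toTrans T) (a := b) h).trans
    (congrArg ((toTrans T).app b).toFunctor.map (mapIdApp_homFunctor_id h))

lemma eltNat_comp {d : B} (T : (homYoneda F D).obj e) (k : b ⟶ c) (l : c ⟶ d)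
    (h : F.obj e ⟶ b) :
    (eltNat T (k ≫ l) h).hom ≫ (mapCompApp D k l (elt T h)).hom =
      eltMap T (α_ h k l).inv ≫ (eltNat T l (h ≫ k)).hom ≫
        (D.map l).toFunctor.map (eltNat T k h).hom :=
  (natApp_comp (toTrans T) k l h).trans
    (congrArg (fun m => ((toTrans T).app d).toFunctor.map m ≫ (eltNat T l (h ≫ k)).hom ≫
      (D.map l).toFunctor.map (eltNat T k h).hom) (mapCompApp_homFunctor_id h k l))

@[simp]
lemma cell_id (T : (homYoneda F D).obj e) (h : F.obj e ⟶ b) : cell (𝟙 T) h = 𝟙 _ := rfl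

@[simp]
lemma cell_comp {R S T : (homYoneda F D).obj e} (m : R ⟶ S) (n : S ⟶ T) (h : F.obj e ⟶ b) :
    cell (m ≫ n) h = cell m h ≫ cell n h := rfl

lemma cell_naturality {S T : (homYoneda F D).obj e} (m : S ⟶ T) {h k : F.obj e ⟶ b}
    (β : h ⟶ k) : eltMap S β ≫ cell m k = cell m h ≫ eltMap T β :=
  modApp_naturality (toMod m) β

lemma cell_eltNat {S T : (homYoneda F D).obj e} (m : S ⟶ T) (k : b ⟶ c) (h : F.obj e ⟶ b) :
    cell m (h ≫ k) ≫ (eltNat T k h).hom =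
      (eltNat S k h).hom ≫ (D.map k).toFunctor.map (cell m h) :=
  modApp_natApp (toMod m) k h

lemma cell_ext {S T : (homYoneda F D).obj e} {m n : S ⟶ T}
    (w : ∀ (b : B) (h : F.obj e ⟶ b), cell m h = cell n h) : m = n :=
  congrArg ofMod (mod_ext (m := toMod m) (n := toMod n) fun b h => w b h)

lemma isId_cell {S T : (homYoneda F D).obj e} {m : S ⟶ T} (hm : IsId m) (h : F.obj e ⟶ b) :
    IsId (cell m h) := by
  obtain ⟨rfl, rfl⟩ := hm
  exact IsId.id _

/-- The components of an isomorphism of `homYoneda F D`. -/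
def cellIso {S T : (homYoneda F D).obj e} (m : S ≅ T) (h : F.obj e ⟶ b) : elt S h ≅ elt T h where
  hom := cell m.hom h
  inv := cell m.inv h
  hom_inv_id := by rw [← cell_comp, Iso.hom_inv_id, cell_id]
  inv_hom_id := by rw [← cell_comp, Iso.inv_hom_id, cell_id]

/-- Constructor for the objects of `homYoneda F D`. -/
def eltMk (app : ∀ b, (F.obj e ⟶ b) ⥤ D.obj b)
    (nat : ∀ {b c : B} (k : b ⟶ c) (h : F.obj e ⟶ b),
      (app c).obj (h ≫ k) ≅ (D.map k).toFunctor.obj ((app b).obj h))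
    (nat_naturality : ∀ {b c : B} (k : b ⟶ c) {h l : F.obj e ⟶ b} (β : h ⟶ l),
      (app c).map (β ▷ k) ≫ (nat k l).hom = (nat k h).hom ≫ (D.map k).toFunctor.map ((app b).map β))
    (nat_map₂ : ∀ {b c : B} {k l : b ⟶ c} (θ : k ⟶ l) (h : F.obj e ⟶ b),
      (app c).map (h ◁ θ) ≫ (nat l h).hom = (nat k h).hom ≫ map₂App D θ ((app b).obj h))
    (nat_id : ∀ {b : B} (h : F.obj e ⟶ b),
      (nat (𝟙 b) h).hom ≫ (mapIdApp D ((app b).obj h)).hom = (app b).map (ρ_ h).hom)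
    (nat_comp : ∀ {b c d : B} (k : b ⟶ c) (l : c ⟶ d) (h : F.obj e ⟶ b),
      (nat (k ≫ l) h).hom ≫ (mapCompApp D k l ((app b).obj h)).hom =
        (app d).map (α_ h k l).inv ≫ (nat l (h ≫ k)).hom ≫
          (D.map l).toFunctor.map (nat k h).hom) : (homYoneda F D).obj e :=
  ofTrans (mkTrans app nat nat_naturality nat_map₂
    (fun {b} h => (nat_id h).trans (congrArg (app b).map (mapIdApp_homFunctor_id h)).symm)
    (fun {_ _ d} k l h => (nat_comp k l h).trans (congrArg (fun m => (app d).map m ≫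
      (nat l (h ≫ k)).hom ≫ (D.map l).toFunctor.map (nat k h).hom)
        (mapCompApp_homFunctor_id h k l)).symm))

/-- Constructor for the morphisms of `homYoneda F D`. -/
def cellMk {S T : (homYoneda F D).obj e} (m : ∀ {b : B} (h : F.obj e ⟶ b), elt S h ⟶ elt T h)
    (naturality : ∀ {b : B} {h k : F.obj e ⟶ b} (β : h ⟶ k),
      eltMap S β ≫ m k = m h ≫ eltMap T β)
    (nat : ∀ {b c : B} (k : b ⟶ c) (h : F.obj e ⟶ b), m (h ≫ k) ≫ (eltNat T k h).hom =
      (eltNat S k h).hom ≫ (D.map k).toFunctor.map (m h)) : S ⟶ T :=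
  ofMod (mkMod (fun h => m h) naturality nat)

/-- Constructor for the isomorphisms of `homYoneda F D`. -/
def cellMkIso {S T : (homYoneda F D).obj e}
    (m : ∀ {b : B} (h : F.obj e ⟶ b), elt S h ≅ elt T h)
    (naturality : ∀ {b : B} {h k : F.obj e ⟶ b} (β : h ⟶ k),
      eltMap S β ≫ (m k).hom = (m h).hom ≫ eltMap T β)
    (nat : ∀ {b c : B} (k : b ⟶ c) (h : F.obj e ⟶ b), (m (h ≫ k)).hom ≫ (eltNat T k h).hom =
      (eltNat S k h).hom ≫ (D.map k).toFunctor.map (m h).hom) : S ≅ T :=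
  ofModIso (mkModIso (fun h => m h) naturality nat)

/-- The action of `f` is precomposition with `B(F f, -)`, whose structure 2-cells are inverse
associators of `B`. -/
lemma eltNat_map (f : e ⟶ e') (T : (homYoneda F D).obj e) (k : b ⟶ c) (h : F.obj e' ⟶ b) :
    (eltNat (((homYoneda F D).map f).toFunctor.obj T) k h).hom =
      eltMap T (α_ (F.map f) h k).inv ≫ (eltNat T k (F.map f ≫ h)).hom :=
  natApp_comp_trans (homFunctorMap (F.map f) (StrictPseudofunctor.id B)) (toTrans T) k h

lemma cell_map (f : e ⟶ e') {S T : (homYoneda F D).obj e} (m : S ⟶ T) (h : F.obj e' ⟶ b) :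
    cell (((homYoneda F D).map f).toFunctor.map m) h = cell m (F.map f ≫ h) := rfl

lemma cell_mapIdApp (T : (homYoneda F D).obj e) (h : F.obj e ⟶ b) :
    cell (mapIdApp (homYoneda F D) T).hom h = eltMap T ((F.mapId e).hom ▷ h ≫ (λ_ h).hom) :=
  (isId_cell (isId_mapIdApp (homYoneda F D) T) h).eq
    (isId_eltMap T (((IsId.mapId F e).whiskerRight h).comp (IsId.leftUnitor h)))

lemma cell_mapCompApp {e'' : E} (f : e ⟶ e') (g : e' ⟶ e'') (T : (homYoneda F D).obj e)
    (h : F.obj e'' ⟶ b) : cell (mapCompApp (homYoneda F D) f g T).hom h =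
      eltMap T ((F.mapComp f g).hom ▷ h ≫ (α_ (F.map f) (F.map g) h).hom) :=
  (isId_cell (isId_mapCompApp (homYoneda F D) f g T) h).eq
    (isId_eltMap T (((IsId.mapComp F f g).whiskerRight h).comp (IsId.associator _ _ h)))

section Glue

variable {G : StrictPseudofunctor E Cat.{u, u}}
  (t : G.toPseudofunctor ⟶ (homYoneda F D).toPseudofunctor)

/-- The value of a pseudo-natural transformation `G ⟶ Ps(B, Cat)(B(F-, -), D)`. -/
abbrev val (x : G.obj e) : (homYoneda F D).obj e := (t.app e).toFunctor.obj x

/-- The value of a pseudo-natural transformation `G ⟶ Ps(B, Cat)(B(F-, -), D)` at a morphism. -/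
abbrev valMap {x y : G.obj e} (s : x ⟶ y) : val t x ⟶ val t y := (t.app e).toFunctor.map s

/-- The components of the structure 2-cells of `G ⟶ Ps(B, Cat)(B(F-, -), D)`. -/
def valGlue (f : e ⟶ e') (x : G.obj e) (h : F.obj e' ⟶ b) :
    elt (val t x) (F.map f ≫ h) ≅ elt (val t ((G.map f).toFunctor.obj x)) h :=
  (cellIso (natApp t f x) h).symm

/-- This law and the next four are the axioms of `t` and of its structure 2-cells, inverted so that
they run in the direction of `glue`. Up to `valGlue_mapComp`, they are the relations that a functor
out of the pseudo-colimit has to respect. -/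
lemma valGlue_naturality_left (f : e ⟶ e') {x y : G.obj e} (h : F.obj e' ⟶ b) (s : x ⟶ y) :
    cell (valMap t s) (F.map f ≫ h) ≫ (valGlue t f y h).hom =
      (valGlue t f x h).hom ≫ cell (valMap t ((G.map f).toFunctor.map s)) h := by
  rw [← Iso.inv_comp_eq, ← Category.assoc, ← Iso.eq_comp_inv]
  exact (congrArg (fun m => cell m h) (natApp_naturality t f s)).symm

lemma valGlue_naturality_right (f : e ⟶ e') (x : G.obj e) {h k : F.obj e' ⟶ b} (β : h ⟶ k) :
    eltMap (val t x) (F.map f ◁ β) ≫ (valGlue t f x k).hom =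
      (valGlue t f x h).hom ≫ eltMap (val t ((G.map f).toFunctor.obj x)) β := by
  rw [← Iso.inv_comp_eq, ← Category.assoc, ← Iso.eq_comp_inv]
  exact (cell_naturality (natApp t f x).hom β).symm

lemma valGlue_map₂ {f g : e ⟶ e'} (η : f ⟶ g) (x : G.obj e) (h : F.obj e' ⟶ b) :
    eltMap (val t x) (F.map₂ η ▷ h) ≫ (valGlue t g x h).hom =
      (valGlue t f x h).hom ≫ cell (valMap t (map₂App G η x)) h := by
  rw [← Iso.inv_comp_eq, ← Category.assoc, ← Iso.eq_comp_inv]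
  exact (congrArg (fun m => cell m h) (natApp_map₂ t η x)).symm

lemma valGlue_mapId (x : G.obj e) (h : F.obj e ⟶ b) :
    (valGlue t (𝟙 e) x h).hom ≫ cell (valMap t (mapIdApp G x).hom) h =
      eltMap (val t x) ((F.mapId e).hom ▷ h ≫ (λ_ h).hom) := by
  rw [← Iso.eq_inv_comp, ← cell_mapIdApp]
  exact (congrArg (fun m => cell m h) (natApp_id t x)).symm

lemma valGlue_mapComp {e'' : E} (f : e ⟶ e') (g : e' ⟶ e'') (x : G.obj e) (h : F.obj e'' ⟶ b) :
    (valGlue t (f ≫ g) x h).hom ≫ cell (valMap t (mapCompApp G f g x).hom) h =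
      eltMap (val t x) ((F.mapComp f g).hom ▷ h ≫ (α_ (F.map f) (F.map g) h).hom) ≫
        (valGlue t f x (F.map g ≫ h)).hom ≫
          (valGlue t g ((G.map f).toFunctor.obj x) h).hom := by
  -- This is the composition axiom of `t` evaluated at `h`, before the gluing isomorphisms are
  -- inverted.
  have H : (valGlue t (f ≫ g) x h).inv ≫
      eltMap (val t x) ((F.mapComp f g).hom ▷ h ≫ (α_ (F.map f) (F.map g) h).hom) =
      cell (valMap t (mapCompApp G f g x).hom) h ≫
        (valGlue t g ((G.map f).toFunctor.obj x) h).inv ≫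
          (valGlue t f x (F.map g ≫ h)).inv := by
    rw [← cell_mapCompApp]
    have h₁ := congrArg (fun m => cell m h) (natApp_comp t f g x)
    have h₂ := cell_map g (natApp t f x).hom h
    refine (cell_comp _ _ h).symm.trans (h₁.trans ((cell_comp _ _ h).trans
      (congrArg (_ ≫ ·) ((cell_comp _ _ h).trans ?_))))
    exact congrArg (_ ≫ ·) h₂
  rw [Iso.inv_comp_eq] at H
  rw [H]
  simp only [Category.assoc, Iso.inv_hom_id_assoc, Iso.inv_hom_id, Category.comp_id]

/-- A structure 2-cell of `t` is itself a modification between transformations out of `B(F e', -)`,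
and this is its modification axiom along `k`. It makes the transformation induced by `t` compatible
with gluing. -/
lemma valGlue_eltNat (f : e ⟶ e') (x : G.obj e) (k : b ⟶ c) (h : F.obj e' ⟶ b) :
    eltMap (val t x) (α_ (F.map f) h k).hom ≫ (valGlue t f x (h ≫ k)).hom ≫
        (eltNat (val t ((G.map f).toFunctor.obj x)) k h).hom =
      (eltNat (val t x) k (F.map f ≫ h)).hom ≫
        (D.map k).toFunctor.map (valGlue t f x h).hom := by
  have H : (valGlue t f x (h ≫ k)).inv ≫ eltMap (val t x) (α_ (F.map f) h k).inv ≫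
      (eltNat (val t x) k (F.map f ≫ h)).hom =
      (eltNat (val t ((G.map f).toFunctor.obj x)) k h).hom ≫
        (D.map k).toFunctor.map (valGlue t f x h).inv := by
    exact (congrArg (_ ≫ ·) (eltNat_map f (val t x) k h)).symm.trans
      (cell_eltNat (natApp t f x).hom k h)
  rw [Iso.inv_comp_eq] at H
  have H' := congrArg (fun m => eltMap (val t x) (α_ (F.map f) h k).hom ≫ m ≫
    (D.map k).toFunctor.map (valGlue t f x h).hom) H
  simp only [Category.assoc, ← Functor.map_comp, Iso.inv_hom_id,
    CategoryTheory.Functor.map_id, Category.comp_id] at H'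
  rw [← H', ← reassoc_of% (@eltMap_comp), Iso.hom_inv_id, eltMap_id, Category.id_comp]

end Glue

end HomYoneda

namespace ColimObj

variable {E : Type u} [Bicategory.{u, u} E] {B : Type u} [Bicategory.{u, u} B]
  {F : StrictPseudofunctor E B} {G : StrictPseudofunctor E Cat.{u, u}} {b c : B} {e e' : E}

lemma gen_id_left_comp (x : G.obj e) {h k l : F.obj e ⟶ b} (β : h ⟶ k) (θ : k ⟶ l) :
    gen (𝟙 x) (β ≫ θ) = gen (𝟙 x) β ≫ gen (𝟙 x) θ := by
  rw [gen_comp_gen, Category.comp_id]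

lemma gen_id_right_comp {x y z : G.obj e} (s : x ⟶ y) (t : y ⟶ z) (h : F.obj e ⟶ b) :
    gen (s ≫ t) (𝟙 h) = gen s (𝟙 h) ≫ gen t (𝟙 h) := by
  rw [gen_comp_gen, Category.comp_id]

lemma gen_eq_comp {x y : G.obj e} (s : x ⟶ y) {h k : F.obj e ⟶ b} (β : h ⟶ k) :
    gen s β = gen (𝟙 x) β ≫ gen s (𝟙 k) := by
  rw [gen_comp_gen, Category.comp_id, Category.id_comp]

lemma gen_exchange {x y : G.obj e} (s : x ⟶ y) {h k : F.obj e ⟶ b} (β : h ⟶ k) :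
    gen (𝟙 x) β ≫ gen s (𝟙 k) = gen s (𝟙 h) ≫ gen (𝟙 y) β := by
  simp only [gen_comp_gen, Category.comp_id, Category.id_comp]

lemma gen_id_right_whiskerRight {x y : G.obj e} (s : x ⟶ y) (h : F.obj e ⟶ b) (k : b ⟶ c) :
    gen s (𝟙 (h ≫ k)) = gen s (𝟙 h ▷ k) := by
  rw [id_whiskerRight]

lemma glue_inv_naturality_right (f : e ⟶ e') (x : G.obj e) {h k : F.obj e' ⟶ b} (β : h ⟶ k) :
    gen (𝟙 _) β ≫ (glue f x k).inv = (glue f x h).inv ≫ gen (𝟙 x) (F.map f ◁ β) := by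
  rw [Iso.comp_inv_eq, Category.assoc, glue_naturality_right, Iso.inv_hom_id_assoc]

lemma glue_inv_naturality_left (f : e ⟶ e') {x y : G.obj e} (s : x ⟶ y) (h : F.obj e' ⟶ b) :
    gen ((G.map f).toFunctor.map s) (𝟙 h) ≫ (glue f y h).inv =
      (glue f x h).inv ≫ gen s (𝟙 (F.map f ≫ h)) := by
  rw [Iso.comp_inv_eq, Category.assoc, ← whiskerLeft_id, glue_naturality, Iso.inv_hom_id_assoc]

lemma glue_inv_map₂ {f g : e ⟶ e'} (η : f ⟶ g) (x : G.obj e) (h : F.obj e' ⟶ b) :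
    gen (map₂App G η x) (𝟙 h) ≫ (glue g x h).inv =
      (glue f x h).inv ≫ gen (𝟙 x) (F.map₂ η ▷ h) := by
  rw [Iso.comp_inv_eq, Category.assoc, glue_map₂, Iso.inv_hom_id_assoc]

lemma glue_inv_mapId (x : G.obj e) (h : F.obj e ⟶ b) :
    (glue (𝟙 e) x h).inv ≫ gen (𝟙 x) ((F.mapId e).hom ▷ h ≫ (λ_ h).hom) =
      gen (mapIdApp G x).hom (𝟙 h) := by
  rw [Iso.inv_comp_eq, glue_mapId]

lemma glue_inv_mapComp {e'' : E} (f : e ⟶ e') (g : e' ⟶ e'') (x : G.obj e)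
    (h : F.obj e'' ⟶ b) :
    (glue (f ≫ g) x h).inv ≫
        gen (𝟙 x) ((F.mapComp f g).hom ▷ h ≫ (α_ (F.map f) (F.map g) h).hom) =
      gen (mapCompApp G f g x).hom (𝟙 h) ≫ (glue g ((G.map f).toFunctor.obj x) h).inv ≫
        (glue f x (F.map g ≫ h)).inv := by
  rw [Iso.inv_comp_eq, ← Category.assoc, ← Category.assoc, Iso.eq_comp_inv, Iso.eq_comp_inv,
    glue_mapComp, Category.assoc]

end ColimObj

/-! ### The universal cocone and the transformation induced by a cocone -/

section UniversalProperty

open ColimObj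

section

variable {E : Type u} [Bicategory.{u, u} E] {B : Type u} [Bicategory.{u, u} B]
  [Strict B] {F : StrictPseudofunctor E B} {G : StrictPseudofunctor E Cat.{u, u}}

lemma mapIdApp_colimFunctor {b : B} (X : ColimObj F G b) :
    (mapIdApp (colimFunctor F G) (a := b) X).hom = (colimMapId F G b).app X :=
  (isId_mapIdApp (colimFunctor F G) (a := b) X).eq (isId_colimMapId F G X)

lemma mapCompApp_colimFunctor {b c d : B} (k : b ⟶ c) (l : c ⟶ d) (X : ColimObj F G b) :
    (mapCompApp (colimFunctor F G) k l X).hom = (colimMapComp F G k l).app X :=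
  (isId_mapCompApp (colimFunctor F G) k l X).eq (isId_colimMapComp F G k l X)

end

variable {E : Type u} [Bicategory.{u, u} E] [Strict E] {B : Type u} [Bicategory.{u, u} B]
  [Strict B] {F : StrictPseudofunctor E B} {G : StrictPseudofunctor E Cat.{u, u}}
  {D : StrictPseudofunctor B Cat.{u, u}}

variable (F G) in
/-- The value at `x` of the universal cocone: `h ↦ (e, x, h)`. -/
def unitElt {e : E} (x : G.obj e) : (homYoneda F (colimFunctor F G)).obj e :=
  eltMk
    (fun b =>
      { obj h := (⟨e, x, h⟩ : ColimObj F G b)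
        map β := gen (𝟙 x) β
        map_id h := gen_id x h
        map_comp β θ := gen_id_left_comp x β θ })
    (fun _ _ => Iso.refl _)
    (fun _ _ _ _ => (Category.comp_id _).trans (Category.id_comp _).symm)
    (fun _ _ => (Category.comp_id _).trans (Category.id_comp _).symm)
    (fun h => (Category.id_comp _).trans (mapIdApp_colimFunctor ⟨e, x, h⟩))
    (fun k l h => (Category.id_comp _).trans ((mapCompApp_colimFunctor k l ⟨e, x, h⟩).trans
      ((congrArg (_ ≫ ·) ((Category.id_comp _).trans
        ((colimMap F G l).map_id _))).trans (Category.comp_id _)).symm))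

variable (F G) in
/-- The value at a morphism of the universal cocone. -/
def unitHom {e : E} {x y : G.obj e} (s : x ⟶ y) : unitElt F G x ⟶ unitElt F G y :=
  cellMk (fun {b} h => (gen s (𝟙 h) : (⟨e, x, h⟩ : ColimObj F G b) ⟶ ⟨e, y, h⟩))
    (fun β => gen_exchange s β)
    (fun k h => (Category.comp_id _).trans ((gen_id_right_whiskerRight s h k).trans
      (Category.id_comp _).symm))

variable (F G) in
/-- The structure 2-cells of the universal cocone. -/
def unitGlue {e e' : E} (f : e ⟶ e') (x : G.obj e) :
    unitElt F G ((G.map f).toFunctor.obj x) ≅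
      ((homYoneda F (colimFunctor F G)).map f).toFunctor.obj (unitElt F G x) :=
  cellMkIso (fun {_} h => (glue f x h).symm) (fun β => glue_inv_naturality_right f x β)
    (fun k h => by
      refine (congrArg (_ ≫ ·) ((eltNat_map f (unitElt F G x) k h).trans
        (Category.comp_id _))).trans ?_
      exact (Category.id_comp _).symm)

variable (F G) in
/-- The universal cocone, as a pseudo-natural transformation. -/
def unitTrans : G.toPseudofunctor ⟶ (homYoneda F (colimFunctor F G)).toPseudofunctor :=
  mkTrans
    (fun _ =>
      { obj x := unitElt F G x
        map s := unitHom F G s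
        map_id x := cell_ext fun _ h => gen_id x h
        map_comp s t := cell_ext fun _ h => gen_id_right_comp s t h })
    (unitGlue F G)
    (fun f _ _ s => cell_ext fun _ h => glue_inv_naturality_left f s h)
    (fun η x => cell_ext fun _ h => glue_inv_map₂ η x h)
    (fun x => cell_ext fun _ h => (cell_comp _ _ h).trans
      ((congrArg (_ ≫ ·) (cell_mapIdApp (unitElt F G x) h)).trans (glue_inv_mapId x h)))
    (fun f g x => cell_ext fun _ h => (cell_comp _ _ h).trans
      ((congrArg (_ ≫ ·) (cell_mapCompApp f g (unitElt F G x) h)).trans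
        ((glue_inv_mapComp f g x h).trans (Eq.symm ((cell_comp _ _ h).trans
          (congrArg (_ ≫ ·) ((cell_comp _ _ h).trans (congrArg (_ ≫ ·)
            (cell_map g (unitGlue F G f x).hom h)))))))))

section

variable (t : G.toPseudofunctor ⟶ (homYoneda F D).toPseudofunctor)

lemma cell_valMap_id {e : E} (x : G.obj e) {b : B} (h : F.obj e ⟶ b) :
    cell (valMap t (𝟙 x)) h = 𝟙 _ := by
  rw [valMap, CategoryTheory.Functor.map_id, cell_id]

/-- The functors out of the pseudo-colimit induced by a cocone. -/
def valDesc (b : B) : Desc F G b (D.obj b) where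
  obj x h := elt (val t x) h
  -- The order of the two factors is immaterial by `cell_naturality`, which is what makes this
  -- assignment functorial.
  map {e x y h k} s β := eltMap (val t x) β ≫ cell (valMap t s) k
  map_id x h := by
    rw [eltMap_id, Category.id_comp, cell_valMap_id]
  map_comp s β s' θ := by
    rw [eltMap_comp, valMap, Functor.map_comp, cell_comp, Category.assoc, Category.assoc,
      reassoc_of% (@cell_naturality)]
  glue f x h := valGlue t f x h
  glue_naturality f x y h k s β := by
    rw [Category.assoc, valGlue_naturality_left, ← Category.assoc, valGlue_naturality_right,
      Category.assoc]
  glue_map₂ η x h := by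
    rw [cell_valMap_id, Category.comp_id, eltMap_id, Category.id_comp, valGlue_map₂]
  glue_mapId x h := by
    rw [eltMap_id, Category.id_comp, valGlue_mapId, cell_valMap_id, Category.comp_id]
  glue_mapComp f g x h := by
    rw [eltMap_id, Category.id_comp, valGlue_mapComp, cell_valMap_id, Category.comp_id]

lemma valDesc_functor_gen_id {b : B} {e : E} (x : G.obj e) {h k : F.obj e ⟶ b} (β : h ⟶ k) :
    (valDesc t b).functor.map (gen (𝟙 x) β) = eltMap (val t x) β :=
  (congrArg (_ ≫ ·) (cell_valMap_id t x k)).trans (Category.comp_id _)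

lemma valDesc_functor_gen_id_right {b : B} {e : E} {x y : G.obj e} (s : x ⟶ y)
    (h : F.obj e ⟶ b) : (valDesc t b).functor.map (gen s (𝟙 h)) = cell (valMap t s) h :=
  (congrArg (· ≫ _) (eltMap_id (val t x) h)).trans (Category.id_comp _)

/-- Together with `eltNat_glue`, this provides the squares on generators that make the structure
2-cells of `valTrans` natural. -/
lemma eltNat_gen {b c : B} (k : b ⟶ c) {e : E} {x y : G.obj e} {h l : F.obj e ⟶ b} (s : x ⟶ y)
    (β : h ⟶ l) : (eltMap (val t x) (β ▷ k) ≫ cell (valMap t s) (l ≫ k)) ≫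
      (eltNat (val t y) k l).hom = (eltNat (val t x) k h).hom ≫
        (D.map k).toFunctor.map (eltMap (val t x) β ≫ cell (valMap t s) l) := by
  rw [Category.assoc, cell_eltNat, reassoc_of% (@eltNat_naturality), Functor.map_comp]

lemma eltNat_glue {b c : B} (k : b ⟶ c) {e e' : E} (f : e ⟶ e') (x : G.obj e)
    (h : F.obj e' ⟶ b) :
    ((eltMap (val t x) (α_ (F.map f) h k).hom ≫ cell (valMap t (𝟙 x)) _) ≫
        (valGlue t f x (h ≫ k)).hom) ≫ (eltNat (val t ((G.map f).toFunctor.obj x)) k h).hom =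
      (eltNat (val t x) k (F.map f ≫ h)).hom ≫
        (D.map k).toFunctor.map (valGlue t f x h).hom := by
  rw [cell_valMap_id, Category.comp_id]
  exact (Category.assoc _ _ _).trans (valGlue_eltNat t f x k h)

/-- The pseudo-natural transformation out of the pseudo-colimit induced by a cocone. -/
def valTrans : (colimFunctor F G).toPseudofunctor ⟶ D.toPseudofunctor :=
  mkTrans (X := colimFunctor F G) (fun b => (valDesc t b).functor)
    (fun k X => eltNat (val t (ColimObj.x X)) k (ColimObj.h X))
    (fun {b c} k _ _ p => naturality_of_gen (colimMap F G k ⋙ (valDesc t c).functor)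
      ((valDesc t b).functor ⋙ (D.map k).toFunctor) (fun X => (eltNat (val t X.x) k X.h).hom)
      (fun s β => eltNat_gen t k s β) (fun f x h => eltNat_glue t k f x h) p)
    (fun θ X => (congrArg (· ≫ _) (valDesc_functor_gen_id t (ColimObj.x X)
      (ColimObj.h X ◁ θ))).trans (eltNat_map₂ (val t (ColimObj.x X)) θ (ColimObj.h X)))
    (fun {b} X => (eltNat_id (val t (ColimObj.x X)) (ColimObj.h X)).trans (Eq.symm
      ((congrArg (valDesc t b).functor.map (mapIdApp_colimFunctor X)).trans
        (valDesc_functor_gen_id t (ColimObj.x X) (ρ_ (ColimObj.h X)).hom))))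
    (fun {_ _ d} k l X => (eltNat_comp (val t (ColimObj.x X)) k l (ColimObj.h X)).trans (Eq.symm
      (congrArg (· ≫ _) ((congrArg (valDesc t d).functor.map (mapCompApp_colimFunctor k l X)).trans
        (valDesc_functor_gen_id t (ColimObj.x X) (α_ (ColimObj.h X) k l).inv)))))

end

end UniversalProperty

section Precomposition

variable {E : Type u} [Bicategory.{u, u} E] [Strict E] {B : Type u} [Bicategory.{u, u} B]
  [Strict B] {F : StrictPseudofunctor E B} {G : StrictPseudofunctor E Cat.{u, u}}
  {D D' : StrictPseudofunctor B Cat.{u, u}} {e e' : E} {b : B}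

/-- The structure 2-cell is an associator of the 2-category of pseudo-natural transformations, and
its components are identities. -/
lemma cell_natApp_homFunctorMap (f : op (Ps.of D) ⟶ op (Ps.of D')) (l : e ⟶ e')
    (T : (homYoneda F D').obj e) (h : F.obj e' ⟶ b) :
    cell (natApp (homFunctorMap f (F.comp (yoneda B))) l T).hom h =
      𝟙 ((f.unop.hom.app b).toFunctor.obj (elt T (F.map l ≫ h))) := rfl

lemma cell_natApp_comp_homFunctorMap (t : G.toPseudofunctor ⟶ (homYoneda F D').toPseudofunctor)
    (f : op (Ps.of D) ⟶ op (Ps.of D')) (l : e ⟶ e') (x : G.obj e) (h : F.obj e' ⟶ b) :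
    cell (natApp (t ≫ homFunctorMap f (F.comp (yoneda B))) l x).hom h =
      (f.unop.hom.app b).toFunctor.map (cell (natApp t l x).hom h) := by
  have h₁ : cell (natApp (t ≫ homFunctorMap f (F.comp (yoneda B))) l x).hom h =
      (f.unop.hom.app b).toFunctor.map (cell (natApp t l x).hom h) ≫
        cell (natApp (homFunctorMap f (F.comp (yoneda B))) l (val t x)).hom h :=
    congrArg (fun m => cell m h) (natApp_comp_trans t (homFunctorMap f (F.comp (yoneda B))) l x)
  exact h₁.trans ((congrArg (_ ≫ ·) (cell_natApp_homFunctorMap f l (val t x) h)).trans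
    (Category.comp_id _))

end Precomposition

/-! ### The universal property of the pseudo-colimit -/

section Colimit

open ColimObj

variable {E : Type u} [Bicategory.{u, u} E] [Strict E] {B : Type u} [Bicategory.{u, u} B]
  [Strict B] {F : StrictPseudofunctor E B} {G : StrictPseudofunctor E Cat.{u, u}}
  {D : StrictPseudofunctor B Cat.{u, u}}

/-- The pseudo-natural transformation underlying a 1-morphism out of the pseudo-colimit. -/
def outTrans (f : op (Ps.of D) ⟶ op (Ps.of (colimFunctor F G))) :
    (colimFunctor F G).toPseudofunctor ⟶ D.toPseudofunctor :=
  f.unop.hom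

/-- The functors underlying a 1-morphism out of the pseudo-colimit. -/
def outFunctor (f : op (Ps.of D) ⟶ op (Ps.of (colimFunctor F G))) (b : B) :
    ColimObj F G b ⥤ D.obj b :=
  ((outTrans f).app b).toFunctor

/-- The naturality constraint of a 1-morphism out of the pseudo-colimit. -/
def outNat (f : op (Ps.of D) ⟶ op (Ps.of (colimFunctor F G))) {b c : B} (k : b ⟶ c)
    (X : ColimObj F G b) :
    (outFunctor f c).obj ((colimMap F G k).obj X) ≅
      (D.map k).toFunctor.obj ((outFunctor f b).obj X) :=
  natApp (outTrans f) k X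

/-- The cocone induced by a 1-morphism out of the pseudo-colimit. -/
def coconeOf (f : op (Ps.of D) ⟶ op (Ps.of (colimFunctor F G))) :
    G.toPseudofunctor ⟶ (homYoneda F D).toPseudofunctor :=
  unitTrans F G ≫ homFunctorMap f (F.comp (yoneda B))

section

variable (f : op (Ps.of D) ⟶ op (Ps.of (colimFunctor F G))) {e e' : E} {b c : B}

lemma eltMap_coconeOf (x : G.obj e) {h k : F.obj e ⟶ b} (β : h ⟶ k) :
    eltMap (val (coconeOf f) x) β = (outFunctor f b).map (gen (𝟙 x) β) := rfl

lemma cell_coconeOf {x y : G.obj e} (s : x ⟶ y) (h : F.obj e ⟶ b) :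
    cell (valMap (coconeOf f) s) h = (outFunctor f b).map (gen s (𝟙 h)) := rfl

lemma eltNat_coconeOf (x : G.obj e) (k : b ⟶ c) (h : F.obj e ⟶ b) :
    (eltNat (val (coconeOf f) x) k h).hom = (outNat f k ⟨e, x, h⟩).hom := by
  refine (natApp_comp_trans (toTrans (unitElt F G x)) (outTrans f) k h).trans ?_
  exact (congrArg (· ≫ _) ((outFunctor f c).map_id _)).trans (Category.id_comp _)

lemma valGlue_inv_coconeOf (l : e ⟶ e') (x : G.obj e) (h : F.obj e' ⟶ b) :
    (valGlue (coconeOf f) l x h).inv = (outFunctor f b).map (glue l x h).inv :=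
  cell_natApp_comp_homFunctorMap (unitTrans F G) f l x h

end

/-- Every cocone is induced, up to isomorphism, by a 1-morphism out of the pseudo-colimit. -/
theorem exists_coconeOf_iso (t : G.toPseudofunctor ⟶ (homYoneda F D).toPseudofunctor) :
    ∃ f : op (Ps.of D) ⟶ op (Ps.of (colimFunctor F G)), Nonempty (coconeOf f ≅ t) := by
  -- The induced cocone takes the same values as `t` on objects, so identities serve as components.
  -- The four goals compare the actions on 2-cells, the naturality constraints, the actions on
  -- morphisms of the weight, and the structure 2-cells.
  refine ⟨(Ps.hom (valTrans t)).op, ⟨mkModIso (fun {e} x => cellMkIso (S := val (coconeOf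
    (Ps.hom (valTrans t)).op) x) (T := val t x) (fun {b} h => Iso.refl _) ?_ ?_) ?_ ?_⟩⟩
  · intro b h k β
    refine (Category.comp_id _).trans (Eq.trans ?_ (Category.id_comp _).symm)
    exact (eltMap_coconeOf _ x β).trans (valDesc_functor_gen_id t x β)
  · intro b c k h
    refine (Category.id_comp _).trans (Eq.trans ?_
      ((congrArg (_ ≫ ·) ((D.map k).toFunctor.map_id _)).trans (Category.comp_id _)).symm)
    exact (eltNat_coconeOf (Ps.hom (valTrans t)).op x k h).symm
  · intro e x y s
    refine cell_ext fun b h => ?_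
    refine (Category.comp_id _).trans (Eq.trans ?_ (Category.id_comp _).symm)
    exact (cell_coconeOf _ s h).trans (valDesc_functor_gen_id_right t s h)
  · intro e e' l x
    refine cell_ext fun b h => ?_
    refine (Category.id_comp _).trans (Eq.trans ?_ (Category.comp_id _).symm)
    exact (valGlue_inv_coconeOf (Ps.hom (valTrans t)).op l x h).symm

section

variable {f g : op (Ps.of D) ⟶ op (Ps.of (colimFunctor F G))}

/-- The components of a morphism between cocones induced by 1-morphisms out of the
pseudo-colimit. -/
def coconeCell (m : coconeOf f ⟶ coconeOf g) {b : B} (X : ColimObj F G b) :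
    (outFunctor f b).obj X ⟶ (outFunctor g b).obj X :=
  cell (S := val (coconeOf f) X.x) (T := val (coconeOf g) X.x) (modApp m X.x) X.h

/-- A generator splits as a 2-cell part followed by a weight part. The first square is naturality of
one component of `m` in the 1-cell, the second is naturality of `m` in the object of the weight. -/
lemma coconeCell_gen (m : coconeOf f ⟶ coconeOf g) {e : E} {b : B} {x y : G.obj e}
    {h k : F.obj e ⟶ b} (s : x ⟶ y) (β : h ⟶ k) :
    (outFunctor f b).map (gen s β) ≫ coconeCell m ⟨e, y, k⟩ =
      coconeCell m ⟨e, x, h⟩ ≫ (outFunctor g b).map (gen s β) := by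
  have h₁ : (outFunctor f b).map (gen (𝟙 x) β) ≫ coconeCell m ⟨e, x, k⟩ =
      coconeCell m ⟨e, x, h⟩ ≫ (outFunctor g b).map (gen (𝟙 x) β) :=
    cell_naturality (S := val (coconeOf f) x) (T := val (coconeOf g) x) (modApp m x) β
  have h₂ : (outFunctor f b).map (gen s (𝟙 k)) ≫ coconeCell m ⟨e, y, k⟩ =
      coconeCell m ⟨e, x, k⟩ ≫ (outFunctor g b).map (gen s (𝟙 k)) :=
    congrArg (fun n => cell (S := val (coconeOf f) x) (T := val (coconeOf g) y) n k)
      (modApp_naturality m s)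
  rw [gen_eq_comp, Functor.map_comp, Functor.map_comp, Category.assoc, h₂, reassoc_of% h₁]

/-- The structure 2-cells of the induced cocones are the images of the inverses of `glue`, so this
is the modification axiom of `m` along `l` with two sides inverted. -/
lemma coconeCell_glue (m : coconeOf f ⟶ coconeOf g) {e e' : E} {b : B} (l : e ⟶ e') (x : G.obj e)
    (h : F.obj e' ⟶ b) :
    (outFunctor f b).map (glue l x h).hom ≫ coconeCell m ⟨e', (G.map l).toFunctor.obj x, h⟩ =
      coconeCell m ⟨e, x, F.map l ≫ h⟩ ≫ (outFunctor g b).map (glue l x h).hom := by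
  have h₁ : coconeCell m ⟨e', (G.map l).toFunctor.obj x, h⟩ ≫
      (outFunctor g b).map (glue l x h).inv =
      (outFunctor f b).map (glue l x h).inv ≫ coconeCell m ⟨e, x, F.map l ≫ h⟩ := by
    have := congrArg (fun n => cell n h) (modApp_natApp m l x)
    refine (congrArg (_ ≫ ·) (valGlue_inv_coconeOf g l x h).symm).trans ?_
    refine Eq.trans ?_ (congrArg (· ≫ _) (valGlue_inv_coconeOf f l x h))
    exact (cell_comp _ _ h).symm.trans (this.trans (cell_comp _ _ h))
  rw [← Functor.mapIso_inv, ← Functor.mapIso_inv, Iso.comp_inv_eq, Category.assoc,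
    Iso.eq_inv_comp] at h₁
  exact h₁

lemma coconeCell_outNat (m : coconeOf f ⟶ coconeOf g) {b c : B} (k : b ⟶ c)
    (X : ColimObj F G b) :
    coconeCell m ((colimMap F G k).obj X) ≫ (outNat g k X).hom =
      (outNat f k X).hom ≫ (D.map k).toFunctor.map (coconeCell m X) := by
  refine (congrArg (_ ≫ ·) (eltNat_coconeOf g X.x k X.h).symm).trans ?_
  refine Eq.trans ?_ (congrArg (· ≫ _) (eltNat_coconeOf f X.x k X.h))
  exact cell_eltNat (S := val (coconeOf f) X.x) (T := val (coconeOf g) X.x) (modApp m X.x) k X.h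

/-- The morphism between cocones induced by a 2-morphism. -/
def coconeMap (η : f ⟶ g) : coconeOf f ⟶ coconeOf g :=
  unitTrans F G ◁ homFunctorMap₂ η (F.comp (yoneda B))

/-- The components of a 2-morphism out of the pseudo-colimit. -/
def outApp (η : f ⟶ g) {b : B} (X : ColimObj F G b) :
    (outFunctor f b).obj X ⟶ (outFunctor g b).obj X :=
  modApp (X := colimFunctor F G) (Y := D) (s := outTrans f) (t := outTrans g)
    (Bicategory.Opposite.Hom2.unop2 η).hom (a := b) X

lemma coconeCell_coconeMap (η : f ⟶ g) {b : B} (X : ColimObj F G b) :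
    coconeCell (coconeMap η) X = outApp η X := rfl

lemma coconeCell_ext {m n : coconeOf f ⟶ coconeOf g}
    (w : ∀ (b : B) (X : ColimObj F G b), coconeCell m X = coconeCell n X) : m = n :=
  mod_ext fun e x => cell_ext fun b h => w b ⟨e, x, h⟩

/-- Every object of the pseudo-colimit is some `(e, x, h)`, so the induced morphism of cocones has
exactly the same components as the 2-morphism. -/
lemma coconeMap_injective : Function.Injective (coconeMap (f := f) (g := g)) := by
  intro η θ h
  have w (b : B) (X : ColimObj F G b) : outApp η X = outApp θ X := by
    rw [← coconeCell_coconeMap, h, coconeCell_coconeMap]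
  exact Ps.op_ext w

/-- The 2-morphism which induces a given morphism between cocones. -/
def outMk (m : coconeOf f ⟶ coconeOf g) : f ⟶ g :=
  Bicategory.Opposite.Hom2.op2' (InducedBicategory.Hom₂.mk
    (mkMod (X := colimFunctor F G) (Y := D) (s := outTrans f) (t := outTrans g)
      (fun X => coconeCell m X)
      (fun {b} _ _ p => naturality_of_gen (outFunctor f b) (outFunctor g b)
        (fun X => coconeCell m X) (coconeCell_gen m) (coconeCell_glue m) p)
      (fun k X => coconeCell_outNat m k X)))

lemma coconeMap_outMk (m : coconeOf f ⟶ coconeOf g) : coconeMap (outMk m) = m :=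
  coconeCell_ext fun _ _ => rfl

end

/-- On morphisms, conjugation by `i` turns the comparison functor into `coconeMap`, which is
bijective. On objects, a 2-natural cocone is in particular pseudo-natural, hence induced by a
1-morphism up to isomorphism. -/
lemma comparison_isEquivalence {κ : TwoNat G (homYoneda F (colimFunctor F G))}
    (i : κ.obj ≅ unitTrans F G) (D : StrictPseudofunctor B Cat.{u, u}) :
    (comparison κ (op (Ps.of D))).IsEquivalence := by
  have key {f g : op (Ps.of D) ⟶ op (Ps.of (colimFunctor F G))} (η : f ⟶ g) :
      κ.obj ◁ homFunctorMap₂ η (F.comp (yoneda B)) ≫ i.hom ▷ homFunctorMap g (F.comp (yoneda B)) =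
        i.hom ▷ homFunctorMap f (F.comp (yoneda B)) ≫ coconeMap η :=
    whisker_exchange i.hom (homFunctorMap₂ η (F.comp (yoneda B)))
  refine { faithful := ⟨fun {f g η θ} h => ?_⟩, full := ⟨fun {f g} m => ?_⟩,
           essSurj := ⟨fun t => ?_⟩ }
  · apply coconeMap_injective
    refine (cancel_epi (i.hom ▷ homFunctorMap f (F.comp (yoneda B)))).1 ?_
    refine (key η).symm.trans (Eq.trans ?_ (key θ))
    have h' : ((comparison κ (op (Ps.of D))).map η).hom =
        ((comparison κ (op (Ps.of D))).map θ).hom := congrArg _ h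
    exact congrArg (· ≫ _) h'
  -- Transport `m` along `i` to the universal cocone, where the 2-morphism inducing it is explicit.
  · let m' : coconeOf f ⟶ coconeOf g :=
      i.inv ▷ homFunctorMap f (F.comp (yoneda B)) ≫ m.hom ≫
        i.hom ▷ homFunctorMap g (F.comp (yoneda B))
    refine ⟨outMk m', ?_⟩
    ext : 1
    refine (cancel_mono (i.hom ▷ homFunctorMap g (F.comp (yoneda B)))).1 ?_
    refine (key (outMk m')).trans ((congrArg (_ ≫ ·) (coconeMap_outMk m')).trans ?_)
    exact hom_inv_whiskerRight_assoc i _ _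
  · obtain ⟨f, ⟨j⟩⟩ := exists_coconeOf_iso t.obj
    exact ⟨f, ⟨(isTwoNatural _ _).isoMk (whiskerRightIso i _ ≪≫ j)⟩⟩

/-- A weighted homotopy 2-colimit of representables exists when the weight is cofibrant. -/
theorem exists_isHomotopyColimit (F : StrictPseudofunctor E B) (hG : IsCofibrant G) :
    ∃ (P : Ps B) (κ : TwoNat G (homFunctor (op P) (F.comp (yoneda B)))), IsHomotopyColimit κ := by
  -- The universal cocone is only pseudo-natural, whereas a homotopy colimit requires a 2-natural
  -- one; cofibrancy of the weight bridges the gap.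
  obtain ⟨κ, ⟨i⟩⟩ := hG.exists_twoNat_iso (unitTrans F G)
  exact ⟨Ps.of (colimFunctor F G), κ, fun D => comparison_isEquivalence i D.unop⟩

end Colimit

lemma isEquivalence_comp_right_iff {C D E : Type*} [Category* C] [Category* D] [Category* E]
    (F : C ⥤ D) (G : D ⥤ E) [G.IsEquivalence] : (F ⋙ G).IsEquivalence ↔ F.IsEquivalence :=
  ⟨fun _ => Functor.isEquivalence_of_comp_right F G, fun _ => inferInstance⟩

lemma isEquivalence_comp_left_iff {C D E : Type*} [Category* C] [Category* D] [Category* E]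
    (F : C ⥤ D) (G : D ⥤ E) [F.IsEquivalence] : (F ⋙ G).IsEquivalence ↔ G.IsEquivalence :=
  ⟨fun _ => Functor.isEquivalence_of_comp_left F G, fun _ => inferInstance⟩

/-! ### 2-natural transformations in components -/

section TwoNaturalConstructors

variable {E : Type u} [Bicategory.{u, u} E] {X Y : StrictPseudofunctor E Cat.{u, u}}

/-- Constructor for 2-natural transformations between 2-functors to `Cat`. -/
def mkTwoNat (app : ∀ a, X.obj a ⥤ Y.obj a)
    (nat : ∀ {a b : E} (f : a ⟶ b) (x : X.obj a),
      (app b).obj ((X.map f).toFunctor.obj x) ≅ (Y.map f).toFunctor.obj ((app a).obj x))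
    (isId_nat : ∀ {a b : E} (f : a ⟶ b) (x : X.obj a), IsId (nat f x).hom)
    (nat_naturality : ∀ {a b : E} (f : a ⟶ b) {x y : X.obj a} (k : x ⟶ y),
      (app b).map ((X.map f).toFunctor.map k) ≫ (nat f y).hom =
        (nat f x).hom ≫ (Y.map f).toFunctor.map ((app a).map k))
    (nat_map₂ : ∀ {a b : E} {f g : a ⟶ b} (η : f ⟶ g) (x : X.obj a),
      (app b).map (map₂App X η x) ≫ (nat g x).hom =
        (nat f x).hom ≫ map₂App Y η ((app a).obj x)) : TwoNat X Y :=
  ⟨mkTrans app nat nat_naturality nat_map₂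
    -- The unit and composition axioms compare identities with the same ends, so they hold
    -- automatically.
    (fun {a} x => ((isId_nat (𝟙 a) x).comp (isId_mapIdApp Y _)).eq
      ((isId_mapIdApp X x).map (app a)))
    (fun {_ _ c} f g x => ((isId_nat (f ≫ g) x).comp (isId_mapCompApp Y f g _)).eq
      (((isId_mapCompApp X f g x).map (app c)).comp
        ((isId_nat g _).comp ((isId_nat f x).map (Y.map g).toFunctor)))),
    fun _ _ f => isId_cat _ fun x => isId_nat f x⟩

lemma isId_natApp (s : TwoNat X Y) {a b : E} (f : a ⟶ b) (x : X.obj a) :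
    IsId (natApp s.obj f x).hom :=
  (s.property f).app x

/-- Constructor for isomorphisms between 2-natural transformations whose components are
identities. -/
def twoNatIso {s t : TwoNat X Y}
    (m : ∀ {a : E} (x : X.obj a), (s.obj.app a).toFunctor.obj x ≅ (t.obj.app a).toFunctor.obj x)
    (isId_m : ∀ {a : E} (x : X.obj a), IsId (m x).hom)
    (naturality : ∀ {a : E} {x y : X.obj a} (k : x ⟶ y),
      (s.obj.app a).toFunctor.map k ≫ (m y).hom = (m x).hom ≫ (t.obj.app a).toFunctor.map k) :
    s ≅ t :=
  (isTwoNatural X Y).isoMk (mkModIso m naturality fun f x =>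
    ((isId_m _).comp (isId_natApp t f x)).eq
      ((isId_natApp s f x).comp ((isId_m x).map (Y.map f).toFunctor)))

lemma twoNat_hom_ext {s t : TwoNat X Y} {m n : s ⟶ t}
    (h : ∀ (a : E) (x : X.obj a), modApp m.hom x = modApp n.hom x) : m = n := by
  ext : 1
  exact mod_ext h

/-- Constructor for isomorphisms between functors to a category of 2-natural transformations. -/
def twoNatFunctorIso {A : Type*} [Category* A] {K K' : A ⥤ TwoNat X Y}
    (m : ∀ (y : A) {a : E} (x : X.obj a),
      ((K.obj y).obj.app a).toFunctor.obj x ≅ ((K'.obj y).obj.app a).toFunctor.obj x)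
    (isId_m : ∀ (y : A) {a : E} (x : X.obj a), IsId (m y x).hom)
    (naturality : ∀ (y : A) {a : E} {x x' : X.obj a} (k : x ⟶ x'),
      ((K.obj y).obj.app a).toFunctor.map k ≫ (m y x').hom =
        (m y x).hom ≫ ((K'.obj y).obj.app a).toFunctor.map k)
    (naturality' : ∀ {y y' : A} (k : y ⟶ y') {a : E} (x : X.obj a),
      modApp (K.map k).hom x ≫ (m y' x).hom = (m y x).hom ≫ modApp (K'.map k).hom x) : K ≅ K' :=
  NatIso.ofComponents (fun y => twoNatIso (m y) (isId_m y) (naturality y))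
    fun k => twoNat_hom_ext fun _ x => naturality' k x

end TwoNaturalConstructors

/-! ### Homotopy limits in `Cat` and transposed cones -/

section Pointwise

variable {E : Type u} [Bicategory.{u, u} E] [Strict E] {A A' : Cat.{u, u}}
  {Z : StrictPseudofunctor E Cat.{u, u}} {G : StrictPseudofunctor E Cat.{u, u}}

/-- Evaluation at `y`, as a functor `Cat(A, C) ⥤ C`. -/
def evalAt {A : Cat.{u, u}} (C : Cat.{u, u}) (y : A) : (A ⟶ C) ⥤ C where
  obj k := k.toFunctor.obj y
  map m := m.toNatTrans.app y

/-- Evaluation at `y`, as a 2-natural transformation `Cat(A, Z-) ⟶ Z`. -/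
def evTrans (Z : StrictPseudofunctor E Cat.{u, u}) (y : A) : TwoNat (homFunctor A Z) Z :=
  mkTwoNat (fun e => evalAt (Z.obj e) y) (fun _ _ => Iso.refl _) (fun _ _ => IsId.id _)
    (fun _ _ _ _ => (Category.comp_id _).trans (Category.id_comp _).symm)
    (fun _ _ => (Category.comp_id _).trans (Category.id_comp _).symm)

/-- The modification between evaluations induced by a morphism. -/
def evMod (Z : StrictPseudofunctor E Cat.{u, u}) {y y' : A} (k : y ⟶ y') :
    evTrans Z y ⟶ evTrans Z y' :=
  ObjectProperty.homMk (mkMod (fun {e} (x : A ⟶ Z.obj e) => x.toFunctor.map k)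
    (fun m => (m.toNatTrans.naturality k).symm)
    (fun _ _ => (Category.comp_id _).trans (Category.id_comp _).symm))

/-- The functor `A ⥤ [E, Cat](G, Z)` which corresponds to a 2-natural transformation
`G ⟶ Cat(A, Z-)`. -/
def transpose (s : TwoNat G (homFunctor A Z)) : A ⥤ TwoNat G Z where
  obj y := ⟨s.obj ≫ (evTrans Z y).obj, isTwoNatural_comp s.property (evTrans Z y).property⟩
  map k := ObjectProperty.homMk (s.obj ◁ (evMod Z k).hom)
  map_id y := twoNat_hom_ext fun e x => ((s.obj.app e).toFunctor.obj x).toFunctor.map_id y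
  map_comp k l := twoNat_hom_ext fun e x =>
    ((s.obj.app e).toFunctor.obj x).toFunctor.map_comp k l

/-- Transposition of 2-natural transformations, as a functor. -/
def transposeFunctor (A : Cat.{u, u}) (G Z : StrictPseudofunctor E Cat.{u, u}) :
    TwoNat G (homFunctor A Z) ⥤ (A ⥤ TwoNat G Z) where
  obj s := transpose s
  map {s t} m :=
    { app y := ObjectProperty.homMk (m.hom ▷ (evTrans Z y).obj)
      naturality y y' k := twoNat_hom_ext fun e x =>
        (modApp (Y := homFunctor A Z) m.hom x).toNatTrans.naturality k }
  map_id s := by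
    ext y : 2
    exact twoNat_hom_ext fun e x => rfl
  map_comp m n := by
    ext y : 2
    exact twoNat_hom_ext fun e x => rfl

lemma natApp_comp_evTrans (s : TwoNat G (homFunctor A Z)) (y : A) {a b : E} (f : a ⟶ b)
    (x : G.obj a) : (natApp (s.obj ≫ (evTrans Z y).obj) f x).hom =
      (natApp (Y := homFunctor A Z) s.obj f x).hom.toNatTrans.app y :=
  (natApp_comp_trans s.obj (evTrans Z y).obj f x).trans (Category.comp_id _)

instance : (transposeFunctor A G Z).Faithful where
  map_injective {s t m n} h := twoNat_hom_ext fun e x => by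
    refine Cat.Hom₂.ext (NatTrans.ext (funext fun y => ?_))
    exact congrArg (fun k : transpose s ⟶ transpose t => modApp (k.app y).hom x) h

/-- For each object of the weight, the components at all `y` assemble into a natural transformation
because `α` is natural in `y`; the modification axioms are checked separately at each `y`. -/
instance : (transposeFunctor A G Z).Full where
  map_surjective {s t} α := by
    let c {e : E} (x : G.obj e) :
        (s.obj.app e).toFunctor.obj x ⟶ (t.obj.app e).toFunctor.obj x :=
      NatTrans.toCatHom₂ (F := ((s.obj.app e).toFunctor.obj x).toFunctor)
        (G := ((t.obj.app e).toFunctor.obj x).toFunctor)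
        { app y := modApp (α.app y).hom x
          naturality y y' k := congrArg
            (fun m : (transpose s).obj y ⟶ (transpose t).obj y' => modApp m.hom x)
            (α.naturality k) }
    refine ⟨ObjectProperty.homMk (mkMod c (fun {e x x'} k => ?_) fun {a b} f x => ?_), ?_⟩
    · refine Cat.Hom₂.ext (NatTrans.ext (funext fun y => ?_))
      exact modApp_naturality (α.app y).hom k
    · refine Cat.Hom₂.ext (NatTrans.ext (funext fun y => ?_))
      refine (congrArg (_ ≫ ·) (natApp_comp_evTrans t y f x).symm).trans ?_
      exact (modApp_natApp (α.app y).hom f x).trans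
        (congrArg (· ≫ _) (natApp_comp_evTrans s y f x))
    · ext y : 2
      exact twoNat_hom_ext fun e x => rfl

/-- Functors between small categories, as morphisms of `Cat`. -/
def homToFunctor (A A' : Cat.{u, u}) : (A' ⟶ A) ⥤ (A' ⥤ A) where
  obj f := f.toFunctor
  map η := η.toNatTrans

instance : (homToFunctor A A').IsEquivalence where
  faithful := ⟨fun h => Cat.Hom₂.ext h⟩
  full := ⟨fun η => ⟨η.toCatHom₂, rfl⟩⟩
  essSurj := ⟨fun f => ⟨f.toCatHom, ⟨Iso.refl _⟩⟩⟩

/-- The transpose of `comparison s A'` is composition with the transpose of `s`. -/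
def comparisonTransposeIso (s : TwoNat G (homFunctor A Z)) (A' : Cat.{u, u}) :
    comparison s A' ⋙ transposeFunctor A' G Z ≅
      homToFunctor A A' ⋙ (Functor.whiskeringRight A' A _).obj (transpose s) :=
  NatIso.ofComponents
    (fun f => twoNatFunctorIso
      (fun y e x => Iso.refl (((s.obj.app e).toFunctor.obj x).toFunctor.obj (f.toFunctor.obj y)))
      (fun y e x => IsId.id (((s.obj.app e).toFunctor.obj x).toFunctor.obj (f.toFunctor.obj y)))
      (fun y e _ _ k => (Category.comp_id (((s.obj.app e).toFunctor.map k).toNatTrans.app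
        (f.toFunctor.obj y))).trans (Category.id_comp (((s.obj.app e).toFunctor.map
        k).toNatTrans.app (f.toFunctor.obj y))).symm)
      (fun k e x => (Category.comp_id (((s.obj.app e).toFunctor.obj x).toFunctor.map
        (f.toFunctor.map k))).trans (Category.id_comp (((s.obj.app e).toFunctor.obj
        x).toFunctor.map (f.toFunctor.map k))).symm))
    (fun η => by
      ext y : 2
      exact twoNat_hom_ext fun e x =>
        (Category.comp_id (((s.obj.app e).toFunctor.obj x).toFunctor.map
        (η.toNatTrans.app y))).trans (Category.id_comp (((s.obj.app e).toFunctor.obj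
        x).toFunctor.map (η.toNatTrans.app y))).symm)

/-- The transpose of `s` is determined by the comparison functor of `s` at the terminal category. -/
def comparisonEvIso (s : TwoNat G (homFunctor A Z)) {A' : Cat.{u, u}} (y : A') :
    comparison s A' ⋙ postcompTwoNat G (evTrans Z y) ≅ evalAt A y ⋙ transpose s :=
  twoNatFunctorIso
    (fun f e x => Iso.refl (((s.obj.app e).toFunctor.obj x).toFunctor.obj (f.toFunctor.obj y)))
    (fun f e x => IsId.id (((s.obj.app e).toFunctor.obj x).toFunctor.obj (f.toFunctor.obj y)))
    (fun f e _ _ k => (Category.comp_id (((s.obj.app e).toFunctor.map k).toNatTrans.app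
      (f.toFunctor.obj y))).trans (Category.id_comp (((s.obj.app e).toFunctor.map k).toNatTrans.app
      (f.toFunctor.obj y))).symm)
    (fun η e x => (Category.comp_id (((s.obj.app e).toFunctor.obj x).toFunctor.map
      (η.toNatTrans.app y))).trans (Category.id_comp (((s.obj.app e).toFunctor.obj x).toFunctor.map
      (η.toNatTrans.app y))).symm)

lemma evalAt_isEquivalence (C : Cat.{u, u}) :
    (evalAt (A := Cat.of (Discrete PUnit.{u + 1})) C ⟨⟨⟩⟩).IsEquivalence :=
  let H : (Cat.of (Discrete PUnit.{u + 1}) ⟶ C) ⥤ (Discrete PUnit.{u + 1} ⥤ C) :=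
    homToFunctor C (Cat.of (Discrete PUnit.{u + 1}))
  have : H.IsEquivalence :=
    inferInstanceAs (homToFunctor C (Cat.of (Discrete PUnit.{u + 1}))).IsEquivalence
  Functor.isEquivalence_trans H Functor.equiv.functor

/-- Up to transposition the comparison functor is composition with `transpose s`, an equivalence.
That composite is essentially surjective, hence so is the fully faithful `transposeFunctor`, and two
out of three applies. No cofibrancy is needed in this direction. -/
lemma isHomotopyLimit_of_transpose (s : TwoNat G (homFunctor A Z))
    (hs : (transpose s).IsEquivalence) : IsHomotopyLimit s := by
  intro A'
  have h₁ : (comparison s A' ⋙ transposeFunctor A' G Z).IsEquivalence :=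
    Functor.isEquivalence_of_iso (comparisonTransposeIso s A').symm
  have h₂ : (transposeFunctor A' G Z).EssSurj :=
    ⟨fun t => ⟨_, ⟨(comparison s A' ⋙ transposeFunctor A' G Z).objObjPreimageIso t⟩⟩⟩
  have h₃ : (transposeFunctor A' G Z).IsEquivalence := {}
  exact Functor.isEquivalence_of_comp_right _ (transposeFunctor A' G Z)

/-- A cone in `Cat` with cofibrant weight is a homotopy 2-limit if and only if the functor from its
vertex to the category of 2-natural transformations is an equivalence. -/
theorem isHomotopyLimit_iff_transpose (hG : IsCofibrant G) (s : TwoNat G (homFunctor A Z)) :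
    IsHomotopyLimit s ↔ (transpose s).IsEquivalence := by
  refine ⟨fun h => ?_, isHomotopyLimit_of_transpose s⟩
  -- Test at the terminal category. Evaluation at its object is a pointwise equivalence `Cat(1, Z-)
  -- ⟶ Z`, and it remains an equivalence on 2-natural transformations out of the cofibrant `G`.
  let A' : Cat.{u, u} := Cat.of (Discrete PUnit.{u + 1})
  have h₁ : (comparison s A').IsEquivalence := h A'
  have h₂ : (postcompTwoNat G (evTrans Z (A := A') ⟨⟨⟩⟩)).IsEquivalence :=
    hG.postcompTwoNat_isEquivalence _ fun e => evalAt_isEquivalence (Z.obj e)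
  have h₃ : (evalAt (A := A') A ⟨⟨⟩⟩).IsEquivalence := evalAt_isEquivalence A
  have h₄ : (evalAt (A := A') A ⟨⟨⟩⟩ ⋙ transpose s).IsEquivalence :=
    Functor.isEquivalence_of_iso (comparisonEvIso s (A' := A') ⟨⟨⟩⟩)
  exact Functor.isEquivalence_of_comp_left (evalAt (A := A') A ⟨⟨⟩⟩) _

end Pointwise

/-! ### Cotensors `Cat(D, M-)` -/

section Cotensor

variable {E : Type u} [Bicategory.{u, u} E] [Strict E] {B : Type u} [Bicategory.{u, u} B]
  [Strict B] (F : StrictPseudofunctor E B) {G : StrictPseudofunctor E Cat.{u, u}} {L : B}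
  (γ : TwoNat G (homFunctor L F)) (M : StrictPseudofunctor B Cat.{u, u}) (D : Cat.{u, u})

/-- The identity, as a 2-natural transformation between the two ways to compose `F`, `M` and
`Cat(D, -)`. -/
def cotensorTrans : TwoNat (F.comp (homFunctor D M)) (homFunctor D (F.comp M)) :=
  mkTwoNat (fun e => 𝟭 (D ⟶ M.obj (F.obj e))) (fun _ _ => Iso.refl _) (fun _ _ => IsId.id _)
    (fun _ _ _ _ => (Category.comp_id _).trans (Category.id_comp _).symm)
    (fun _ _ => (Category.comp_id _).trans (Category.id_comp _).symm)

variable {F}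

/-- The transpose of the image of a cone under `Cat(D, M-)` is the comparison functor at `D` of its
image under `M`. -/
def transposeCotensorIso :
    transpose (mapCone (homFunctor D M) γ) ⋙ postcompTwoNat G (cotensorTrans F M D) ≅
      comparison (mapCone M γ) D :=
  twoNatFunctorIso
    (fun (f : D ⟶ M.obj L) e x => Iso.refl (f ≫ M.map ((γ.obj.app e).toFunctor.obj x)))
    (fun f e x => IsId.id (f ≫ M.map ((γ.obj.app e).toFunctor.obj x)))
    (fun f e _ _ k => (Category.comp_id (f ◁ M.map₂ ((γ.obj.app e).toFunctor.map k))).trans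
      (Category.id_comp (f ◁ M.map₂ ((γ.obj.app e).toFunctor.map k))).symm)
    (fun η e x => (Category.comp_id (η ▷ M.map ((γ.obj.app e).toFunctor.obj x))).trans
      (Category.id_comp (η ▷ M.map ((γ.obj.app e).toFunctor.obj x))).symm)

/-- Composition with `cotensorTrans`, whose components are identity functors, is an equivalence and
carries one functor to the other. The homotopy limit condition for `M` at the single category `D` is
thereby a condition on `Cat(D, M-)`. -/
theorem transpose_cotensor_isEquivalence_iff (hG : IsCofibrant G) :
    (transpose (mapCone (homFunctor D M) γ)).IsEquivalence ↔
      (comparison (mapCone M γ) D).IsEquivalence := by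
  have h : (postcompTwoNat G (cotensorTrans F M D)).IsEquivalence :=
    hG.postcompTwoNat_isEquivalence _ fun e =>
      inferInstanceAs (𝟭 (D ⟶ M.obj (F.obj e))).IsEquivalence
  exact (isEquivalence_comp_right_iff _ _).symm.trans
    (Functor.isEquivalence_iff_of_iso (transposeCotensorIso γ M D))

end Cotensor

/-! ### The Yoneda lemma for pseudo-natural transformations -/

section YonedaLemma

section Elements

variable {B : Type u} [Bicategory.{u, u} B] [Strict B] {X : StrictPseudofunctor B Cat.{u, u}}
  {a b c d : B}

/-- The value of `T : B(a, -) ⟶ X` at a 1-cell. -/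
def repObj (T : (homYoneda (StrictPseudofunctor.id B) X).obj a) (h : a ⟶ b) : X.obj b :=
  elt (F := StrictPseudofunctor.id B) (e := a) T h

/-- The value of `T : B(a, -) ⟶ X` at a 2-cell. -/
def repMap (T : (homYoneda (StrictPseudofunctor.id B) X).obj a) {h k : a ⟶ b} (β : h ⟶ k) :
    repObj T h ⟶ repObj T k :=
  eltMap (F := StrictPseudofunctor.id B) (e := a) T β

/-- The naturality constraint of `T : B(a, -) ⟶ X`. -/
def repNat (T : (homYoneda (StrictPseudofunctor.id B) X).obj a) (k : b ⟶ c) (h : a ⟶ b) :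
    repObj T (h ≫ k) ≅ (X.map k).toFunctor.obj (repObj T h) :=
  eltNat (F := StrictPseudofunctor.id B) (e := a) T k h

/-- The components of a modification between `S, T : B(a, -) ⟶ X`. -/
def repCell {S T : (homYoneda (StrictPseudofunctor.id B) X).obj a} (m : S ⟶ T) (h : a ⟶ b) :
    repObj S h ⟶ repObj T h :=
  cell (F := StrictPseudofunctor.id B) (e := a) m h

lemma repMap_comp (T : (homYoneda (StrictPseudofunctor.id B) X).obj a) {h k l : a ⟶ b}
    (β : h ⟶ k) (θ : k ⟶ l) : repMap T (β ≫ θ) = repMap T β ≫ repMap T θ :=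
  eltMap_comp (F := StrictPseudofunctor.id B) (e := a) T β θ

lemma repNat_naturality (T : (homYoneda (StrictPseudofunctor.id B) X).obj a) (k : b ⟶ c)
    {h l : a ⟶ b} (β : h ⟶ l) : repMap T (β ▷ k) ≫ (repNat T k l).hom =
      (repNat T k h).hom ≫ (X.map k).toFunctor.map (repMap T β) :=
  eltNat_naturality (F := StrictPseudofunctor.id B) (e := a) T k β

lemma repNat_map₂ (T : (homYoneda (StrictPseudofunctor.id B) X).obj a) {k l : b ⟶ c} (θ : k ⟶ l)
    (h : a ⟶ b) : repMap T (h ◁ θ) ≫ (repNat T l h).hom =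
      (repNat T k h).hom ≫ map₂App X θ (repObj T h) :=
  eltNat_map₂ (F := StrictPseudofunctor.id B) (e := a) T θ h

lemma repNat_comp (T : (homYoneda (StrictPseudofunctor.id B) X).obj a) (k : b ⟶ c) (l : c ⟶ d)
    (h : a ⟶ b) : (repNat T (k ≫ l) h).hom ≫ (mapCompApp X k l (repObj T h)).hom =
      repMap T (α_ h k l).inv ≫ (repNat T l (h ≫ k)).hom ≫
        (X.map l).toFunctor.map (repNat T k h).hom :=
  eltNat_comp (F := StrictPseudofunctor.id B) (e := a) T k l h

/-- The components of the isomorphism between `T` and the object which corresponds to `T 1`. -/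
def repIso (T : (homYoneda (StrictPseudofunctor.id B) X).obj a) (h : a ⟶ b) :
    (X.map h).toFunctor.obj (repObj T (𝟙 a)) ≅ repObj T h :=
  (repNat T h (𝟙 a)).symm ≪≫ ((toTrans T).app b).toFunctor.mapIso (λ_ h)

lemma repNat_repIso (T : (homYoneda (StrictPseudofunctor.id B) X).obj a) (h : a ⟶ b) :
    (repNat T h (𝟙 a)).hom ≫ (repIso T h).hom = repMap T (λ_ h).hom :=
  Iso.hom_inv_id_assoc _ _

/-- After cancelling the invertible constraint of `T` at the identity 1-cell, both sides are values
of `T` on 2-cells, which agree by naturality of the left unitor. -/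
lemma repIso_naturality (T : (homYoneda (StrictPseudofunctor.id B) X).obj a) {h k : a ⟶ b}
    (β : h ⟶ k) : map₂App X β (repObj T (𝟙 a)) ≫ (repIso T k).hom =
      (repIso T h).hom ≫ repMap T β := by
  rw [← cancel_epi (repNat T h (𝟙 a)).hom, ← reassoc_of% (@repNat_map₂), repNat_repIso,
    reassoc_of% (@repNat_repIso), ← repMap_comp, ← repMap_comp, leftUnitor_naturality]

lemma repIso_repNat (T : (homYoneda (StrictPseudofunctor.id B) X).obj a) (k : b ⟶ c)
    (h : a ⟶ b) : (repIso T (h ≫ k)).hom ≫ (repNat T k h).hom =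
      (mapCompApp X h k (repObj T (𝟙 a))).hom ≫ (X.map k).toFunctor.map (repIso T h).hom := by
  rw [← cancel_epi (repNat T (h ≫ k) (𝟙 a)).hom, reassoc_of% (@repNat_repIso),
    reassoc_of% (@repNat_comp), ← Functor.map_comp, repNat_repIso, ← repNat_naturality,
    ← reassoc_of% (@repMap_comp), leftUnitor_comp]

end Elements

variable {B : Type u} [Bicategory.{u, u} B] [Strict B] (X : StrictPseudofunctor B Cat.{u, u})
  {a b c : B}

lemma isId_map₂App {f g : a ⟶ b} {η : f ⟶ g} (hη : IsId η) (y : X.obj a) :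
    IsId (map₂App X η y) := by
  obtain ⟨rfl, rfl⟩ := hη
  exact ⟨rfl, map₂App_id X _ y⟩

/-- The functor `h ↦ X h y`. -/
def repFunctor (y : X.obj a) (b : B) : (a ⟶ b) ⥤ X.obj b where
  obj h := (X.map h).toFunctor.obj y
  map β := map₂App X β y
  map_id h := map₂App_id X h y
  map_comp β θ := map₂App_comp X β θ y

/-- The object of `Ps(B, Cat)(B(a, -), X)` which corresponds to an object of `X a`. -/
def repElt (y : X.obj a) : (homYoneda (StrictPseudofunctor.id B) X).obj a :=
  eltMk (F := StrictPseudofunctor.id B) (repFunctor X y)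
    (fun {b c} (k : b ⟶ c) (h : a ⟶ b) => mapCompApp X h k y)
    (fun {b c} (k : b ⟶ c) {h l : a ⟶ b} (β : h ⟶ l) => map₂App_whiskerRight X β k y)
    (fun {b c} {k l : b ⟶ c} (θ : k ⟶ l) (h : a ⟶ b) => map₂App_whiskerLeft X h θ y)
    (fun {b} (h : a ⟶ b) => ((isId_mapCompApp X h (𝟙 b) y).comp (isId_mapIdApp X _)).eq
      (isId_map₂App X (IsId.rightUnitor h) y))
    (fun {b c d} (k : b ⟶ c) (l : c ⟶ d) (h : a ⟶ b) =>
      ((isId_mapCompApp X h (k ≫ l) y).comp (isId_mapCompApp X k l _)).eq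
        ((isId_map₂App X (IsId.associator h k l).inv y).comp
          ((isId_mapCompApp X (h ≫ k) l y).comp
            ((isId_mapCompApp X h k y).map (X.map l).toFunctor))))

/-- The morphism of `Ps(B, Cat)(B(a, -), X)` which corresponds to a morphism of `X a`. -/
def repHom {y z : X.obj a} (s : y ⟶ z) : repElt X y ⟶ repElt X z :=
  cellMk (F := StrictPseudofunctor.id B) (fun {b} (h : a ⟶ b) => (X.map h).toFunctor.map s)
    (fun {b} {h k : a ⟶ b} (β : h ⟶ k) => (map₂App_naturality X β s).symm)
    (fun {b c} (k : b ⟶ c) (h : a ⟶ b) => mapCompApp_naturality X h k s)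

/-- The functor `X a ⥤ Ps(B, Cat)(B(a, -), X)`. -/
def rep (a : B) : X.obj a ⥤ (homYoneda (StrictPseudofunctor.id B) X).obj a where
  obj y := repElt X y
  map s := repHom X s
  map_id y := cell_ext fun _ (h : a ⟶ _) => (X.map h).toFunctor.map_id y
  map_comp s t := cell_ext fun _ (h : a ⟶ _) => (X.map h).toFunctor.map_comp s t

/-- This is the core of fullness. Take `p`, `q`, `r` to be the components of a modification at `h`,
at the identity and at `𝟙 a ≫ h`. The modification axiom `h₁` and naturality `h₂` along the left
unitor show that `q` determines `p`. -/
lemma eq_map_of_natural {y z : X.obj a} (h : a ⟶ b)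
    {p : (X.map h).toFunctor.obj y ⟶ (X.map h).toFunctor.obj z}
    {q : (X.map (𝟙 a)).toFunctor.obj y ⟶ (X.map (𝟙 a)).toFunctor.obj z}
    {r : (X.map (𝟙 a ≫ h)).toFunctor.obj y ⟶ (X.map (𝟙 a ≫ h)).toFunctor.obj z}
    (h₁ : r ≫ (mapCompApp X (𝟙 a) h z).hom =
      (mapCompApp X (𝟙 a) h y).hom ≫ (X.map h).toFunctor.map q)
    (h₂ : map₂App X (λ_ h).hom y ≫ p = r ≫ map₂App X (λ_ h).hom z) :
    p = (X.map h).toFunctor.map ((mapIdApp X y).inv ≫ q ≫ (mapIdApp X z).hom) := by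
  have h₃ (w : X.obj a) : map₂App X (λ_ h).hom w =
      (mapCompApp X (𝟙 a) h w).hom ≫ (X.map h).toFunctor.map (mapIdApp X w).hom :=
    (isId_map₂App X (IsId.leftUnitor h) w).eq
      ((isId_mapCompApp X (𝟙 a) h w).comp ((isId_mapIdApp X w).map (X.map h).toFunctor))
  rw [h₃, h₃, ← Category.assoc r, h₁, Category.assoc, Category.assoc, cancel_epi] at h₂
  rw [Functor.map_comp, Functor.map_comp, ← h₂, ← Functor.map_comp_assoc, Iso.inv_hom_id,
    CategoryTheory.Functor.map_id, Category.id_comp]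

instance : (rep X a).Faithful where
  map_injective {y z s t} h := by
    have h' : (X.map (𝟙 a)).toFunctor.map s = (X.map (𝟙 a)).toFunctor.map t :=
      congrArg (fun m : repElt X y ⟶ repElt X z => repCell m (𝟙 a)) h
    rw [← cancel_epi (mapIdApp X y).hom, ← mapIdApp_naturality, h', mapIdApp_naturality]

instance : (rep X a).Full where
  map_surjective {y z} m :=
    ⟨(mapIdApp X y).inv ≫ repCell (S := repElt X y) (T := repElt X z) m (𝟙 a) ≫
      (mapIdApp X z).hom, cell_ext fun _ (h : a ⟶ _) => (eq_map_of_natural X h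
        (cell_eltNat (F := StrictPseudofunctor.id B) (e := a) m h (𝟙 a))
        (cell_naturality (F := StrictPseudofunctor.id B) (e := a) m (λ_ h).hom)).symm⟩

instance : (rep X a).EssSurj where
  mem_essImage T :=
    ⟨repObj T (𝟙 a), ⟨cellMkIso
      (F := StrictPseudofunctor.id B) (S := repElt X _) (T := T)
      (fun {b} (h : a ⟶ b) => repIso T h)
      (fun {b} {h k : a ⟶ b} (β : h ⟶ k) => repIso_naturality T β)
      (fun {b c} (k : b ⟶ c) (h : a ⟶ b) => repIso_repNat T k h)⟩⟩

instance : (rep X a).IsEquivalence where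

variable {X} in
lemma isId_of_repCell {S T : (homYoneda (StrictPseudofunctor.id B) X).obj a} (m : S ⟶ T)
    (h : ∀ (b : B) (h : a ⟶ b), IsId (repCell m h)) : IsId m := by
  have h₁ : IsId (toMod (F := StrictPseudofunctor.id B) (e := a) m) :=
    isId_modification _ fun b => isId_cat _ fun k => h b k
  obtain ⟨e, he⟩ := h₁
  obtain rfl : S = T := congrArg (ofTrans (F := StrictPseudofunctor.id B)) e
  exact ⟨rfl, congrArg (ofMod (F := StrictPseudofunctor.id B)) he⟩

lemma mapCompApp_inv_map₂ (f : a ⟶ b) {h k : b ⟶ c} (β : h ⟶ k) (y : X.obj a) :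
    map₂App X β ((X.map f).toFunctor.obj y) ≫ (mapCompApp X f k y).inv =
      (mapCompApp X f h y).inv ≫ map₂App X (f ◁ β) y := by
  rw [Iso.comp_inv_eq, Category.assoc, map₂App_whiskerLeft, Iso.inv_hom_id_assoc]

/-- The naturality constraint of the Yoneda equivalence. -/
def repGlue (f : a ⟶ b) (y : X.obj a) : repElt X ((X.map f).toFunctor.obj y) ≅
    ((homYoneda (StrictPseudofunctor.id B) X).map f).toFunctor.obj (repElt X y) :=
  cellMkIso (F := StrictPseudofunctor.id B) (e := b)
    (fun {_} (h : b ⟶ _) => (mapCompApp X f h y).symm)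
    (fun {_} {h k : b ⟶ _} (β : h ⟶ k) => mapCompApp_inv_map₂ X f β y)
    (fun {c d} (k : c ⟶ d) (h : b ⟶ c) => by
      refine (congrArg (_ ≫ ·) (eltNat_map (F := StrictPseudofunctor.id B) f (repElt X y) k
        h)).trans ?_
      exact ((isId_mapCompApp X f (h ≫ k) y).inv.comp
        ((isId_map₂App X (IsId.associator f h k).inv y).comp
          (isId_mapCompApp X (f ≫ h) k y))).eq
        ((isId_mapCompApp X h k _).comp
          ((isId_mapCompApp X f h y).inv.map (X.map k).toFunctor)))

/-- The components are inverse composition constraints of a strict 2-functor. Hence the Yoneda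
equivalence is 2-natural, and composition with it preserves 2-natural transformations. -/
lemma isId_repGlue (f : a ⟶ b) (y : X.obj a) : IsId (repGlue X f y).hom :=
  isId_of_repCell _ fun _ (h : b ⟶ _) => (isId_mapCompApp X f h y).inv

lemma repGlue_naturality (f : a ⟶ b) {y z : X.obj a} (s : y ⟶ z) :
    repHom X ((X.map f).toFunctor.map s) ≫ (repGlue X f z).hom = (repGlue X f y).hom ≫
      ((homYoneda (StrictPseudofunctor.id B) X).map f).toFunctor.map (repHom X s) := by
  refine cell_ext fun _ (h : b ⟶ _) => ?_
  have : (X.map h).toFunctor.map ((X.map f).toFunctor.map s) ≫ (mapCompApp X f h z).inv =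
      (mapCompApp X f h y).inv ≫ (X.map (f ≫ h)).toFunctor.map s := by
    rw [Iso.comp_inv_eq, Category.assoc, mapCompApp_naturality, Iso.inv_hom_id_assoc]
  exact this

lemma repGlue_map₂ {f g : a ⟶ b} (η : f ⟶ g) (y : X.obj a) :
    repHom X (map₂App X η y) ≫ (repGlue X g y).hom = (repGlue X f y).hom ≫
      map₂App (homYoneda (StrictPseudofunctor.id B) X) η (repElt X y) := by
  refine cell_ext fun _ (h : b ⟶ _) => ?_
  have : (X.map h).toFunctor.map (map₂App X η y) ≫ (mapCompApp X g h y).inv =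
      (mapCompApp X f h y).inv ≫ map₂App X (η ▷ h) y := by
    rw [Iso.comp_inv_eq, Category.assoc, map₂App_whiskerRight, Iso.inv_hom_id_assoc]
  exact this

end YonedaLemma

/-! ### Comparison functors under change of cone, and orthogonality -/

section Comparison

variable {E : Type u} [Bicategory.{u, u} E] [Strict E]
  {C : Type v} [Bicategory.{u, u} C] [Strict C] {G : StrictPseudofunctor E Cat.{u, u}}
  {F : StrictPseudofunctor E C} {L L' : C}

/-- The comparison functor of the cone obtained by precomposition with `f`. -/
def postcompComparisonIso (γ : TwoNat G (homFunctor L F)) (f : L' ⟶ L) (D : C) :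
    postcomp D f ⋙ comparison γ D ≅ comparison ((comparison γ L').obj f) D :=
  twoNatFunctorIso
    (fun g e x => α_ g f ((γ.obj.app e).toFunctor.obj x))
    (fun g e x => IsId.associator g f ((γ.obj.app e).toFunctor.obj x))
    (fun g e _ _ k => associator_naturality_right g f ((γ.obj.app e).toFunctor.map k))
    (fun η e x => associator_naturality_left η f ((γ.obj.app e).toFunctor.obj x))

/-- Isomorphic cones have isomorphic comparison functors. -/
def comparisonIso {γ γ' : TwoNat G (homFunctor L F)} (i : γ ≅ γ') (D : C) :
    comparison γ D ≅ comparison γ' D :=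
  NatIso.ofComponents
    (fun f => (isTwoNatural _ _).isoMk
      (whiskerRightIso ((isTwoNatural _ _).ι.mapIso i) (homFunctorMap f F)))
    (fun η => by
      ext : 1
      exact whisker_exchange i.hom.hom (homFunctorMap₂ η F))

end Comparison

section Orthogonality

variable {C : Type v} [Bicategory.{u, u} C]

instance (a b : C) : (opFunctor a b).IsEquivalence where
  faithful := ⟨fun h => congrArg Bicategory.Opposite.Hom2.unop2 h⟩
  full := ⟨fun η => ⟨η.unop2, rfl⟩⟩
  essSurj := ⟨fun f => ⟨f.unop, ⟨Iso.refl _⟩⟩⟩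

/-- Comparison functors for colimits are formed in the opposite 2-category. It reverses 1-cells but
not 2-cells, so its hom-categories are covariantly equivalent to the original ones. -/
lemma isHomotopyOrthogonal_iff_postcomp {A A' : C} (f : A ⟶ A') (X : C) :
    IsHomotopyOrthogonal f X ↔ (postcomp (op X) f.op).IsEquivalence := by
  have i : precomp X f ⋙ opFunctor A X ≅ opFunctor A' X ⋙ postcomp (op X) f.op :=
    NatIso.ofComponents (fun _ => Iso.refl _)
      (fun _ => (Category.comp_id _).trans (Category.id_comp _).symm)
  exact (isEquivalence_comp_right_iff (precomp X f) (opFunctor A X)).symm.trans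
    ((Functor.isEquivalence_iff_of_iso i).trans (isEquivalence_comp_left_iff _ _))

end Orthogonality

/-! ### The 1-morphisms `ρ` and homotopy models -/

section Rho

variable {E : Type u} [Bicategory.{u, u} E] [Strict E] {B : Type u} [Bicategory.{u, u} B]
  [Strict B] {F : StrictPseudofunctor E B} {G : StrictPseudofunctor E Cat.{u, u}} {L : B}

/-- The Yoneda equivalence, as a 2-natural transformation `X F- ⟶ Ps(B, Cat)(B(F-, -), X)`. -/
def repTrans (F : StrictPseudofunctor E B) (X : StrictPseudofunctor B Cat.{u, u}) :
    TwoNat (F.comp X) (homYoneda F X) :=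
  mkTwoNat (fun e => rep X (F.obj e)) (fun f y => repGlue X (F.map f) y)
    (fun f y => isId_repGlue X (F.map f) y) (fun f _ _ s => repGlue_naturality X (F.map f) s)
    (fun η y => repGlue_map₂ X (F.map₂ η) y)

/-- Under the Yoneda equivalence, the transpose of the image of a cone under `X` is the comparison
functor at `X` of its image under the Yoneda embedding. -/
def transposeRepIso (γ : TwoNat G (homFunctor L F)) (X : StrictPseudofunctor B Cat.{u, u}) :
    transpose (mapCone X γ) ⋙ postcompTwoNat G (repTrans F X) ≅
      rep X L ⋙ comparison (mapCone (yoneda B) γ) (op (Ps.of X)) :=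
  twoNatFunctorIso
    (fun y e x => repGlue X ((γ.obj.app e).toFunctor.obj x) y)
    (fun y e x => isId_repGlue X ((γ.obj.app e).toFunctor.obj x) y)
    (fun y e _ _ k => repGlue_map₂ X ((γ.obj.app e).toFunctor.map k) y)
    (fun s e x => repGlue_naturality X ((γ.obj.app e).toFunctor.obj x) s)

/-- The two functors are opposite sides of a square that commutes up to isomorphism. Its other sides
are the Yoneda equivalence at `L` and composition with the pointwise equivalence `repTrans`, an
equivalence because `G` is cofibrant. -/
theorem comparison_yoneda_isEquivalence_iff (hG : IsCofibrant G) (γ : TwoNat G (homFunctor L F))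
    (X : StrictPseudofunctor B Cat.{u, u}) :
    (comparison (mapCone (yoneda B) γ) (op (Ps.of X))).IsEquivalence ↔
      (transpose (mapCone X γ)).IsEquivalence := by
  have h : (postcompTwoNat G (repTrans F X)).IsEquivalence :=
    hG.postcompTwoNat_isEquivalence _ fun e => inferInstanceAs (rep X (F.obj e)).IsEquivalence
  refine Iff.trans ?_ (isEquivalence_comp_right_iff (transpose (mapCone X γ))
    (postcompTwoNat G (repTrans F X)))
  exact ((Functor.isEquivalence_iff_of_iso (transposeRepIso γ X)).trans
    (isEquivalence_comp_left_iff (rep X L) _)).symm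

/-- A 2-functor is homotopy orthogonal to the 1-morphism built from a cone if and only if it sends
the cone to a homotopy 2-limit. -/
theorem Cone.IsRho.isHomotopyOrthogonal_iff {c : Cone B} (hG : IsCofibrant c.G) {P : Ps B}
    {ρ : P ⟶ ((yoneda B).obj c.L).unop} (hρ : c.IsRho ρ) (X : StrictPseudofunctor B Cat.{u, u}) :
    IsHomotopyOrthogonal ρ (Ps.of X) ↔ (transpose (mapCone X c.γ)).IsEquivalence := by
  obtain ⟨κ, hκ, ⟨i⟩⟩ := hρ
  have : (comparison κ (op (Ps.of X))).IsEquivalence := hκ _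
  refine (isHomotopyOrthogonal_iff_postcomp ρ (Ps.of X)).trans
    ((isEquivalence_comp_right_iff _ (comparison κ (op (Ps.of X)))).symm.trans ?_)
  -- Composition with `ρ` followed by the comparison functor of `κ` is the comparison functor of the
  -- cone that `ρ` induces, and this cone is isomorphic to `Y(γ)`.
  refine (Functor.isEquivalence_iff_of_iso (postcompComparisonIso κ ρ.op _ ≪≫
    comparisonIso i _)).trans ?_
  exact comparison_yoneda_isEquivalence_iff hG c.γ X

/-- The comparison functor of the colimit cocone at `Y(L)` is essentially surjective, so `Y(γ)` has
a preimage up to isomorphism. -/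
theorem Cone.exists_isRho (c : Cone B) (hG : IsCofibrant c.G) :
    ∃ (P : Ps B) (ρ : P ⟶ ((yoneda B).obj c.L).unop), c.IsRho ρ := by
  obtain ⟨P, κ, hκ⟩ := exists_isHomotopyColimit c.F hG
  have : (comparison κ ((yoneda B).obj c.L)).IsEquivalence := hκ _
  exact ⟨P, ((comparison κ ((yoneda B).obj c.L)).objPreimage (mapCone (yoneda B) c.γ)).unop, κ, hκ,
    ⟨(comparison κ ((yoneda B).obj c.L)).objObjPreimageIso (mapCone (yoneda B) c.γ)⟩⟩

end Rho

end HSketch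

/-! ### Homotopy models as homotopy orthogonal objects -/

theorem lemma5p4 {B : Type u} [Bicategory.{u, u} B] [Bicategory.Strict B]
    (S : HSketch.HomotopyLimitSketch B) :
    HSketch.IsHomotopyOrthogonalSubcategory S.hModPs ∧
    (∀ i, ∃ (P : HSketch.Ps B) (ρ : P ⟶ ((HSketch.yoneda B).obj (S.cone i).L).unop),
      (S.cone i).IsRho ρ) ∧
    ∀ (P : S.ι → HSketch.Ps B)
      (ρ : ∀ i, P i ⟶ ((HSketch.yoneda B).obj (S.cone i).L).unop),
      (∀ i, (S.cone i).IsRho (ρ i)) →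
      ∀ M : StrictPseudofunctor B Cat.{u, u},
        (S.IsHomotopyModel M ↔
          ∀ i, HSketch.IsHomotopyOrthogonal (ρ i) (HSketch.Ps.of M)) ∧
        (S.IsHomotopyModel M ↔ ∀ (D : Cat.{u, u}) (i),
          HSketch.IsHomotopyOrthogonal (ρ i) (HSketch.Ps.of (HSketch.homFunctor D M))) := by
  have h₁ (i : S.ι) := (S.cone i).exists_isRho (S.cofibrant i)
  have h₂ (P : S.ι → HSketch.Ps B) (ρ : ∀ i, P i ⟶ ((HSketch.yoneda B).obj (S.cone i).L).unop)
      (hρ : ∀ i, (S.cone i).IsRho (ρ i)) (M : StrictPseudofunctor B Cat.{u, u}) :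
      S.IsHomotopyModel M ↔ ∀ i, HSketch.IsHomotopyOrthogonal (ρ i) (HSketch.Ps.of M) :=
    -- Cone by cone, both conditions say that the transposed cone `M L ⥤ [E, Cat](G, M F-)` is an
    -- equivalence.
    forall_congr' fun i => (HSketch.isHomotopyLimit_iff_transpose (S.cofibrant i) _).trans
      ((hρ i).isHomotopyOrthogonal_iff (S.cofibrant i) M).symm
  refine ⟨?_, h₁, fun P ρ hρ M => ⟨h₂ P ρ hρ M, ?_⟩⟩
  · choose P ρ hρ using h₁
    exact ⟨S.ι, P, _, ρ, fun X => h₂ P ρ hρ X⟩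
  -- With the cone fixed, the definition of a homotopy limit already quantifies over `D`, so the two
  -- conditions are compared at each `D` separately.
  · rw [forall_comm]
    exact forall_congr' fun i => forall_congr' fun D =>
      (HSketch.transpose_cotensor_isEquivalence_iff (S.cone i).γ M D (S.cofibrant i)).symm.trans
        ((hρ i).isHomotopyOrthogonal_iff (S.cofibrant i) (HSketch.homFunctor D M)).symm
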